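/- Let $0\le v\le u$ be integers, let $O$ be one of the following algebras of functions over a field $k$, with coordinates $z_1,\dots,z_u$ and partial derivatives $\partial_1,\dots,\partial_u$: 1. (affine space) $O=k[z_1,\dots,z_u]$, $\operatorname{char}k=0$; 2. (formal disk) $O=k[[z_1,\dots,z_u]]$, $\operatorname{char}k=0$; 3. (complex analytic disk) $k=\mathbb C$ and $O$ is the algebra of holomorphic functions on a disk $D\subset\mathbb C^u$; 4. (smooth real disk) $k=\mathbb R$ and $O$ is the algebra of $C^\infty$ functions on a disk $D\subset\mathbb R^u$; 5. (divided power polynomials) $\operatorname{char}k=p>0$ and $O$ is the algebra of finite sums $\sum_n c_n z^{[n]}$, $n\in\mathbb Z_{\ge0}^u$, $c_n\in k$, with $z^{[m]}z^{[n]}=\prod_s\binom{m_s+n_s}{m_s}\,z^{[m+n]}$ and $\partial_s z^{[n]}=z^{[n-e_s]}$ (which is $0$ if $n_s=0$); 6. (divided power series) the same as in 5 with arbitrary infinite sums. In 3 and 4 a disk is an open set $D\ni 0$ that together with any point $z$ contains every $w$ with $|w_s|\le|z_s|$ for all $s$; for instance, a polydisk or a ball centred at the origin. Let $\Omega$ be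 the de Rham algebra of differential forms on the disk with logarithmic singularities along the hyperplanes $\{z_s=0\}$, $s\le v$; that is, $\Omega$ is the exterior algebra over $O$ on the free generators $\omega_s=dz_s/z_s$ for $s\le v$ and $\omega_s=dz_s$ for $s>v$, with the differential given by $d\omega_s=0$ and $df=\sum_{s\le v}z_s\partial_s(f)\,\omega_s+\sum_{s>v}\partial_s(f)\,\omega_s$ for $f\in O$. Let $Z=\bigoplus_n Z^n=\ker d\subset\Omega$ be the graded algebra of closed forms. A graded $k$-algebra $B=\bigoplus_{n\ge0}B_n$ is called Koszul if $B_0=k$ and $\operatorname{Tor}^B_{ij}(k,k)=0$ for all $i\ne j$, where $i$ is the homological and $j$ the internal grading; these spaces are the homology of the reduced bar complex of $B$. No finite-dimensionality of the $B_n$ is required. Then in cases 1–4 the algebra $Z$ is Koszul for all $0\le v\le u$. In cases 5 and 6 the algebra $Z$ is Koszul when $v=0$, and for all $0\le v\le u$ the algebra $k\oplus Z^1\oplus Z^2\oplus\cdots$ is Koszul. -/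

import Mathlib

open scoped TensorProduct ContDiff

/-! ### Graded algebras, the bar complex and Koszulity -/

section Koszul

variable {k B : Type*} [Field k] [Ring B] [Algebra k B]

private theorem contractNth_update_lt {n : ℕ} [DecidableEq (Fin (n + 1))] (s : Fin n)
    (a : Fin (n + 1) → B) (i : Fin (n + 1)) (x : B) (h : (i : ℕ) < s) :
    Fin.contractNth s.castSucc (· * ·) (Function.update a i x) =
      Function.update (Fin.contractNth s.castSucc (· * ·) a) ⟨i, by omega⟩ x := by
  funext t
  simp only [Fin.contractNth, Function.update_apply, Fin.ext_iff, Fin.val_castSucc, Fin.val_succ]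
  split_ifs <;> first | rfl | omega

private theorem contractNth_update_gt {n : ℕ} [DecidableEq (Fin (n + 1))] (s : Fin n)
    (a : Fin (n + 1) → B) (i : Fin (n + 1)) (x : B) (h : (s : ℕ) + 1 < i) :
    Fin.contractNth s.castSucc (· * ·) (Function.update a i x) =
      Function.update (Fin.contractNth s.castSucc (· * ·) a) ⟨i - 1, by omega⟩ x := by
  funext t
  simp only [Fin.contractNth, Function.update_apply, Fin.ext_iff, Fin.val_castSucc, Fin.val_succ]
  split_ifs <;> first | rfl | omega

private theorem contractNth_update_eq {n : ℕ} [DecidableEq (Fin (n + 1))] (s : Fin n)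
    (a : Fin (n + 1) → B) (i : Fin (n + 1)) (x : B) (h : (i : ℕ) = s) :
    Fin.contractNth s.castSucc (· * ·) (Function.update a i x) =
      Function.update (Fin.contractNth s.castSucc (· * ·) a) s (x * a s.succ) := by
  funext t
  by_cases ht : t = s
  · subst ht
    simp only [Fin.contractNth, Function.update_apply, Fin.ext_iff, Fin.val_castSucc, Fin.val_succ]
    simp [h]
  · have ht' : (t : ℕ) ≠ s := fun h' => ht (Fin.ext h')
    simp only [Fin.contractNth, Function.update_apply, Fin.ext_iff, Fin.val_castSucc, Fin.val_succ]
    split_ifs <;> first | rfl | omega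

private theorem contractNth_update_succ {n : ℕ} [DecidableEq (Fin (n + 1))] (s : Fin n)
    (a : Fin (n + 1) → B) (i : Fin (n + 1)) (x : B) (h : (i : ℕ) = s + 1) :
    Fin.contractNth s.castSucc (· * ·) (Function.update a i x) =
      Function.update (Fin.contractNth s.castSucc (· * ·) a) s (a s.castSucc * x) := by
  funext t
  by_cases ht : t = s
  · subst ht
    simp only [Fin.contractNth, Function.update_apply, Fin.ext_iff, Fin.val_castSucc, Fin.val_succ]
    simp [h]
  · have ht' : (t : ℕ) ≠ s := fun h' => ht (Fin.ext h')
    simp only [Fin.contractNth, Function.update_apply, Fin.ext_iff, Fin.val_castSucc, Fin.val_succ]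
    split_ifs <;> first | rfl | omega

variable (k B) in
/-- The face map `a₀ ⊗ ⋯ ⊗ aₙ ↦ a₀ ⊗ ⋯ ⊗ aₛ aₛ₊₁ ⊗ ⋯ ⊗ aₙ` of the bar complex. -/
noncomputable def barFace (n : ℕ) (s : Fin n) : (⨂[k]^(n + 1) B) →ₗ[k] (⨂[k]^n B) :=
  PiTensorProduct.lift
    { toFun := fun a => PiTensorProduct.tprod k (Fin.contractNth s.castSucc (· * ·) a)
      map_update_add' := by
        intro _ a i x y
        rcases lt_trichotomy (i : ℕ) s with h | h | h
        · simp only [contractNth_update_lt s a i _ h, MultilinearMap.map_update_add]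
        · simp only [contractNth_update_eq s a i _ h, add_mul, MultilinearMap.map_update_add]
        · rcases Nat.lt_or_ge ((s : ℕ) + 1) i with h' | h'
          · simp only [contractNth_update_gt s a i _ h', MultilinearMap.map_update_add]
          · have h'' : (i : ℕ) = s + 1 := by omega
            simp only [contractNth_update_succ s a i _ h'', mul_add,
              MultilinearMap.map_update_add]
      map_update_smul' := by
        intro _ a i c x
        rcases lt_trichotomy (i : ℕ) s with h | h | h
        · simp only [contractNth_update_lt s a i _ h, MultilinearMap.map_update_smul]
        · simp only [contractNth_update_eq s a i _ h, smul_mul_assoc,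
            MultilinearMap.map_update_smul]
        · rcases Nat.lt_or_ge ((s : ℕ) + 1) i with h' | h'
          · simp only [contractNth_update_gt s a i _ h', MultilinearMap.map_update_smul]
          · have h'' : (i : ℕ) = s + 1 := by omega
            simp only [contractNth_update_succ s a i _ h'', mul_smul_comm,
              MultilinearMap.map_update_smul] }

variable (k B) in
/-- The bar differential
`a₀ ⊗ ⋯ ⊗ aₙ ↦ ∑ₛ (-1)ˢ a₀ ⊗ ⋯ ⊗ aₛ aₛ₊₁ ⊗ ⋯ ⊗ aₙ`, from homological degree `n + 1` to `n`. -/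
noncomputable def barDifferential (n : ℕ) : (⨂[k]^(n + 1) B) →ₗ[k] (⨂[k]^n B) :=
  ∑ s : Fin n, (-1 : k) ^ (s : ℕ) • barFace k B n s

/-- The component of homological degree `i` and internal degree `j` of the reduced bar complex
of a graded algebra `B = ⨁ₙ 𝒜ₙ`: the direct sum of `𝒜_{n₁} ⊗ ⋯ ⊗ 𝒜_{nᵢ}` over all
`n₁, …, nᵢ ≥ 1` with `n₁ + ⋯ + nᵢ = j`, realized inside `B^{⊗ i}`. -/
def barComponent (𝒜 : ℕ → Submodule k B) (i j : ℕ) : Submodule k (⨂[k]^i B) :=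
  Submodule.span k
    {t | ∃ (n : Fin i → ℕ) (a : Fin i → B), (∀ s, 1 ≤ n s ∧ a s ∈ 𝒜 (n s)) ∧
      ∑ s, n s = j ∧ t = PiTensorProduct.tprod k a}

/-- Cycles of bidegree `(i, j)` in the reduced bar complex. -/
noncomputable def barCycles (𝒜 : ℕ → Submodule k B) :
    (i j : ℕ) → Submodule k (⨂[k]^i B)
  | 0, j => barComponent 𝒜 0 j
  | i + 1, j => barComponent 𝒜 (i + 1) j ⊓ LinearMap.ker (barDifferential k B i)

/-- Boundaries of bidegree `(i, j)` in the reduced bar complex. -/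
noncomputable def barBoundaries (𝒜 : ℕ → Submodule k B) (i j : ℕ) :
    Submodule k (⨂[k]^i B) :=
  (barComponent 𝒜 (i + 1) j).map (barDifferential k B i)

/-- `Tor^B_{ij}(k, k)` of a nonnegatively graded algebra `B = ⨁ₙ 𝒜ₙ` with `𝒜₀ = k`, with
homological grading `i` and internal grading `j`: the homology of the reduced bar complex. -/
abbrev BarTor (𝒜 : ℕ → Submodule k B) (i j : ℕ) : Type _ :=
  barCycles 𝒜 i j ⧸ (barBoundaries 𝒜 i j).submoduleOf (barCycles 𝒜 i j)

/-- A nonnegatively graded algebra `B = ⨁ₙ 𝒜ₙ` over a field `k` is Koszul if `𝒜₀ = k` and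
`Tor^B_{ij}(k, k) = 0` for all `i ≠ j`. -/
def IsKoszul (𝒜 : ℕ → Submodule k B) [GradedAlgebra 𝒜] : Prop :=
  Function.Bijective (algebraMap k (𝒜 0)) ∧ ∀ i j : ℕ, i ≠ j → Subsingleton (BarTor 𝒜 i j)

end Koszul

section GradedSubalgebra

variable {k K B : Type*} [CommRing k] [CommRing K] [Algebra k K] [Ring B] [Algebra k B]
  [Algebra K B] [IsScalarTower k K B]

/-- The grading induced on a `k`-subalgebra of a graded `K`-algebra. -/
def inducedGrading (𝒜 : ℕ → Submodule K B) (S : Subalgebra k B) (n : ℕ) : Submodule k S :=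
  ((𝒜 n).restrictScalars k).comap S.val.toLinearMap

theorem inducedGrading_isInternal (𝒜 : ℕ → Submodule K B) [GradedAlgebra 𝒜]
    (S : Subalgebra k B) (hS : ∀ (n : ℕ), ∀ x ∈ S, (DirectSum.decompose 𝒜 x n : B) ∈ S) :
    DirectSum.IsInternal (inducedGrading 𝒜 S) := by
  classical
  have key : ∀ (y : DirectSum ℕ fun i => inducedGrading 𝒜 S i) (n : ℕ),
      (DirectSum.decompose 𝒜
        ((DirectSum.coeAddMonoidHom (inducedGrading 𝒜 S) y : S) : B) n : B) =
        ((y n : S) : B) := by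
    intro y n
    induction y using DirectSum.induction_on with
    | zero => simp
    | of i x =>
      have hx : ((x : S) : B) ∈ 𝒜 i := x.2
      rw [DirectSum.coeAddMonoidHom_of]
      by_cases h : i = n
      · subst h
        rw [DirectSum.decompose_of_mem_same 𝒜 hx, DirectSum.of_eq_same]
      · rw [DirectSum.decompose_of_mem_ne 𝒜 hx h, DirectSum.of_eq_of_ne _ _ _ (Ne.symm h)]
        rfl
    | add x y hx hy =>
      simp only [map_add, Subalgebra.coe_add, DirectSum.decompose_add, DirectSum.add_apply,
        Submodule.coe_add, hx, hy]
  constructor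
  · intro y y' h
    refine DFinsupp.ext fun n => ?_
    apply Subtype.ext
    apply Subtype.ext
    rw [← key y n, ← key y' n, h]
  · intro x
    refine ⟨∑ n ∈ DFinsupp.support (DirectSum.decompose 𝒜 (x : B)),
      DirectSum.of (fun i => inducedGrading 𝒜 S i) n
        ⟨⟨_, hS n x x.2⟩, (DirectSum.decompose 𝒜 (x : B) n).2⟩, ?_⟩
    rw [map_sum]
    simp only [DirectSum.coeAddMonoidHom_of]
    apply Subtype.ext
    rw [AddSubmonoidClass.coe_finsetSum]
    exact DirectSum.sum_support_decompose 𝒜 (x : B)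

/-- A homogeneous subalgebra of a graded algebra is a graded algebra. -/
@[reducible]
noncomputable def inducedGradedAlgebra (𝒜 : ℕ → Submodule K B) [GradedAlgebra 𝒜]
    (S : Subalgebra k B) (hS : ∀ (n : ℕ), ∀ x ∈ S, (DirectSum.decompose 𝒜 x n : B) ∈ S) :
    GradedAlgebra (inducedGrading 𝒜 S) where
  one_mem := SetLike.GradedOne.one_mem (A := 𝒜)
  mul_mem _ _ _ _ hx hy := SetLike.GradedMul.mul_mem (A := 𝒜) hx hy
  toDecomposition := (inducedGrading_isInternal 𝒜 S hS).chooseDecomposition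

end GradedSubalgebra

section ConnectedPart

variable {k B : Type*} [Field k] [Ring B] [Algebra k B]

/-- For a nonnegatively graded `k`-algebra `B = ⨁ₙ 𝒜ₙ`, the graded subalgebra
`k ⊕ 𝒜₁ ⊕ 𝒜₂ ⊕ ⋯`. -/
noncomputable def connectedPart (𝒜 : ℕ → Submodule k B) [GradedAlgebra 𝒜] : Subalgebra k B where
  carrier := {x | (DirectSum.decompose 𝒜 x 0 : B) ∈ (⊥ : Subalgebra k B)}
  mul_mem' {x y} hx hy := by
    have h := (GradedRing.projZeroRingHom 𝒜).map_mul x y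
    simp only [GradedRing.projZeroRingHom_apply] at h
    rw [Set.mem_ofPred_eq, h]
    exact mul_mem hx hy
  add_mem' {x y} hx hy := by
    rw [Set.mem_ofPred_eq, DirectSum.decompose_add, DirectSum.add_apply, Submodule.coe_add]
    exact add_mem hx hy
  algebraMap_mem' c := by
    rw [Set.mem_ofPred_eq,
      DirectSum.decompose_of_mem_same 𝒜 (SetLike.algebraMap_mem_graded 𝒜 c)]
    exact Subalgebra.algebraMap_mem _ c

/-- The grading of `k ⊕ 𝒜₁ ⊕ 𝒜₂ ⊕ ⋯`. -/
noncomputable def connectedGrading (𝒜 : ℕ → Submodule k B) [GradedAlgebra 𝒜] :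
    ℕ → Submodule k (connectedPart 𝒜) :=
  inducedGrading 𝒜 (connectedPart 𝒜)

noncomputable instance connectedGrading.gradedAlgebra (𝒜 : ℕ → Submodule k B)
    [GradedAlgebra 𝒜] : GradedAlgebra (connectedGrading 𝒜) :=
  inducedGradedAlgebra 𝒜 (connectedPart 𝒜) (by
    intro n x hx
    change (DirectSum.decompose 𝒜 (DirectSum.decompose 𝒜 x n : B) 0 : B) ∈ (⊥ : Subalgebra k B)
    by_cases h : n = 0
    · subst h
      rw [DirectSum.decompose_of_mem_same 𝒜 (DirectSum.decompose 𝒜 x 0).2]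
      exact hx
    · rw [DirectSum.decompose_of_mem_ne 𝒜 (DirectSum.decompose 𝒜 x n).2 h]
      exact zero_mem _)

end ConnectedPart

/-! ### Logarithmic differential forms

In this section `O` is the algebra of functions on a disk with coordinates `z₁, …, zᵤ` and `∂` is
the family of partial derivatives.  The first `v` coordinates are the ones along whose zero loci
logarithmic poles are allowed. -/

section LogForms

variable {k O : Type*} [Field k] [CommRing O] [Algebra k O] {u : ℕ}

variable (k O u) in
/-- The algebra `Ω` of logarithmic differential forms: the exterior algebra over `O` on the
generators `ω₁, …, ωᵤ`, where `ωₛ = dzₛ/zₛ` for `s ≤ v` and `ωₛ = dzₛ` for `s > v`.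
Elements are the finite sums of `f ωₛ₁ ∧ ⋯ ∧ ωₛₙ` with `f ∈ O`. -/
abbrev LogForms : Type _ := O ⊗[k] ExteriorAlgebra k (Fin u → k)

variable (k O u) in
/-- Logarithmic forms of degree `n`. -/
abbrev logFormsGrading (n : ℕ) : Submodule O (LogForms k O u) :=
  (⋀[k]^n (Fin u → k)).baseChange O

variable (k) in
/-- The generator `ωₛ` of the exterior algebra. -/
noncomputable abbrev logGenerator (s : Fin u) : ExteriorAlgebra k (Fin u → k) :=
  ExteriorAlgebra.ι k (Pi.single s 1)

/-- The derivation of `O` dual to `ωₛ`: it is `zₛ ∂ₛ` for the first `v` indices and `∂ₛ` for the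
others, so that `df = ∑ₛ logDerivation s f · ωₛ`. -/
noncomputable def logDerivation (z : Fin u → O) (D : Fin u → Derivation k O O) (v : ℕ)
    (s : Fin u) : Derivation k O O :=
  if (s : ℕ) < v then z s • D s else D s

/-- The de Rham differential on logarithmic forms:
`d (f ω) = ∑ₛ logDerivation s f · ωₛ ∧ ω` for `ω` a product of generators. -/
noncomputable def deRham (z : Fin u → O) (D : Fin u → Derivation k O O) (v : ℕ) :
    LogForms k O u →ₗ[k] LogForms k O u :=
  ∑ s : Fin u, TensorProduct.map (logDerivation z D v s : O →ₗ[k] O)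
    (LinearMap.mulLeft k (logGenerator k s))

theorem deRham_tmul (z : Fin u → O) (D : Fin u → Derivation k O O) (v : ℕ) (f : O)
    (a : ExteriorAlgebra k (Fin u → k)) :
    deRham z D v (f ⊗ₜ[k] a) =
      ∑ s : Fin u, logDerivation z D v s f ⊗ₜ[k] (logGenerator k s * a) := by
  simp [deRham, LinearMap.sum_apply]

variable (k O u) in
/-- The grade involution `ω ↦ (-1)ⁿ ω` for `ω` of degree `n`. -/
noncomputable def gradeInvolution : LogForms k O u →ₐ[k] LogForms k O u :=
  Algebra.TensorProduct.map (AlgHom.id k O) CliffordAlgebra.involute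

private theorem ι_mul_eq_involute_mul (m : Fin u → k) (a : ExteriorAlgebra k (Fin u → k)) :
    ExteriorAlgebra.ι k m * a = CliffordAlgebra.involute a * ExteriorAlgebra.ι k m := by
  induction a using ExteriorAlgebra.induction with
  | algebraMap r => rw [AlgHom.commutes, Algebra.commutes]
  | ι x =>
    have h1 : CliffordAlgebra.involute (ExteriorAlgebra.ι k x) = - ExteriorAlgebra.ι k x :=
      CliffordAlgebra.involute_ι x
    have h2 := ExteriorAlgebra.ι_add_mul_swap (R := k) m x
    rw [h1, neg_mul, eq_neg_iff_add_eq_zero, h2]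
  | mul a b ha hb =>
    rw [map_mul, ← mul_assoc, ha, mul_assoc, hb, mul_assoc]
  | add a b ha hb => rw [mul_add, map_add, add_mul, ha, hb]

/-- The graded Leibniz rule. -/
theorem deRham_mul (z : Fin u → O) (D : Fin u → Derivation k O O) (v : ℕ)
    (x y : LogForms k O u) :
    deRham z D v (x * y) = deRham z D v x * y + gradeInvolution k O u x * deRham z D v y := by
  induction x using TensorProduct.induction_on with
  | zero => simp
  | add x x' hx hx' => simp only [add_mul, map_add, hx, hx']; abel
  | tmul f a =>
    induction y using TensorProduct.induction_on with
    | zero => simp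
    | add y y' hy hy' => simp only [mul_add, map_add, hy, hy']; abel
    | tmul g b =>
      rw [gradeInvolution, Algebra.TensorProduct.map_tmul, Algebra.TensorProduct.tmul_mul_tmul,
        deRham_tmul, deRham_tmul, deRham_tmul, Finset.sum_mul, Finset.mul_sum,
        ← Finset.sum_add_distrib]
      refine Finset.sum_congr rfl fun s _ => ?_
      rw [Algebra.TensorProduct.tmul_mul_tmul, Algebra.TensorProduct.tmul_mul_tmul,
        Derivation.leibniz, AlgHom.id_apply, ← mul_assoc (CliffordAlgebra.involute a),
        ← ι_mul_eq_involute_mul, TensorProduct.add_tmul, smul_eq_mul, smul_eq_mul, mul_assoc,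
        add_comm, mul_comm g]

/-- The algebra `Z` of closed logarithmic forms. -/
noncomputable def closedForms (z : Fin u → O) (D : Fin u → Derivation k O O) (v : ℕ) :
    Subalgebra k (LogForms k O u) where
  carrier := {x | deRham z D v x = 0}
  mul_mem' {x y} hx hy := by
    rw [Set.mem_ofPred_eq] at hx hy ⊢
    rw [deRham_mul, hx, hy, zero_mul, mul_zero, add_zero]
  add_mem' {x y} hx hy := by
    rw [Set.mem_ofPred_eq] at hx hy ⊢
    rw [map_add, hx, hy, add_zero]
  algebraMap_mem' c := by
    rw [Set.mem_ofPred_eq, Algebra.TensorProduct.algebraMap_apply, deRham_tmul]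
    simp

/-- The closed logarithmic forms of degree `n`. -/
noncomputable def closedGrading (z : Fin u → O) (D : Fin u → Derivation k O O) (v : ℕ) :
    ℕ → Submodule k (closedForms z D v) :=
  inducedGrading (logFormsGrading k O u) (closedForms z D v)

theorem deRham_mem (z : Fin u → O) (D : Fin u → Derivation k O O) (v : ℕ) {n : ℕ}
    {x : LogForms k O u} (hx : x ∈ logFormsGrading k O u n) :
    deRham z D v x ∈ logFormsGrading k O u (n + 1) := by
  obtain ⟨x, rfl⟩ := Submodule.toBaseChange_surjective' _ _ hx
  clear hx
  induction x using TensorProduct.induction_on with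
  | zero => simp
  | add x y ihx ihy =>
    rw [map_add, Submodule.coe_add, map_add]
    exact add_mem ihx ihy
  | tmul f a =>
    rw [Submodule.coe_toBaseChange_tmul, deRham_tmul]
    refine sum_mem fun s _ => Submodule.tmul_mem_baseChange_of_mem _ ?_
    have h1 : logGenerator k s ∈ ⋀[k]^1 (Fin u → k) := by
      change _ ∈ LinearMap.range (ExteriorAlgebra.ι k) ^ 1
      rw [pow_one]; exact ⟨_, rfl⟩
    rw [add_comm]
    exact SetLike.mul_mem_graded (A := fun n => ⋀[k]^n (Fin u → k)) h1 a.2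

theorem decompose_deRham (z : Fin u → O) (D : Fin u → Derivation k O O) (v : ℕ) (n : ℕ)
    (x : LogForms k O u) :
    (DirectSum.decompose (logFormsGrading k O u) (deRham z D v x) (n + 1) : LogForms k O u) =
      deRham z D v (DirectSum.decompose (logFormsGrading k O u) x n) := by
  induction x using DirectSum.Decomposition.inductionOn (logFormsGrading k O u) with
  | zero => simp
  | add x y hx hy =>
    simp only [map_add, DirectSum.decompose_add, DirectSum.add_apply, Submodule.coe_add, hx, hy]
  | @homogeneous i m =>
    have hm := deRham_mem z D v m.2
    by_cases h : i = n
    · subst h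
      rw [DirectSum.decompose_of_mem_same _ hm, DirectSum.decompose_of_mem_same _ m.2]
    · rw [DirectSum.decompose_of_mem_ne _ hm (by omega),
        DirectSum.decompose_of_mem_ne _ m.2 h, map_zero]

noncomputable instance closedGrading.gradedAlgebra (z : Fin u → O)
    (D : Fin u → Derivation k O O) (v : ℕ) : GradedAlgebra (closedGrading z D v) :=
  inducedGradedAlgebra (logFormsGrading k O u) (closedForms z D v) (by
    intro n x hx
    change deRham z D v _ = 0
    rw [← decompose_deRham, show deRham z D v x = 0 from hx]
    simp)

end LogForms

/-! ### Smooth and holomorphic functions -/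

section Smooth

variable (𝕜 : Type*) [RCLike 𝕜] {u : ℕ}

/-- An open neighbourhood `D` of the origin in `𝕜ᵘ` that with any point `z` contains all `w` with
`|wₛ| ≤ |zₛ|` for all `s` (a complete Reinhardt domain when `𝕜 = ℂ`).  Polydisks and balls centred
at the origin, of finite or infinite radii, are of this form. -/
structure IsReinhardtDisk (D : Set (Fin u → 𝕜)) : Prop where
  isOpen : IsOpen D
  zero_mem : (0 : Fin u → 𝕜) ∈ D
  mem_of_norm_le : ∀ z ∈ D, ∀ w : Fin u → 𝕜, (∀ s, ‖w s‖ ≤ ‖z s‖) → w ∈ D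

variable {𝕜}

/-- The extension by zero of a function on `D`. -/
noncomputable def extendZero {D : Set (Fin u → 𝕜)} (f : D → 𝕜) : (Fin u → 𝕜) → 𝕜 :=
  Function.extend Subtype.val f 0

theorem extendZero_coe {D : Set (Fin u → 𝕜)} (f : D → 𝕜) (x : D) : extendZero f x = f x :=
  Subtype.val_injective.extend_apply f 0 x

/-- The algebra of infinitely `𝕜`-differentiable functions `D → 𝕜`, for `D` an open subset of
`𝕜ᵘ`: smooth functions if `𝕜 = ℝ`, holomorphic functions if `𝕜 = ℂ`. -/
noncomputable def smoothFunctions (D : TopologicalSpace.Opens (Fin u → 𝕜)) :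
    Subalgebra 𝕜 (D → 𝕜) where
  carrier := {f | ContDiffOn 𝕜 ∞ (extendZero (D := (D : Set (Fin u → 𝕜))) f) D}
  mul_mem' {f g} hf hg := by
    rw [Set.mem_ofPred_eq] at hf hg ⊢
    refine (hf.mul hg).congr fun x hx => ?_
    rw [extendZero_coe _ (⟨x, hx⟩ : (D : Set (Fin u → 𝕜))),
      extendZero_coe _ (⟨x, hx⟩ : (D : Set (Fin u → 𝕜))),
      extendZero_coe _ (⟨x, hx⟩ : (D : Set (Fin u → 𝕜)))]
    rfl
  add_mem' {f g} hf hg := by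
    rw [Set.mem_ofPred_eq] at hf hg ⊢
    refine (hf.add hg).congr fun x hx => ?_
    rw [extendZero_coe _ (⟨x, hx⟩ : (D : Set (Fin u → 𝕜))),
      extendZero_coe _ (⟨x, hx⟩ : (D : Set (Fin u → 𝕜))),
      extendZero_coe _ (⟨x, hx⟩ : (D : Set (Fin u → 𝕜)))]
    rfl
  algebraMap_mem' c := by
    rw [Set.mem_ofPred_eq]
    refine (contDiffOn_const (c := c)).congr fun x hx => ?_
    rw [extendZero_coe _ (⟨x, hx⟩ : (D : Set (Fin u → 𝕜)))]
    rfl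

namespace smoothFunctions

variable (D : TopologicalSpace.Opens (Fin u → 𝕜))

/-- The coordinate function `zₛ`. -/
noncomputable def coord (s : Fin u) : smoothFunctions D :=
  ⟨fun x => (x : Fin u → 𝕜) s, by
    change ContDiffOn 𝕜 ∞ (extendZero (D := (D : Set (Fin u → 𝕜))) _) D
    refine (contDiff_apply 𝕜 𝕜 s).contDiffOn.congr fun x hx => ?_
    rw [extendZero_coe _ (⟨x, hx⟩ : (D : Set (Fin u → 𝕜)))]⟩

variable {D}

theorem differentiableAt (f : smoothFunctions D) (x : D) :
    DifferentiableAt 𝕜 (extendZero (D := (D : Set (Fin u → 𝕜))) f.1) x :=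
  ((show ContDiffOn 𝕜 ∞ _ _ from f.2).contDiffAt (D.isOpen.mem_nhds x.2)).differentiableAt
    (by simp)

theorem hasFDerivAt_of_eqOn (f : smoothFunctions D) (x : D) {g : (Fin u → 𝕜) → 𝕜}
    {g' : (Fin u → 𝕜) →L[𝕜] 𝕜} (hg : HasFDerivAt g g' x)
    (h : ∀ y : D, f.1 y = g y) :
    fderiv 𝕜 (extendZero (D := (D : Set (Fin u → 𝕜))) f.1) x = g' := by
  refine (hg.congr_of_eventuallyEq ?_).fderiv
  filter_upwards [D.isOpen.mem_nhds x.2] with y hy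
  rw [← h ⟨y, hy⟩]
  exact extendZero_coe _ (⟨y, hy⟩ : (D : Set (Fin u → 𝕜)))

variable (D) in
/-- The partial derivative `∂/∂zₛ`. -/
noncomputable def partialDeriv (s : Fin u) :
    Derivation 𝕜 (smoothFunctions D) (smoothFunctions D) :=
  Derivation.mk'
    { toFun := fun f =>
        ⟨fun x => fderiv 𝕜 (extendZero (D := (D : Set (Fin u → 𝕜))) f.1) x (Pi.single s 1), by
          change ContDiffOn 𝕜 ∞ (extendZero (D := (D : Set (Fin u → 𝕜))) _) D
          have h : ContDiffOn 𝕜 ∞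
              (fun x => fderiv 𝕜 (extendZero (D := (D : Set (Fin u → 𝕜))) f.1) x
                (Pi.single s 1)) D :=
            ((show ContDiffOn 𝕜 ∞ _ _ from f.2).fderiv_of_isOpen D.isOpen
              (by simp)).clm_apply contDiffOn_const
          refine h.congr fun x hx => ?_
          rw [extendZero_coe _ (⟨x, hx⟩ : (D : Set (Fin u → 𝕜)))]⟩
      map_add' := fun f g => by
        apply Subtype.ext
        funext x
        change fderiv 𝕜 (extendZero (D := (D : Set (Fin u → 𝕜))) (f + g).1) x (Pi.single s 1) =
          fderiv 𝕜 (extendZero (D := (D : Set (Fin u → 𝕜))) f.1) x (Pi.single s 1) +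
          fderiv 𝕜 (extendZero (D := (D : Set (Fin u → 𝕜))) g.1) x (Pi.single s 1)
        rw [hasFDerivAt_of_eqOn (f + g) x
          ((differentiableAt f x).hasFDerivAt.add (differentiableAt g x).hasFDerivAt)]
        · rfl
        · intro y
          simp only [Pi.add_apply]
          rw [extendZero_coe f.1 y, extendZero_coe g.1 y]
          rfl
      map_smul' := fun c f => by
        apply Subtype.ext
        funext x
        change fderiv 𝕜 (extendZero (D := (D : Set (Fin u → 𝕜))) (c • f).1) x (Pi.single s 1) =
          c • fderiv 𝕜 (extendZero (D := (D : Set (Fin u → 𝕜))) f.1) x (Pi.single s 1)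
        rw [hasFDerivAt_of_eqOn (c • f) x ((differentiableAt f x).hasFDerivAt.const_smul c)]
        · rfl
        · intro y
          simp only [Pi.smul_apply]
          rw [extendZero_coe f.1 y]
          rfl }
    (by
      intro f g
      apply Subtype.ext
      funext x
      change fderiv 𝕜 (extendZero (D := (D : Set (Fin u → 𝕜))) (f * g).1) x (Pi.single s 1) =
        f.1 x * fderiv 𝕜 (extendZero (D := (D : Set (Fin u → 𝕜))) g.1) x (Pi.single s 1) +
        g.1 x * fderiv 𝕜 (extendZero (D := (D : Set (Fin u → 𝕜))) f.1) x (Pi.single s 1)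
      rw [hasFDerivAt_of_eqOn (f * g) x
        ((differentiableAt f x).hasFDerivAt.mul (differentiableAt g x).hasFDerivAt)]
      · rw [extendZero_coe f.1 x, extendZero_coe g.1 x]
        rfl
      · intro y
        simp only [Pi.mul_apply]
        rw [extendZero_coe f.1 y, extendZero_coe g.1 y]
        rfl)

end smoothFunctions

end Smooth

/-! ### Power series and polynomials with divided powers -/

/-- Formal power series with divided powers in `u` variables: the formal infinite sums
`∑ₙ cₙ z^[n]` over multi-indices `n`, where `z^[n]` stands for `z₁^{n₁}/n₁! ⋯ zᵤ^{nᵤ}/nᵤ!`.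
They are multiplied by `z^[m] z^[n] = ∏ₛ (mₛ + nₛ choose mₛ) z^[m + n]`. -/
@[ext]
structure DPSeries (u : ℕ) (k : Type*) where
  coeff : (Fin u →₀ ℕ) → k

namespace DPSeries

variable {u : ℕ} {k : Type*} [Field k]

/-- The structure constant `∏ₛ (mₛ + nₛ choose mₛ)`. -/
def binom (m n : Fin u →₀ ℕ) : ℕ := ∏ s, (m s + n s).choose (m s)

theorem binom_assoc (a b c : Fin u →₀ ℕ) :
    binom a b * binom (a + b) c = binom b c * binom a (b + c) := by
  simp only [binom, ← Finset.prod_mul_distrib, Finsupp.add_apply]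
  refine Finset.prod_congr rfl fun s _ => ?_
  have key : ∀ p q : ℕ, (p + q).choose p * p.factorial * q.factorial = (p + q).factorial :=
    fun p q => by rw [Nat.choose_symm_add]; exact Nat.add_choose_mul_factorial_mul_factorial p q
  have h1 := key (a s) (b s)
  have h2 := key (a s + b s) (c s)
  have h3 := key (b s) (c s)
  have h4 := key (a s) (b s + c s)
  have hp : 0 < (a s).factorial * (b s).factorial * (c s).factorial := by positivity
  refine Nat.eq_of_mul_eq_mul_right hp ?_
  rw [← add_assoc] at h4
  calc _ = (a s + b s + c s).choose (a s + b s) *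
        ((a s + b s).choose (a s) * (a s).factorial * (b s).factorial) * (c s).factorial := by ring
    _ = (a s + b s + c s).factorial := by rw [h1, h2]
    _ = (a s + b s + c s).choose (a s) * (a s).factorial *
        ((b s + c s).choose (b s) * (b s).factorial * (c s).factorial) := by rw [h3, h4]
    _ = _ := by rw [← add_assoc]; ring

theorem binom_comm (a b : Fin u →₀ ℕ) : binom a b = binom b a := by
  simp only [binom]
  refine Finset.prod_congr rfl fun s _ => ?_
  rw [add_comm (b s), Nat.choose_symm_add]

theorem binom_zero_left (b : Fin u →₀ ℕ) : binom 0 b = 1 := by simp [binom]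

instance : Zero (DPSeries u k) := ⟨⟨fun _ => 0⟩⟩
instance : Add (DPSeries u k) := ⟨fun f g => ⟨fun n => f.coeff n + g.coeff n⟩⟩
instance : Neg (DPSeries u k) := ⟨fun f => ⟨fun n => - f.coeff n⟩⟩

/-- The divided monomial `z^[m]` with coefficient `c`. -/
noncomputable def monomial (m : Fin u →₀ ℕ) (c : k) : DPSeries u k := ⟨fun n => if n = m then c else 0⟩

noncomputable instance : One (DPSeries u k) := ⟨monomial 0 1⟩
noncomputable instance : Mul (DPSeries u k) :=
  ⟨fun f g => ⟨fun n => ∑ p ∈ Finset.HasAntidiagonal.antidiagonal n,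
    (binom p.1 p.2 : k) * (f.coeff p.1 * g.coeff p.2)⟩⟩

theorem coeff_zero (n : Fin u →₀ ℕ) : (0 : DPSeries u k).coeff n = 0 := rfl
theorem coeff_add (f g : DPSeries u k) (n : Fin u →₀ ℕ) :
    (f + g).coeff n = f.coeff n + g.coeff n := rfl
theorem coeff_neg (f : DPSeries u k) (n : Fin u →₀ ℕ) : (-f).coeff n = - f.coeff n := rfl
theorem coeff_monomial (m n : Fin u →₀ ℕ) (c : k) :
    (monomial m c).coeff n = if n = m then c else 0 := rfl
theorem coeff_one (n : Fin u →₀ ℕ) : (1 : DPSeries u k).coeff n = if n = 0 then 1 else 0 := rfl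
theorem coeff_mul (f g : DPSeries u k) (n : Fin u →₀ ℕ) :
    (f * g).coeff n = ∑ p ∈ Finset.HasAntidiagonal.antidiagonal n,
      (binom p.1 p.2 : k) * (f.coeff p.1 * g.coeff p.2) := rfl

theorem mul_comm' (f g : DPSeries u k) : f * g = g * f := by
  ext n
  rw [coeff_mul, coeff_mul, Finsupp.sum_antidiagonal_swap n
    (fun a b => (binom a b : k) * (f.coeff a * g.coeff b))]
  refine Finset.sum_congr rfl fun p _ => ?_
  rw [binom_comm, mul_comm (f.coeff _)]

theorem coeff_monomial_zero_mul (c : k) (f : DPSeries u k) (n : Fin u →₀ ℕ) :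
    (monomial 0 c * f).coeff n = c * f.coeff n := by
  rw [coeff_mul, Finset.sum_eq_single (0, n)]
  · simp [coeff_monomial, binom_zero_left]
  · rintro ⟨a, b⟩ hab hne
    rw [Finset.HasAntidiagonal.mem_antidiagonal] at hab
    have ha : a ≠ 0 := by
      rintro rfl
      simp only [zero_add] at hab
      exact hne (by rw [hab])
    simp [coeff_monomial, ha]
  · simp

theorem mul_assoc' (f g h : DPSeries u k) : f * g * h = f * (g * h) := by
  ext n
  simp only [coeff_mul, Finset.sum_mul, Finset.mul_sum, Finset.sum_sigma']
  refine Finset.sum_nbij' (fun x => ⟨(x.2.1, x.2.2 + x.1.2), (x.2.2, x.1.2)⟩)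
    (fun x => ⟨(x.1.1 + x.2.1, x.2.2), (x.1.1, x.2.1)⟩) ?_ ?_ ?_ ?_ ?_
  · rintro ⟨⟨a, b⟩, ⟨c, d⟩⟩ hx
    simp only [Finset.mem_sigma, Finset.HasAntidiagonal.mem_antidiagonal] at hx ⊢
    obtain ⟨h1, h2⟩ := hx
    exact ⟨by rw [← h1, ← h2, add_assoc], trivial⟩
  · rintro ⟨⟨a, b⟩, ⟨c, d⟩⟩ hx
    simp only [Finset.mem_sigma, Finset.HasAntidiagonal.mem_antidiagonal] at hx ⊢
    obtain ⟨h1, h2⟩ := hx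
    exact ⟨by rw [← h1, ← h2, add_assoc], trivial⟩
  · rintro ⟨⟨a, b⟩, ⟨c, d⟩⟩ hx
    simp only [Finset.mem_sigma, Finset.HasAntidiagonal.mem_antidiagonal] at hx
    obtain ⟨h1, rfl⟩ := hx
    rfl
  · rintro ⟨⟨a, b⟩, ⟨c, d⟩⟩ hx
    simp only [Finset.mem_sigma, Finset.HasAntidiagonal.mem_antidiagonal] at hx
    obtain ⟨h1, rfl⟩ := hx
    rfl
  · rintro ⟨⟨a, b⟩, ⟨c, d⟩⟩ hx
    simp only [Finset.mem_sigma, Finset.HasAntidiagonal.mem_antidiagonal] at hx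
    obtain ⟨h1, rfl⟩ := hx
    have hb := congrArg (Nat.cast (R := k)) (binom_assoc c d b)
    push_cast at hb
    dsimp only
    linear_combination (f.coeff c * g.coeff d * h.coeff b) * hb

noncomputable instance : CommRing (DPSeries u k) where
  add_assoc f g h := by ext n; simp only [coeff_add, add_assoc]
  zero_add f := by ext n; simp only [coeff_add, coeff_zero, zero_add]
  add_zero f := by ext n; simp only [coeff_add, coeff_zero, add_zero]
  add_comm f g := by ext n; simp only [coeff_add, add_comm]
  neg_add_cancel f := by ext n; simp only [coeff_add, coeff_neg, coeff_zero, neg_add_cancel]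
  left_distrib f g h := by
    ext n; simp only [coeff_add, coeff_mul, mul_add, Finset.sum_add_distrib]
  right_distrib f g h := by
    ext n; simp only [coeff_add, coeff_mul, add_mul, mul_add, Finset.sum_add_distrib]
  zero_mul f := by ext n; simp [coeff_mul, coeff_zero]
  mul_zero f := by ext n; simp [coeff_mul, coeff_zero]
  mul_assoc := mul_assoc'
  mul_comm := mul_comm'
  one_mul f := by
    ext n
    exact (coeff_monomial_zero_mul 1 f n).trans (one_mul _)
  mul_one f := by
    rw [mul_comm']
    ext n
    exact (coeff_monomial_zero_mul 1 f n).trans (one_mul _)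
  nsmul := nsmulRec
  zsmul := zsmulRec

noncomputable instance : Algebra k (DPSeries u k) where
  smul c f := ⟨fun n => c * f.coeff n⟩
  algebraMap :=
    { toFun := fun c => monomial 0 c
      map_one' := rfl
      map_mul' := fun c d => by
        ext n
        rw [coeff_monomial_zero_mul, coeff_monomial, coeff_monomial]
        split_ifs <;> simp
      map_zero' := by ext n; simp [coeff_monomial, coeff_zero]
      map_add' := fun c d => by
        ext n
        rw [coeff_add, coeff_monomial, coeff_monomial, coeff_monomial]
        split_ifs <;> simp }
  commutes' c f := mul_comm _ _
  smul_def' c f := by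
    ext n
    exact (coeff_monomial_zero_mul c f n).symm

theorem coeff_smul (c : k) (f : DPSeries u k) (n : Fin u →₀ ℕ) :
    (c • f).coeff n = c * f.coeff n := rfl

theorem algebraMap_def (c : k) : algebraMap k (DPSeries u k) c = monomial 0 c := rfl

/-- The coordinate `zₛ = z^[eₛ]`. -/
noncomputable def coord (s : Fin u) : DPSeries u k := monomial (Finsupp.single s 1) 1

theorem binom_add_single (s : Fin u) (a b : Fin u →₀ ℕ) :
    binom (a + Finsupp.single s 1) (b + Finsupp.single s 1) =
      binom a (b + Finsupp.single s 1) + binom (a + Finsupp.single s 1) b := by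
  simp only [binom, ← Finset.mul_prod_erase Finset.univ _ (Finset.mem_univ s),
    Finsupp.add_apply, Finsupp.single_eq_same]
  have h : ∀ t ∈ Finset.univ.erase s, (Finsupp.single s 1 : Fin u →₀ ℕ) t = 0 := fun t ht =>
    Finsupp.single_eq_of_ne (Finset.ne_of_mem_erase ht)
  rw [Finset.prod_congr rfl (fun t ht => by rw [h t ht, add_zero, add_zero] :
      ∀ t ∈ Finset.univ.erase s, _ = (a t + b t).choose (a t)),
    Finset.prod_congr rfl (fun t ht => by rw [h t ht, add_zero] :
      ∀ t ∈ Finset.univ.erase s, (a t + (b t + (Finsupp.single s 1 : Fin u →₀ ℕ) t)).choose (a t)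
        = (a t + b t).choose (a t)),
    Finset.prod_congr rfl (fun t ht => by rw [h t ht, add_zero] :
      ∀ t ∈ Finset.univ.erase s, (a t + (Finsupp.single s 1 : Fin u →₀ ℕ) t + b t).choose
        (a t + (Finsupp.single s 1 : Fin u →₀ ℕ) t) = (a t + b t).choose (a t)),
    ← add_mul]
  congr 1
  rw [show a s + 1 + (b s + 1) = (a s + b s + 1) + 1 by ring, Nat.choose_succ_succ,
    show a s + (b s + 1) = a s + b s + 1 by ring, show a s + 1 + b s = a s + b s + 1 by ring]

theorem binom_add_single_of_eq_zero (s : Fin u) (a b : Fin u →₀ ℕ) (ha : a s = 0) :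
    binom a (b + Finsupp.single s 1) = binom a b := by
  simp only [binom]
  refine Finset.prod_congr rfl fun t _ => ?_
  by_cases h : t = s
  · subst h; simp [ha]
  · rw [Finsupp.add_apply, Finsupp.single_eq_of_ne h, add_zero]

/-- The function underlying `∂/∂zₛ`: it sends `z^[n]` to `z^[n - eₛ]`, and to `0` if `nₛ = 0`. -/
noncomputable def shift (s : Fin u) (f : DPSeries u k) : DPSeries u k :=
  ⟨fun n => f.coeff (n + Finsupp.single s 1)⟩

theorem shift_mul (s : Fin u) (f g : DPSeries u k) :
    shift s (f * g) = f * shift s g + g * shift s f := by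
  classical
  have hsub : ∀ a : Fin u →₀ ℕ, a s ≠ 0 →
      a - Finsupp.single s 1 + Finsupp.single s 1 = a := fun a ha =>
    tsub_add_cancel_of_le (Finsupp.single_le_iff.mpr (Nat.one_le_iff_ne_zero.mpr ha))
  have hsplit : ∀ p : (Fin u →₀ ℕ) × (Fin u →₀ ℕ),
      (p.1 + p.2) s ≠ 0 →
      (binom p.1 p.2 : k) =
        (if p.2 s ≠ 0 then (binom p.1 (p.2 - Finsupp.single s 1) : k) else 0) +
        (if p.1 s ≠ 0 then (binom (p.1 - Finsupp.single s 1) p.2 : k) else 0) := by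
    rintro ⟨a, b⟩ hab
    dsimp only at hab ⊢
    by_cases ha : a s = 0
    · by_cases hb : b s = 0
      · exact absurd (by simp [ha, hb]) hab
      · have := binom_add_single_of_eq_zero s a (b - Finsupp.single s 1) ha
        rw [hsub b hb] at this
        simp [ha, hb, this]
    · by_cases hb : b s = 0
      · have := binom_add_single_of_eq_zero s b (a - Finsupp.single s 1) hb
        rw [hsub a ha, binom_comm, binom_comm b] at this
        simp [ha, hb, this]
      · have := binom_add_single s (a - Finsupp.single s 1) (b - Finsupp.single s 1)
        rw [hsub a ha, hsub b hb] at this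
        simp only [ne_eq, ha, hb, not_false_eq_true, if_true]
        rw [this]
        push_cast
        ring
  ext n
  rw [coeff_add, mul_comm g, coeff_mul, coeff_mul]
  change (f * g).coeff (n + Finsupp.single s 1) = _
  rw [coeff_mul]
  have hstep : ∀ p ∈ Finset.HasAntidiagonal.antidiagonal (n + Finsupp.single s 1),
      (binom p.1 p.2 : k) * (f.coeff p.1 * g.coeff p.2) =
        (if p.2 s ≠ 0 then
          (binom p.1 (p.2 - Finsupp.single s 1) : k) * (f.coeff p.1 * g.coeff p.2) else 0) +
        (if p.1 s ≠ 0 then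
          (binom (p.1 - Finsupp.single s 1) p.2 : k) * (f.coeff p.1 * g.coeff p.2) else 0) := by
    intro p hp
    rw [Finset.HasAntidiagonal.mem_antidiagonal] at hp
    rw [hsplit p (by rw [hp]; simp), add_mul, ite_mul, ite_mul, zero_mul]
  rw [Finset.sum_congr rfl hstep, Finset.sum_add_distrib, ← Finset.sum_filter,
    ← Finset.sum_filter]
  congr 1
  · refine Finset.sum_nbij' (fun p => (p.1, p.2 - Finsupp.single s 1))
      (fun p => (p.1, p.2 + Finsupp.single s 1)) ?_ ?_ ?_ ?_ ?_
    · rintro ⟨a, b⟩ h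
      simp only [Finset.mem_filter, Finset.HasAntidiagonal.mem_antidiagonal] at h ⊢
      have := hsub b h.2
      apply add_right_cancel (b := Finsupp.single s 1)
      rw [add_assoc, this, h.1]
    · rintro ⟨a, b⟩ h
      simp only [Finset.mem_filter, Finset.HasAntidiagonal.mem_antidiagonal] at h ⊢
      exact ⟨by rw [← add_assoc, h], by simp⟩
    · rintro ⟨a, b⟩ h
      simp only [Finset.mem_filter] at h
      simp only [hsub b h.2]
    · rintro ⟨a, b⟩ h
      simp
    · rintro ⟨a, b⟩ h
      simp only [Finset.mem_filter] at h
      simp only [shift, hsub b h.2]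
  · refine Finset.sum_nbij' (fun p => (p.1 - Finsupp.single s 1, p.2))
      (fun p => (p.1 + Finsupp.single s 1, p.2)) ?_ ?_ ?_ ?_ ?_
    · rintro ⟨a, b⟩ h
      simp only [Finset.mem_filter, Finset.HasAntidiagonal.mem_antidiagonal] at h ⊢
      have := hsub a h.2
      apply add_right_cancel (b := Finsupp.single s 1)
      rw [add_right_comm, this, h.1]
    · rintro ⟨a, b⟩ h
      simp only [Finset.mem_filter, Finset.HasAntidiagonal.mem_antidiagonal] at h ⊢
      exact ⟨by rw [add_right_comm, h], by simp⟩
    · rintro ⟨a, b⟩ h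
      simp only [Finset.mem_filter] at h
      simp only [hsub a h.2]
    · rintro ⟨a, b⟩ h
      simp
    · rintro ⟨a, b⟩ h
      simp only [Finset.mem_filter] at h
      simp only [shift, hsub a h.2]

/-- The partial derivative `∂/∂zₛ`. -/
noncomputable def partialDeriv (s : Fin u) : Derivation k (DPSeries u k) (DPSeries u k) :=
  Derivation.mk'
    { toFun := shift s
      map_add' := fun _ _ => rfl
      map_smul' := fun _ _ => rfl }
    (fun f g => shift_mul s f g)

end DPSeries

/-- Polynomials with divided powers: the finite sums `∑ₙ cₙ z^[n]`. -/
noncomputable def DPPolynomial (u : ℕ) (k : Type*) [Field k] : Subalgebra k (DPSeries u k) where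
  carrier := {f | (Function.support f.coeff).Finite}
  mul_mem' {f g} hf hg := by
    refine ((hf.prod hg).image (fun p => p.1 + p.2)).subset fun n hn => ?_
    rw [Function.mem_support, DPSeries.coeff_mul] at hn
    obtain ⟨p, hp, hne⟩ := Finset.exists_ne_zero_of_sum_ne_zero hn
    have h := right_ne_zero_of_mul hne
    exact ⟨p, ⟨left_ne_zero_of_mul h, right_ne_zero_of_mul h⟩,
      Finset.HasAntidiagonal.mem_antidiagonal.mp hp⟩
  add_mem' {f g} hf hg := (hf.union hg).subset (Function.support_add f.coeff g.coeff)
  algebraMap_mem' c := by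
    refine (Set.finite_singleton (0 : Fin u →₀ ℕ)).subset fun n hn => ?_
    rw [Function.mem_support, DPSeries.algebraMap_def, DPSeries.coeff_monomial] at hn
    by_contra h
    exact hn (if_neg h)

namespace DPPolynomial

variable {u : ℕ} {k : Type*} [Field k]

/-- The coordinate `zₛ`. -/
noncomputable def coord (s : Fin u) : DPPolynomial u k :=
  ⟨DPSeries.coord s, by
    refine (Set.finite_singleton (Finsupp.single s 1 : Fin u →₀ ℕ)).subset fun n hn => ?_
    rw [Function.mem_support, DPSeries.coord, DPSeries.coeff_monomial] at hn
    by_contra h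
    exact hn (if_neg h)⟩

/-- The partial derivative `∂/∂zₛ`. -/
noncomputable def partialDeriv (s : Fin u) : Derivation k (DPPolynomial u k) (DPPolynomial u k) :=
  Derivation.mk'
    { toFun := fun f => ⟨DPSeries.partialDeriv s f.1, by
        refine Set.Finite.subset (Set.Finite.preimage (f := fun n => n + Finsupp.single s 1)
          (add_left_injective _).injOn f.2) fun n hn => hn⟩
      map_add' := fun _ _ => rfl
      map_smul' := fun _ _ => rfl }
    (fun f g => Subtype.ext (DPSeries.shift_mul s f.1 g.1))

end DPPolynomial

/-!
# Koszulity of algebras of closed logarithmic forms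

Let `A ⊆ Z` be the exterior algebra over `k` spanned by the products of the generators `ωₛ`, which
are closed forms of degree one. The proof compares `Z` with `A`, which is Koszul.

*Regularity.* The homology of an `A`-module `N` is computed by its Cartan complex, the tensor
product of `N` with the divided power coalgebra on variables `x₁, …, xᵤ`. Its elements are written
as families `c` of elements of `N` indexed by multi-indices; the differential is `cartanDiff`. In
the complex of `Ω = O ⊗ A` all cycles of positive form degree are boundaries, since `Ω` is free over
`A`. The de Rham cohomology `H` has the same property: homotopies built from quasi-inverses of the
derivations `zₛ ∂ₛ` (`s ≤ v`) and `∂ₛ` (`s > v`) deform a closed form into a harmonic one, a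
combination of products of the logarithmic `ωₛ` whose coefficients are killed by all the
derivations, while the other `ωₛ` act by zero on `H`. The exact sequences `0 → Z → Ω → dΩ → 0` and
`0 → dΩ → Z → H → 0` then show, by induction on the degree of the multi-indices, that in `Z` all
cycles of form degree at least two are boundaries: the Castelnuovo–Mumford regularity of `Z` over
`A` is at most one (`KoszulOperators.exists_closed_cartan_eq`,
`isRegularOverExterior_of_closedForms`). The degree zero part of `Z` plays no role here, so the same
holds for `k ⊕ Z¹ ⊕ Z² ⊕ ⋯`.

*Koszulity.* For a connected graded algebra `B` with regularity at most one over `A`, call a graded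
`B`-module linear if it starts in degree zero and has regularity zero over `A`. Such a module is
generated in degree zero, and the kernel of its free cover `B ⊗ N₀ → N`, shifted by one, is again
linear (`IsLinearModule.syzygy`). So linear modules have linear free resolutions over `B`, and by
dimension shifting every cycle of the bar complex with coefficients in `N` is homologous to an
element of `B₁ ⊗ ⋯ ⊗ B₁ ⊗ N₀` (`IsLinearModule.exists_eq_add_linear`). Applied to `N = B₊`,
shifted by one, this says that `B` is Koszul (`IsRegularOverExterior.isKoszul`).

*Integration.* It remains to find the quasi-inverses (`LogIntegration`). For polynomials and power
series they are given by coefficientwise division (`MonomialExpansion.exists_logIntegration`). For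
smooth and holomorphic functions on a disk they are built from the averages
`∫₀¹ f(z₁, …, t zₛ, …, zᵤ) dt` (`smoothFunctions.logIntegration`). Finally `Z⁰ = k`, except for
divided powers with `v > 0`, where the functions killed by all the derivations need not be constant.
-/

/-! ### The bar complex with coefficients -/

section BarTower

variable {k B : Type*} [Field k] [Ring B] [Algebra k B]

/-- The action `P ⊗ N → N` of a left ideal `P` of `B` on a left `B`-module `N`. -/
noncomputable def idealAction (k : Type*) {B : Type*} [Field k] [Ring B] [Algebra k B] (P : Ideal B)
    (N : Type*) [AddCommGroup N] [Module k N] [Module B N] [IsScalarTower k B N] :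
    P ⊗[k] N →ₗ[k] N :=
  TensorProduct.lift ((Algebra.lsmul k k N).toLinearMap ∘ₗ (P.subtype.restrictScalars k))

@[simp] theorem idealAction_tmul (P : Ideal B) (N : Type*) [AddCommGroup N] [Module k N]
    [Module B N] [IsScalarTower k B N] (p : P) (n : N) :
    idealAction k P N (p ⊗ₜ n) = (p : B) • n := rfl

variable {P : Ideal B} {T : ℕ → Type*} [∀ i, AddCommGroup (T i)] [∀ i, Module k (T i)]
  (e : ∀ i, T (i + 1) ≃ₗ[k] T i ⊗[k] P)

/-- The multiplication of the last tensor factor of `T (i + 1) = T i ⊗ P` with the coefficient. -/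
noncomputable def lastAction (i : ℕ) (N : Type*) [AddCommGroup N] [Module k N] [Module B N]
    [IsScalarTower k B N] : T (i + 1) ⊗[k] N →ₗ[k] T i ⊗[k] N :=
  (idealAction k P N).lTensor (T i) ∘ₗ (TensorProduct.assoc k (T i) P N).toLinearMap ∘ₗ
    (e i).toLinearMap.rTensor N

/-- The bar differential on `T i = P^{⊗ i}`, where the tensor powers are given by a sequence of
spaces with isomorphisms `T (i + 1) ≃ T i ⊗ P`. -/
noncomputable def towerDiff : ∀ i, T (i + 1) →ₗ[k] T i
  | 0 => 0
  | i + 1 => (e i).symm.toLinearMap ∘ₗ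
      ((towerDiff i).rTensor P + (-1 : k) ^ i • lastAction e i P) ∘ₗ (e (i + 1)).toLinearMap

/-- The differential `P^{⊗ (i + 1)} ⊗ N → P^{⊗ i} ⊗ N` of the bar complex with coefficients in a
left `B`-module `N`. -/
noncomputable def coeffDiff (i : ℕ) (N : Type*) [AddCommGroup N] [Module k N] [Module B N]
    [IsScalarTower k B N] : T (i + 1) ⊗[k] N →ₗ[k] T i ⊗[k] N :=
  (towerDiff e i).rTensor N + (-1 : k) ^ i • lastAction e i N

theorem towerDiff_succ (i : ℕ) (x : T (i + 2)) :
    e i (towerDiff e (i + 1) x) = coeffDiff e i P (e (i + 1) x) := by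
  simp [towerDiff, coeffDiff]

section Coeff

variable {N N' : Type*} [AddCommGroup N] [Module k N] [Module B N] [IsScalarTower k B N]
  [AddCommGroup N'] [Module k N'] [Module B N'] [IsScalarTower k B N']

theorem lastAction_symm_tmul (i : ℕ) (t : T i) (p : P) (n : N) :
    lastAction e i N ((e i).symm (t ⊗ₜ p) ⊗ₜ n) = t ⊗ₜ ((p : B) • n) := by
  simp [lastAction]

theorem coeffDiff_symm_tmul (i : ℕ) (t : T i) (p : P) (n : N) :
    coeffDiff e i N ((e i).symm (t ⊗ₜ p) ⊗ₜ n) =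
      towerDiff e i ((e i).symm (t ⊗ₜ p)) ⊗ₜ n + (-1 : k) ^ i • t ⊗ₜ ((p : B) • n) := by
  simp [coeffDiff, lastAction_symm_tmul]

/-- Induction on the elements of `T (i + 1) = T i ⊗ P`. -/
theorem tower_induction {i : ℕ} {C : T (i + 1) → Prop} (h0 : C 0)
    (ht : ∀ t p, C ((e i).symm (t ⊗ₜ p))) (ha : ∀ x y, C x → C y → C (x + y)) (x : T (i + 1)) :
    C x := by
  rw [← (e i).symm_apply_apply x]
  induction e i x using TensorProduct.induction_on with
  | zero => simpa using h0
  | tmul t p => exact ht t p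
  | add x y hx hy => rw [map_add]; exact ha _ _ hx hy

theorem towerDiff_symm_tmul (i : ℕ) (x : T (i + 1)) (q : P) :
    towerDiff e (i + 1) ((e (i + 1)).symm (x ⊗ₜ q)) =
      (e i).symm (towerDiff e i x ⊗ₜ q) +
        (-1 : k) ^ i • (e i).symm (lastAction e i P (x ⊗ₜ q)) := by
  simp [towerDiff]

theorem coeffDiff_lTensor (i : ℕ) (φ : N →ₗ[B] N') (x : T (i + 1) ⊗[k] N) :
    coeffDiff e i N' ((φ.restrictScalars k).lTensor _ x) =
      (φ.restrictScalars k).lTensor _ (coeffDiff e i N x) := by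
  induction x using TensorProduct.induction_on with
  | zero => simp
  | add x y hx hy => simp only [map_add, hx, hy]
  | tmul x n =>
    induction x using tower_induction e with
    | h0 => simp
    | ha x y hx hy => simp only [TensorProduct.add_tmul, map_add, hx, hy]
    | ht t p =>
      simp [coeffDiff_symm_tmul]

theorem coeffDiff_tmul (i : ℕ) (x : T (i + 1)) (n : N) :
    coeffDiff e i N (x ⊗ₜ n) = towerDiff e i x ⊗ₜ n + (-1 : k) ^ i • lastAction e i N (x ⊗ₜ n) := by
  simp [coeffDiff]

theorem coeffDiff_coeffDiff_of_towerDiff (i : ℕ) (h : towerDiff e i ∘ₗ towerDiff e (i + 1) = 0)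
    (x : T (i + 2) ⊗[k] N) : coeffDiff e i N (coeffDiff e (i + 1) N x) = 0 := by
  induction x using TensorProduct.induction_on with
  | zero => simp
  | add x y hx hy => simp only [map_add, hx, hy, add_zero]
  | tmul x n =>
    induction x using tower_induction e with
    | h0 => simp
    | ha x y hx hy => simp only [TensorProduct.add_tmul, map_add, hx, hy, add_zero]
    | ht x q =>
      induction x using tower_induction e with
      | h0 => simp
      | ha x y hx hy =>
        simp only [TensorProduct.add_tmul, map_add, hx, hy, add_zero]
      | ht t p =>
        have h' := LinearMap.congr_fun h ((e (i + 1)).symm ((e i).symm (t ⊗ₜ p) ⊗ₜ q))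
        simp only [LinearMap.comp_apply, LinearMap.zero_apply] at h'
        rw [coeffDiff_symm_tmul, map_add, coeffDiff_tmul, h', map_smul, coeffDiff_symm_tmul,
          towerDiff_symm_tmul, lastAction_symm_tmul]
        rw [TensorProduct.add_tmul, map_add, lastAction_symm_tmul, TensorProduct.zero_tmul,
          zero_add, ← TensorProduct.smul_tmul', map_smul, lastAction_symm_tmul]
        have h2 : ((((p : B) • q : P) : B)) • n = (p : B) • (q : B) • n := by
          rw [Submodule.coe_smul, smul_eq_mul, mul_smul]
        rw [h2]
        have : (-1 : k) ^ (i + 1) = - (-1) ^ i := by ring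
        rw [this]
        module

theorem towerDiff_comp (i : ℕ) : towerDiff e i ∘ₗ towerDiff e (i + 1) = 0 := by
  induction i with
  | zero => simp [towerDiff]
  | succ i ih =>
    ext x
    apply (e i).injective
    rw [LinearMap.comp_apply, towerDiff_succ, towerDiff_succ,
      coeffDiff_coeffDiff_of_towerDiff e i ih]
    simp

theorem coeffDiff_coeffDiff (i : ℕ) (x : T (i + 2) ⊗[k] N) :
    coeffDiff e i N (coeffDiff e (i + 1) N x) = 0 :=
  coeffDiff_coeffDiff_of_towerDiff e i (towerDiff_comp e i) x

end Coeff

section Free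

variable (r : B →ₗ[k] P) (W : Type*) [AddCommGroup W] [Module k W]

/-- The contracting homotopy `t ⊗ (b ⊗ w) ↦ ± (t ⊗ b₊) ⊗ (1 ⊗ w)` of the bar complex with
coefficients in the free module `B ⊗ W`; here `b₊ = r b` is the component of `b` in `P`. -/
noncomputable def freeHomotopy (i : ℕ) :
    T i ⊗[k] (B ⊗[k] W) →ₗ[k] T (i + 1) ⊗[k] (B ⊗[k] W) :=
  (-1 : k) ^ i • (TensorProduct.map ((e i).symm.toLinearMap ∘ₗ r.lTensor (T i))
    (TensorProduct.mk k B W 1) ∘ₗ (TensorProduct.assoc k (T i) B W).symm.toLinearMap)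

theorem freeHomotopy_tmul (i : ℕ) (t : T i) (b : B) (w : W) :
    freeHomotopy e r W i (t ⊗ₜ (b ⊗ₜ w)) = (-1 : k) ^ i • (e i).symm (t ⊗ₜ r b) ⊗ₜ (1 ⊗ₜ w) := by
  simp [freeHomotopy]

variable {r W}

theorem coeffDiff_freeHomotopy_tmul (i : ℕ) (t : T i) (b : B) (w : W) :
    coeffDiff e i (B ⊗[k] W) (freeHomotopy e r W i (t ⊗ₜ (b ⊗ₜ w))) =
      (-1 : k) ^ i • towerDiff e i ((e i).symm (t ⊗ₜ r b)) ⊗ₜ (1 ⊗ₜ w) +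
        t ⊗ₜ[k] ((r b : B) ⊗ₜ[k] w) := by
  rw [freeHomotopy_tmul, map_smul, coeffDiff_symm_tmul, smul_add, smul_smul,
    ← mul_pow, TensorProduct.smul_tmul' (r b : B)]
  simp

/-- The homotopy formula in positive degrees. -/
theorem freeHomotopy_formula (hr : ∀ p : P, r p = p) (hP : ∀ p ∈ P, ∀ b : B, p * b ∈ P)
    (hb : ∀ b : B, ∃ c : k, b = r b + algebraMap k B c) (i : ℕ)
    (x : T (i + 1) ⊗[k] (B ⊗[k] W)) :
    coeffDiff e (i + 1) (B ⊗[k] W) (freeHomotopy e r W (i + 1) x) +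
      freeHomotopy e r W i (coeffDiff e i (B ⊗[k] W) x) = x := by
  induction x using TensorProduct.induction_on with
  | zero => simp
  | add x y hx hy =>
    simp only [map_add]
    rw [add_add_add_comm, hx, hy]
  | tmul x f =>
    induction f using TensorProduct.induction_on with
    | zero => simp
    | add f g hf hg =>
      simp only [map_add, TensorProduct.tmul_add]
      rw [add_add_add_comm, hf, hg]
    | tmul b w =>
      induction x using tower_induction e with
      | h0 => simp
      | ha x y hx hy =>
        simp only [TensorProduct.add_tmul, map_add]
        rw [add_add_add_comm, hx, hy]
      | ht t p =>
        rw [coeffDiff_freeHomotopy_tmul, coeffDiff_symm_tmul, towerDiff_symm_tmul,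
          lastAction_symm_tmul, map_add, map_smul, TensorProduct.smul_tmul' (p : B),
          freeHomotopy_tmul, freeHomotopy_tmul]
        obtain ⟨c, hc⟩ := hb b
        have h1 : r ((p : B) * b) = (p : B) • r b + c • p := by
          have : (p : B) * b = (⟨_, hP p p.2 b⟩ : P) := rfl
          rw [this, hr]
          apply Subtype.ext
          simp only [Submodule.coe_add, Submodule.coe_smul, Submodule.coe_smul_of_tower,
            smul_eq_mul]
          conv_lhs => rw [hc]
          rw [mul_add, ← Algebra.commutes, Algebra.smul_def]
        have h2 : (e i).symm (t ⊗ₜ p) ⊗ₜ[k] (b ⊗ₜ[k] w) =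
            (e i).symm (t ⊗ₜ p) ⊗ₜ[k] ((r b : B) ⊗ₜ[k] w) +
              c • (e i).symm (t ⊗ₜ p) ⊗ₜ[k] ((1 : B) ⊗ₜ[k] w) := by
          conv_lhs => rw [hc]
          rw [TensorProduct.add_tmul, TensorProduct.tmul_add, Algebra.algebraMap_eq_smul_one,
            ← TensorProduct.smul_tmul', TensorProduct.tmul_smul]
        rw [h2, smul_eq_mul, h1]
        simp only [TensorProduct.tmul_add, map_add, TensorProduct.add_tmul,
          TensorProduct.tmul_smul, map_smul, ← TensorProduct.smul_tmul', smul_add, smul_smul]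
        have e1 : (-1 : k) ^ (i + 1) = - (-1) ^ i := by ring
        have e2 : (-1 : k) ^ i * (-1) ^ i = 1 := by rw [← mul_pow]; simp
        rw [e1, neg_mul, e2, ← mul_assoc, e2]
        module

end Free

end BarTower

/-! ### Modules with a linear resolution -/

section LinearModules

theorem sum_sum_eq_zero_of_antisymm {ι M : Type*} [Fintype ι] [AddCommGroup M] (f : ι → ι → M)
    (h : ∀ s t, f s t + f t s = 0) (h' : ∀ s, f s s = 0) : ∑ s, ∑ t, f s t = 0 := by
  classical
  rw [← Finset.sum_product']
  refine Finset.sum_involution (fun p _ => (p.2, p.1)) ?_ ?_ ?_ ?_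
  · rintro ⟨s, t⟩ _; exact h s t
  · rintro ⟨s, t⟩ _ hne heq
    simp only [Prod.mk.injEq] at heq
    obtain ⟨rfl, _⟩ := heq
    exact hne (h' _)
  · simp
  · simp

variable {k B : Type*} [Field k] [Ring B] [Algebra k B] {u : ℕ}

/-- The differential `(∂ c)(a) = ∑ₛ ηₛ c(a + eₛ)` of the Cartan complex of a module `N` on which
`η₁, …, ηᵤ` act.  The function `c` stands for the element `∑ₐ x^[a] ⊗ c(a)` of the tensor product
of `N` with the divided power coalgebra. -/
def cartanDiff (η : Fin u → B) {N : Type*} [AddCommGroup N] [Module B N]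
    (c : (Fin u → ℕ) → N) (a : Fin u → ℕ) : N :=
  ∑ s, η s • c (a + Pi.single s 1)

section

variable {N N' : Type*} [AddCommGroup N] [Module B N] [AddCommGroup N'] [Module B N']
  {η : Fin u → B}

theorem cartanDiff_cartanDiff (hη : ∀ s t, η s * η t + η t * η s = 0) (hη' : ∀ s, η s * η s = 0)
    (c : (Fin u → ℕ) → N) (a : Fin u → ℕ) : cartanDiff η (cartanDiff η c) a = 0 := by
  simp only [cartanDiff, Finset.smul_sum, smul_smul]
  refine sum_sum_eq_zero_of_antisymm _ (fun s t => ?_) fun s => by rw [hη', zero_smul]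
  rw [add_right_comm a, ← add_smul, hη, zero_smul]

theorem cartanDiff_map (φ : N →ₗ[B] N') (c : (Fin u → ℕ) → N) (a : Fin u → ℕ) :
    cartanDiff η (fun a => φ (c a)) a = φ (cartanDiff η c a) := by
  simp [cartanDiff]

theorem cartanDiff_sub (c c' : (Fin u → ℕ) → N) (a : Fin u → ℕ) :
    cartanDiff η (fun a => c a - c' a) a = cartanDiff η c a - cartanDiff η c' a := by
  simp [cartanDiff, smul_sub]

theorem sum_add_single (a : Fin u → ℕ) (s : Fin u) :
    ∑ t, (a + Pi.single s 1 : Fin u → ℕ) t = ∑ t, a t + 1 := by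
  simp [Finset.sum_add_distrib, Finset.sum_pi_single']

theorem cartanDiff_congr {c c' : (Fin u → ℕ) → N} {i : ℕ}
    (h : ∀ a, ∑ s, a s = i + 1 → c a = c' a) {a : Fin u → ℕ} (ha : ∑ s, a s = i) :
    cartanDiff η c a = cartanDiff η c' a := by
  refine Finset.sum_congr rfl fun s _ => ?_
  rw [h _ (by rw [sum_add_single, ha])]

end

variable (𝒜 : ℕ → Submodule k B) [GradedAlgebra 𝒜] (η : Fin u → B)

/-- A graded `B`-module `N = ⨁ᵣ Nᵣ`, the grading being given by its projections `π r`, whose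
Castelnuovo–Mumford regularity over the exterior algebra on `η₁, …, ηᵤ` is zero: in the Cartan
complex, all cycles with values in `Nᵣ`, `r > 0`, are boundaries. The cycles in question are
families indexed by the multi-indices of degree `i`. -/
structure IsLinearModule {N : Type*} [AddCommGroup N] [Module k N] [Module B N]
    (π : ℕ → N →ₗ[k] N) : Prop where
  sum_proj : ∀ x, ∃ m, ∑ r ∈ Finset.range m, π r x = x
  proj_proj : ∀ r s x, π r (π s x) = if r = s then π s x else 0
  smul_proj : ∀ {a : ℕ} {b : B}, b ∈ 𝒜 a → ∀ r x, π (a + r) (b • π r x) = b • π r x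
  exact : ∀ (r i : ℕ) (c : (Fin u → ℕ) → N), (∀ a, π (r + 1) (c a) = c a) →
    (∀ a, ∑ s, a s + 1 = i → cartanDiff η c a = 0) →
    ∃ c' : (Fin u → ℕ) → N, (∀ a, π r (c' a) = c' a) ∧
      ∀ a, ∑ s, a s = i → cartanDiff η c' a = c a

/-- The algebra `B` has regularity at most one over the exterior algebra on `η₁, …, ηᵤ ∈ B₁`:
in the Cartan complex of `B`, all cycles with values in degrees greater than one are boundaries.
The number `i` is the degree of the multi-indices; for `i = 0` every family is a cycle. -/
structure IsRegularOverExterior : Prop where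
  mem_one : ∀ s, η s ∈ 𝒜 1
  mul_add_mul : ∀ s t, η s * η t + η t * η s = 0
  mul_self : ∀ s, η s * η s = 0
  exact : ∀ (r i : ℕ) (c : (Fin u → ℕ) → B), (∀ a, c a ∈ 𝒜 (r + 2)) →
    (∀ a, ∑ s, a s + 1 = i → cartanDiff η c a = 0) →
    ∃ c' : (Fin u → ℕ) → B, (∀ a, c' a ∈ 𝒜 (r + 1)) ∧
      ∀ a, ∑ s, a s = i → cartanDiff η c' a = c a

variable {𝒜 η}

theorem gradedProj_mem (r : ℕ) (b : B) : GradedAlgebra.proj 𝒜 r b ∈ 𝒜 r :=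
  SetLike.coe_mem _

theorem gradedProj_eq_self_iff {r : ℕ} {b : B} : GradedAlgebra.proj 𝒜 r b = b ↔ b ∈ 𝒜 r :=
  ⟨fun h => h ▸ gradedProj_mem r b, fun h => DirectSum.decompose_of_mem_same 𝒜 h⟩

theorem gradedProj_proj (r s : ℕ) (b : B) :
    GradedAlgebra.proj 𝒜 r (GradedAlgebra.proj 𝒜 s b) =
      if r = s then GradedAlgebra.proj 𝒜 s b else 0 := by
  split_ifs with h
  · subst h; exact gradedProj_eq_self_iff.2 (gradedProj_mem r b)
  · exact DirectSum.decompose_of_mem_ne 𝒜 (gradedProj_mem s b) (Ne.symm h)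

theorem sum_gradedProj (b : B) :
    ∃ m, ∀ m' ≥ m, ∑ r ∈ Finset.range m', GradedAlgebra.proj 𝒜 r b = b := by
  classical
  refine ⟨((DirectSum.decompose 𝒜 b).support.sup id) + 1, fun m' hm => ?_⟩
  conv_rhs => rw [← DirectSum.sum_support_decompose 𝒜 b]
  symm
  refine Finset.sum_subset (fun r hr => ?_) fun r _ hr => ?_
  · have := Finset.le_sup (f := id) hr
    simp only [id] at this
    rw [Finset.mem_range]; omega
  · simpa using hr

section FreeCover

variable (𝒜) (W : Type*) [AddCommGroup W] [Module k W]

/-- The projections to the homogeneous components of the free module `B ⊗ W`. -/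
noncomputable def freeProj (r : ℕ) : B ⊗[k] W →ₗ[k] B ⊗[k] W :=
  (GradedAlgebra.proj 𝒜 r).rTensor W

variable {𝒜 W}

theorem sum_freeProj (x : B ⊗[k] W) :
    ∃ m, ∀ m' ≥ m, ∑ r ∈ Finset.range m', freeProj 𝒜 W r x = x := by
  induction x using TensorProduct.induction_on with
  | zero => exact ⟨0, by simp⟩
  | tmul b w =>
    obtain ⟨m, hm⟩ := sum_gradedProj (𝒜 := 𝒜) b
    refine ⟨m, fun m' h => ?_⟩
    conv_rhs => rw [← hm m' h]
    simp [freeProj, TensorProduct.sum_tmul]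
  | add x y hx hy =>
    obtain ⟨m, hm⟩ := hx
    obtain ⟨n, hn⟩ := hy
    refine ⟨max m n, fun m' h => ?_⟩
    simp only [map_add, Finset.sum_add_distrib]
    rw [hm m' (le_trans (le_max_left _ _) h), hn m' (le_trans (le_max_right _ _) h)]

theorem freeProj_freeProj (r s : ℕ) (x : B ⊗[k] W) :
    freeProj 𝒜 W r (freeProj 𝒜 W s x) = if r = s then freeProj 𝒜 W s x else 0 := by
  induction x using TensorProduct.induction_on with
  | zero => simp
  | tmul b w =>
    simp only [freeProj, LinearMap.rTensor_tmul, gradedProj_proj]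
    split_ifs <;> simp
  | add x y hx hy =>
    simp only [map_add, hx, hy]
    split_ifs <;> simp

theorem freeProj_smul {a : ℕ} {b : B} (hb : b ∈ 𝒜 a) (r : ℕ) (x : B ⊗[k] W) :
    freeProj 𝒜 W (a + r) (b • freeProj 𝒜 W r x) = b • freeProj 𝒜 W r x := by
  induction x using TensorProduct.induction_on with
  | zero => simp
  | tmul b' w =>
    simp only [freeProj, LinearMap.rTensor_tmul, TensorProduct.smul_tmul', smul_eq_mul]
    rw [gradedProj_eq_self_iff.2 (SetLike.mul_mem_graded hb (gradedProj_mem r b'))]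
  | add x y hx hy => simp only [map_add, smul_add, hx, hy]

/-- The exactness property of `B` passes to the free modules `B ⊗ W`. -/
theorem IsRegularOverExterior.exact_tensor (h : IsRegularOverExterior 𝒜 η) (r i : ℕ)
    (c : (Fin u → ℕ) → B ⊗[k] W) (hc : ∀ a, freeProj 𝒜 W (r + 2) (c a) = c a)
    (hd : ∀ a, ∑ s, a s + 1 = i → cartanDiff η c a = 0) :
    ∃ c' : (Fin u → ℕ) → B ⊗[k] W, (∀ a, freeProj 𝒜 W (r + 1) (c' a) = c' a) ∧
      ∀ a, ∑ s, a s = i → cartanDiff η c' a = c a := by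
  classical
  let bs := Module.Basis.ofVectorSpace k W
  -- the coordinates of `B ⊗ W` with respect to a basis of `W`
  let φ : _ → B ⊗[k] W →ₗ[B] B := fun w =>
    TensorProduct.AlgebraTensorModule.lift
      (LinearMap.toSpanSingleton B (W →ₗ[k] B) (Algebra.linearMap k B ∘ₗ bs.coord w))
  have hφ : ∀ w b x, φ w (b ⊗ₜ x) = bs.coord w x • b := fun w b x => by
    simp only [φ, TensorProduct.AlgebraTensorModule.lift_tmul, LinearMap.toSpanSingleton_apply,
      LinearMap.smul_apply, LinearMap.comp_apply, Algebra.linearMap_apply, smul_eq_mul]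
    rw [← Algebra.commutes, Algebra.smul_def]
  have hfin : ∀ x : B ⊗[k] W, ∃ S : Finset _, ∀ S' ⊇ S, ∑ w ∈ S', φ w x ⊗ₜ bs w = x := by
    intro x
    induction x using TensorProduct.induction_on with
    | zero => exact ⟨∅, by simp⟩
    | tmul b w =>
      refine ⟨(bs.repr w).support, fun S' hS' => ?_⟩
      conv_rhs => rw [← bs.linearCombination_repr w, Finsupp.linearCombination_apply,
        Finsupp.sum, TensorProduct.tmul_sum]
      symm
      rw [Finset.sum_subset hS']
      · exact Finset.sum_congr rfl fun j _ => by
          rw [hφ, TensorProduct.smul_tmul, Module.Basis.coord_apply]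
      · intro j _ hj
        rw [Finsupp.notMem_support_iff.1 hj]; simp
    | add x y hx hy =>
      obtain ⟨S, hS⟩ := hx
      obtain ⟨R, hR⟩ := hy
      refine ⟨S ∪ R, fun S' hS' => ?_⟩
      simp only [map_add, TensorProduct.add_tmul, Finset.sum_add_distrib]
      rw [hS S' (Finset.union_subset_left hS'), hR S' (Finset.union_subset_right hS')]
  have hproj : ∀ w x, φ w (freeProj 𝒜 W (r + 2) x) = GradedAlgebra.proj 𝒜 (r + 2) (φ w x) := by
    intro w x
    induction x using TensorProduct.induction_on with
    | zero => simp
    | tmul b y => simp only [freeProj, LinearMap.rTensor_tmul, hφ, map_smul]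
    | add x y hx hy => simp only [map_add, hx, hy]
  have hex := fun w => h.exact r i (fun a => φ w (c a))
    (fun a => gradedProj_eq_self_iff.1 (by rw [← hproj, hc]))
    (fun a ha => by rw [cartanDiff_map, hd a ha, map_zero])
  choose c' hc' hdc' using hex
  choose S hS using hfin
  -- there are finitely many multi-indices of degree `i`, so finitely many coordinates matter
  let A : Finset (Fin u → ℕ) := Fintype.piFinset fun _ => Finset.range (i + 1)
  have hA : ∀ a : Fin u → ℕ, ∑ s, a s = i → a ∈ A := by
    intro a ha
    rw [Fintype.mem_piFinset]
    intro s
    have := Finset.single_le_sum (f := a) (fun _ _ => Nat.zero_le _) (Finset.mem_univ s)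
    rw [Finset.mem_range]; omega
  let R := A.biUnion fun a => S (c a)
  refine ⟨fun a => ∑ w ∈ R, c' w a ⊗ₜ bs w, fun a => ?_, fun a ha => ?_⟩
  · rw [map_sum]
    refine Finset.sum_congr rfl fun w _ => ?_
    rw [freeProj, LinearMap.rTensor_tmul, gradedProj_eq_self_iff.2 (hc' w a)]
  · rw [← hS (c a) R (Finset.subset_biUnion_of_mem (fun a => S (c a)) (hA a ha))]
    simp only [cartanDiff, Finset.smul_sum]
    rw [Finset.sum_comm]
    refine Finset.sum_congr rfl fun w _ => ?_
    rw [← hdc' w a ha, cartanDiff, TensorProduct.sum_tmul]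
    rfl

end FreeCover

end LinearModules

/-! ### Bar complexes of modules with a linear resolution -/

section LinearSyzygy

universe w

variable {k : Type*} {B : Type w} [Field k] [Ring B] [Algebra k B] {u : ℕ}
  {𝒜 : ℕ → Submodule k B} [GradedAlgebra 𝒜] {η : Fin u → B}

section Syzygy

variable {N : Type*} [AddCommGroup N] [Module k N] [Module B N] [IsScalarTower k B N]
  {π : ℕ → N →ₗ[k] N}

/-- The space of generators of a graded module: its component of degree zero. -/
abbrev generatorSpace (π : ℕ → N →ₗ[k] N) : Submodule k N := LinearMap.range (π 0)

variable (B) in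
/-- The free cover `B ⊗ N₀ → N` of a module with a linear resolution. -/
noncomputable def freeCover (π : ℕ → N →ₗ[k] N) : B ⊗[k] generatorSpace π →ₗ[B] N :=
  TensorProduct.AlgebraTensorModule.lift
    (LinearMap.toSpanSingleton B (generatorSpace π →ₗ[k] N) (generatorSpace π).subtype)

@[simp] theorem freeCover_tmul (b : B) (w : generatorSpace π) :
    freeCover B π (b ⊗ₜ[k] w) = b • (w : N) := by
  simp [freeCover]

namespace IsLinearModule

omit [GradedAlgebra 𝒜] [IsScalarTower k B N] in
theorem proj_generator (h : IsLinearModule 𝒜 η π) (w : generatorSpace π) : π 0 w = w := by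
  obtain ⟨_, x, rfl⟩ := w
  simp [h.proj_proj]

theorem freeCover_freeProj (h : IsLinearModule 𝒜 η π) (r : ℕ) (x : B ⊗[k] generatorSpace π) :
    freeCover B π (freeProj 𝒜 _ r x) = π r (freeCover B π x) := by
  induction x using TensorProduct.induction_on with
  | zero => simp
  | add x y hx hy => simp only [map_add, hx, hy]
  | tmul b w =>
    have key : ∀ s b, b ∈ 𝒜 s → π r (b • (w : N)) = if r = s then b • (w : N) else 0 := by
      intro s b hb
      have := h.smul_proj hb 0 (w : N)
      rw [h.proj_generator, add_zero] at this
      rw [← this, h.proj_proj]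
    obtain ⟨m, hm⟩ := sum_gradedProj (𝒜 := 𝒜) b
    have hm' := hm (max m (r + 1)) (le_max_left _ _)
    simp only [freeProj, LinearMap.rTensor_tmul, freeCover_tmul]
    conv_rhs => rw [← hm', Finset.sum_smul, map_sum]
    rw [Finset.sum_eq_single r]
    · rw [key r _ (gradedProj_mem r b), if_pos rfl]
    · intro s _ hs
      rw [key s _ (gradedProj_mem s b), if_neg (Ne.symm hs)]
    · intro hr
      exact absurd (Finset.mem_range.2 (lt_of_lt_of_le (Nat.lt_succ_self r) (le_max_right _ _))) hr

/-- A module with a linear resolution is generated by its component of degree zero. -/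
theorem exists_freeCover_eq (h : IsLinearModule 𝒜 η π) (hη : ∀ s, η s ∈ 𝒜 1) (r : ℕ) (x : N)
    (hx : π r x = x) : ∃ y, freeProj 𝒜 _ r y = y ∧ freeCover B π y = x := by
  induction r generalizing x with
  | zero =>
    refine ⟨1 ⊗ₜ ⟨x, ⟨x, hx⟩⟩, ?_, by simp⟩
    rw [freeProj, LinearMap.rTensor_tmul, gradedProj_eq_self_iff.2 SetLike.GradedOne.one_mem]
  | succ r ih =>
    obtain ⟨c', hc', hd⟩ := h.exact r 0 (fun _ => x) (fun _ => hx) (fun a ha => by omega)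
    choose y hy hy' using fun a => ih (c' a) (hc' a)
    refine ⟨cartanDiff η y 0, ?_, ?_⟩
    · rw [cartanDiff, map_sum]
      refine Finset.sum_congr rfl fun s _ => ?_
      have := freeProj_smul (hη s) r (y (0 + Pi.single s 1))
      rwa [hy, add_comm] at this
    · rw [← cartanDiff_map, ← hd 0 (by simp)]
      simp only [hy']

theorem freeCover_surjective (h : IsLinearModule 𝒜 η π) (hη : ∀ s, η s ∈ 𝒜 1) :
    Function.Surjective (freeCover B π) := by
  intro x
  obtain ⟨m, hm⟩ := h.sum_proj x
  choose y hy hy' using fun r =>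
    h.exists_freeCover_eq hη r (π r x) (by rw [h.proj_proj, if_pos rfl])
  exact ⟨∑ r ∈ Finset.range m, y r, by simp only [map_sum, hy', hm]⟩

/-- The projections to the homogeneous components of the kernel of the free cover, shifted so that
the lowest degree is zero. -/
noncomputable def syzygyProj (h : IsLinearModule 𝒜 η π) (r : ℕ) :
    LinearMap.ker (freeCover B π) →ₗ[k] LinearMap.ker (freeCover B π) where
  toFun x := ⟨freeProj 𝒜 _ (r + 1) (x : B ⊗[k] generatorSpace π), by
    rw [LinearMap.mem_ker, h.freeCover_freeProj, LinearMap.mem_ker.1 x.2, map_zero]⟩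
  map_add' x y := Subtype.ext (by simp)
  map_smul' c x := Subtype.ext (by simp)

@[simp] theorem coe_syzygyProj (h : IsLinearModule 𝒜 η π) (r : ℕ)
    (x : LinearMap.ker (freeCover B π)) :
    (h.syzygyProj r x : B ⊗[k] generatorSpace π) = freeProj 𝒜 _ (r + 1) x := rfl

/-- The free cover is injective in degree zero, where it is the identity map of `N₀`. -/
theorem freeProj_zero_eq_zero (h : IsLinearModule 𝒜 η π)
    (h0 : ∀ b ∈ 𝒜 0, ∃ c : k, b = algebraMap k B c) (x : LinearMap.ker (freeCover B π)) :
    freeProj 𝒜 _ 0 (x : B ⊗[k] generatorSpace π) = 0 := by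
  have key : ∀ y : B ⊗[k] generatorSpace π, ∃ w : generatorSpace π,
      freeProj 𝒜 _ 0 y = 1 ⊗ₜ w := by
    intro y
    induction y using TensorProduct.induction_on with
    | zero => exact ⟨0, by simp⟩
    | tmul b w =>
      obtain ⟨c, hc⟩ := h0 _ (gradedProj_mem 0 b)
      refine ⟨c • w, ?_⟩
      rw [freeProj, LinearMap.rTensor_tmul, hc, Algebra.algebraMap_eq_smul_one,
        TensorProduct.smul_tmul]
    | add y z hy hz =>
      obtain ⟨w, hw⟩ := hy
      obtain ⟨w', hw'⟩ := hz
      exact ⟨w + w', by rw [map_add, hw, hw', TensorProduct.tmul_add]⟩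
  obtain ⟨w, hw⟩ := key x
  have h1 := h.freeCover_freeProj 0 (x : B ⊗[k] generatorSpace π)
  rw [LinearMap.mem_ker.1 x.2, map_zero, hw, freeCover_tmul, one_smul] at h1
  rw [hw, Subtype.ext (a2 := (0 : generatorSpace π)) h1, TensorProduct.tmul_zero]

/-- The first syzygy module of a module with a linear resolution again has a linear resolution.
This is the long exact sequence of Cartan homology for `0 → N' → B ⊗ N₀ → N → 0`. -/
theorem syzygy (h : IsLinearModule 𝒜 η π) (hB : IsRegularOverExterior 𝒜 η)
    (h0 : ∀ b ∈ 𝒜 0, ∃ c : k, b = algebraMap k B c) :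
    IsLinearModule (N := LinearMap.ker (freeCover B π)) 𝒜 η h.syzygyProj where
  sum_proj x := by
    obtain ⟨m, hm⟩ := sum_freeProj (𝒜 := 𝒜) (x : B ⊗[k] generatorSpace π)
    refine ⟨m, Subtype.ext ?_⟩
    have h1 := hm (m + 1) (Nat.le_succ m)
    rw [Finset.sum_range_succ', h.freeProj_zero_eq_zero h0, add_zero] at h1
    rw [AddSubmonoidClass.coe_finsetSum]
    exact h1
  proj_proj r s x := by
    apply Subtype.ext
    simp only [coe_syzygyProj, freeProj_freeProj, add_left_inj]
    split_ifs <;> rfl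
  smul_proj hb r x := Subtype.ext (freeProj_smul hb (r + 1) (x : B ⊗[k] generatorSpace π))
  exact r i c hc hd := by
    classical
    let ι := (LinearMap.ker (freeCover B π)).subtype
    obtain ⟨e, he, hde⟩ := hB.exact_tensor r i (fun a => ι (c a))
      (fun a => congrArg Subtype.val (hc a)) (fun a ha =>
        (cartanDiff_map (η := η) ι c a).trans (by rw [hd a ha, map_zero]))
    -- the image of `e` in `N` is a cycle, hence a boundary `∂ g`; correct `e` by a lift of `g`
    obtain ⟨g, hg, hdg⟩ := h.exact r (i + 1) (fun a => freeCover B π (e a))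
      (fun a => by rw [← h.freeCover_freeProj, he]) (fun a ha => by
        rw [cartanDiff_map, hde a (by omega)]
        exact LinearMap.mem_ker.1 (c a).2)
    choose y hy hy' using fun a => h.exists_freeCover_eq hB.mem_one r (g a) (hg a)
    have hyd : ∀ a, freeProj 𝒜 _ (r + 1) (cartanDiff η y a) = cartanDiff η y a := by
      intro a
      rw [cartanDiff, map_sum]
      refine Finset.sum_congr rfl fun s _ => ?_
      have := freeProj_smul (hB.mem_one s) r (y (a + Pi.single s 1))
      rwa [hy, add_comm] at this
    have hker : ∀ a, ∑ s, a s = i + 1 → e a - cartanDiff η y a ∈ LinearMap.ker (freeCover B π) := by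
      intro a ha
      rw [LinearMap.mem_ker, map_sub, ← cartanDiff_map, sub_eq_zero, ← hdg a ha]
      simp only [hy']
    refine ⟨fun a => if ha : ∑ s, a s = i + 1 then ⟨_, hker a ha⟩ else 0, fun a => ?_,
      fun a ha => ?_⟩
    · dsimp only
      split_ifs with ha
      · exact Subtype.ext (by rw [coe_syzygyProj, map_sub, he, hyd])
      · exact map_zero _
    · apply (LinearMap.ker (freeCover B π)).injective_subtype
      refine (cartanDiff_map (N := LinearMap.ker (freeCover B π)) (η := η) ι _ a).symm.trans ?_
      rw [cartanDiff_congr (c' := fun a => e a - cartanDiff η y a) _ ha,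
        cartanDiff_sub, cartanDiff_cartanDiff hB.mul_add_mul hB.mul_self, sub_zero, hde a ha]
      intro a' ha'
      simp only [ha', dif_pos]
      rfl

end IsLinearModule

end Syzygy

section BarCycles

variable {P : Ideal B} {T : ℕ → Type*} [∀ i, AddCommGroup (T i)] [∀ i, Module k (T i)]
  (e : ∀ i, T (i + 1) ≃ₗ[k] T i ⊗[k] P) (𝒜)

/-- The subspace `B₁^{⊗ i}` of `T i = P^{⊗ i}`. -/
def linearTensors : ∀ i, Submodule k (T i)
  | 0 => ⊤
  | i + 1 => Submodule.span k
      {x | ∃ t ∈ linearTensors i, ∃ p : P, (p : B) ∈ 𝒜 1 ∧ x = (e i).symm (t ⊗ₜ p)}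

/-- The subspace `B₁^{⊗ i} ⊗ V` of `T i ⊗ N` for a subspace `V ⊆ N`. -/
def linearChains (i : ℕ) {N : Type*} [AddCommGroup N] [Module k N] (V : Submodule k N) :
    Submodule k (T i ⊗[k] N) :=
  Submodule.span k {x | ∃ t ∈ linearTensors 𝒜 e i, ∃ n ∈ V, x = t ⊗ₜ n}

/-- The condition of being a cycle of homological degree `i` in the bar complex. -/
def IsBarCycle {N : Type*} [AddCommGroup N] [Module k N] [Module B N] [IsScalarTower k B N] :
    ∀ i, T i ⊗[k] N → Prop
  | 0, _ => True
  | i + 1, x => coeffDiff e i N x = 0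

variable {𝒜}

omit [GradedAlgebra 𝒜] in
theorem linearChains_map {N N' : Type*} [AddCommGroup N] [Module k N] [AddCommGroup N']
    [Module k N'] (φ : N →ₗ[k] N') {V : Submodule k N} {V' : Submodule k N'}
    (h : ∀ x ∈ V, φ x ∈ V') (i : ℕ) {x : T i ⊗[k] N} (hx : x ∈ linearChains 𝒜 e i V) :
    φ.lTensor (T i) x ∈ linearChains 𝒜 e i V' := by
  induction hx using Submodule.span_induction with
  | mem x hx =>
    obtain ⟨t, ht, n, hn, rfl⟩ := hx
    exact Submodule.subset_span ⟨t, ht, φ n, h n hn, by simp⟩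
  | zero => simp
  | add x y _ _ hx hy => rw [map_add]; exact add_mem hx hy
  | smul c x _ hx => rw [map_smul]; exact Submodule.smul_mem _ _ hx

/-- Dimension shifting for the bar complex along `0 → N' → B ⊗ W → N → 0`: if all cycles with
coefficients in `N'` are homologous to linear ones, so are all cycles with coefficients in `N`,
one homological degree higher. -/
theorem exists_eq_add_linear_of_exact {r : B →ₗ[k] P} (hr : ∀ p : P, r p = p)
    (hP : ∀ p ∈ P, ∀ b : B, p * b ∈ P) (hb : ∀ b : B, ∃ c : k, b = r b + algebraMap k B c)
    (hP1 : ∀ b ∈ 𝒜 1, b ∈ P) {N N' W : Type*} [AddCommGroup N] [Module k N] [Module B N]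
    [IsScalarTower k B N] [AddCommGroup N'] [Module k N'] [Module B N'] [IsScalarTower k B N']
    [AddCommGroup W] [Module k W] {ι : N' →ₗ[B] B ⊗[k] W} {μ : B ⊗[k] W →ₗ[B] N}
    (hι : Function.Injective ι) (hμ : Function.Surjective μ) (hιμ : Function.Exact ι μ)
    {V' : Submodule k N'} {V : Submodule k N}
    (hV' : ∀ x ∈ V', ι x ∈ LinearMap.range (freeProj 𝒜 W 1)) (hV : ∀ w, μ (1 ⊗ₜ w) ∈ V) (i : ℕ)
    (ih : ∀ x : T i ⊗[k] N', IsBarCycle e i x →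
      ∃ (y : T (i + 1) ⊗[k] N') (g : T i ⊗[k] N'),
        x = coeffDiff e i N' y + g ∧ g ∈ linearChains 𝒜 e i V')
    (x : T (i + 1) ⊗[k] N) (hx : IsBarCycle e (i + 1) x) :
    ∃ (y : T (i + 2) ⊗[k] N) (g : T (i + 1) ⊗[k] N),
      x = coeffDiff e (i + 1) N y + g ∧ g ∈ linearChains 𝒜 e (i + 1) V := by
  let μ' := μ.restrictScalars k
  let ι' := ι.restrictScalars k
  have hex : Function.Exact ι' μ' := hιμ
  obtain ⟨x, rfl⟩ := LinearMap.lTensor_surjective (T (i + 1))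
    (g := μ') hμ x
  have hx' : μ'.lTensor (T i) (coeffDiff e i _ x) = 0 := by
    rw [← coeffDiff_lTensor]; exact hx
  obtain ⟨c, hc⟩ := (lTensor_exact (T i) hex hμ _).1 hx'
  have hinj : ∀ j, Function.Injective (ι'.lTensor (T j)) := fun j =>
    Module.Flat.lTensor_preserves_injective_linearMap _ hι
  have hcyc : IsBarCycle e i c := by
    cases i with
    | zero => trivial
    | succ i =>
      apply hinj i
      rw [← coeffDiff_lTensor, hc, coeffDiff_coeffDiff, map_zero]
  obtain ⟨y, g, hcy, hg⟩ := ih c hcyc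
  let f := ι'.lTensor (T i) g
  have hf : f = coeffDiff e i _ (x - ι'.lTensor _ y) := by
    rw [map_sub, coeffDiff_lTensor, ← hc, ← map_sub]
    exact congrArg _ (by rw [hcy]; abel)
  -- the linear cycle `f` is the differential of its image under the contracting homotopy
  have hfP : f ∈ Submodule.span k {x : T i ⊗[k] (B ⊗[k] W) |
      ∃ t ∈ linearTensors 𝒜 e i, ∃ b ∈ 𝒜 1, ∃ w, x = t ⊗ₜ (b ⊗ₜ w)} := by
    have h1 : f ∈ linearChains 𝒜 e i (LinearMap.range (freeProj 𝒜 W 1)) := by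
      exact linearChains_map e ι' hV' i hg
    refine Submodule.span_le.2 ?_ h1
    rintro _ ⟨t, ht, _, ⟨n, rfl⟩, rfl⟩
    induction n using TensorProduct.induction_on with
    | zero => simp
    | add x y hx hy =>
      rw [map_add, TensorProduct.tmul_add]; exact add_mem hx hy
    | tmul b w =>
      exact Submodule.subset_span ⟨t, ht, _, gradedProj_mem 1 b, w, rfl⟩
  let σ := freeHomotopy e r W i f
  have hσf : coeffDiff e i _ σ = f := by
    cases i with
    | zero =>
      clear_value f
      change coeffDiff e 0 _ (freeHomotopy e r W 0 f) = f
      clear σ hf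
      induction hfP using Submodule.span_induction with
      | mem x hx =>
        obtain ⟨t, _, b, hb1, w, rfl⟩ := hx
        rw [coeffDiff_freeHomotopy_tmul]
        have := hr ⟨b, hP1 b hb1⟩
        simp only at this
        simp [towerDiff, this]
      | zero => simp
      | add x y _ _ hx hy => simp only [map_add, hx, hy]
      | smul c x _ hx => simp only [map_smul, hx]
    | succ i =>
      have h1 := freeHomotopy_formula e hr hP hb i f
      rwa [hf, coeffDiff_coeffDiff, map_zero, add_zero, ← hf] at h1
  let z := x - ι'.lTensor _ y - σ
  have hz : coeffDiff e i _ z = 0 := by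
    rw [map_sub, hσf, hf, sub_self]
  have hz' := freeHomotopy_formula e hr hP hb i z
  rw [hz, map_zero, add_zero] at hz'
  refine ⟨μ'.lTensor _ (freeHomotopy e r _ (i + 1) z), μ'.lTensor _ σ, ?_, ?_⟩
  · rw [coeffDiff_lTensor, hz', ← map_add]
    have hμι : μ'.lTensor (T (i + 1)) (ι'.lTensor _ y) = 0 := by
      rw [← LinearMap.comp_apply, ← LinearMap.lTensor_comp, hex.linearMap_comp_eq_zero]
      simp
    rw [show z + σ = x - ι'.lTensor _ y by simp [z], map_sub, hμι, sub_zero]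
  · have hmem : σ ∈ linearChains 𝒜 e (i + 1)
        (Submodule.span k {x : B ⊗[k] W | ∃ w, x = 1 ⊗ₜ w}) := by
      change freeHomotopy e r W i f ∈ _
      clear_value f
      clear σ hσf z hz hz' hf
      induction hfP using Submodule.span_induction with
      | mem x hx =>
        obtain ⟨t, ht, b, hb1, w, rfl⟩ := hx
        rw [freeHomotopy_tmul]
        refine Submodule.smul_mem _ _ (Submodule.subset_span ⟨_, Submodule.subset_span
          ⟨t, ht, r b, ?_, rfl⟩, _, Submodule.subset_span ⟨w, rfl⟩, rfl⟩)
        have := hr ⟨b, hP1 b hb1⟩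
        simp only at this
        rw [this]; exact hb1
      | zero => simp
      | add x y _ _ hx hy => rw [map_add]; exact add_mem hx hy
      | smul c x _ hx => rw [map_smul]; exact Submodule.smul_mem _ _ hx
    refine linearChains_map e μ' ?_ (i + 1) hmem
    intro n hn
    induction hn using Submodule.span_induction with
    | mem x hx =>
      obtain ⟨w, rfl⟩ := hx
      exact hV w
    | zero => simp
    | add x y _ _ hx hy => rw [map_add]; exact add_mem hx hy
    | smul c x _ hx => rw [map_smul]; exact Submodule.smul_mem _ _ hx

/-- In the bar complex with coefficients in a module with a linear resolution, every cycle is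
homologous to an element of `B₁ ⊗ ⋯ ⊗ B₁ ⊗ N₀`. The proof is by dimension shifting along
`0 → N' → B ⊗ N₀ → N → 0`. -/
theorem IsLinearModule.exists_eq_add_linear (hB : IsRegularOverExterior 𝒜 η)
    (h0 : ∀ b ∈ 𝒜 0, ∃ c : k, b = algebraMap k B c) {r : B →ₗ[k] P} (hr : ∀ p : P, r p = p)
    (hP : ∀ p ∈ P, ∀ b : B, p * b ∈ P) (hb : ∀ b : B, ∃ c : k, b = r b + algebraMap k B c)
    (hP1 : ∀ b ∈ 𝒜 1, b ∈ P) (i : ℕ) :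
    ∀ {N : Type w} [AddCommGroup N] [Module k N] [Module B N] [IsScalarTower k B N]
      {π : ℕ → N →ₗ[k] N}, IsLinearModule 𝒜 η π → ∀ x : T i ⊗[k] N, IsBarCycle e i x →
      ∃ (y : T (i + 1) ⊗[k] N) (g : T i ⊗[k] N),
        x = coeffDiff e i N y + g ∧ g ∈ linearChains 𝒜 e i (generatorSpace π) := by
  induction i with
  | zero =>
    intro N _ _ _ _ π h x hx
    clear hx
    obtain ⟨x, rfl⟩ := LinearMap.lTensor_surjective (T 0)
      (g := (freeCover B π).restrictScalars k) (h.freeCover_surjective hB.mem_one) x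
    suffices hs : ∃ (y : T 1 ⊗[k] N) (g : T 0 ⊗[k] N),
        ((freeCover B π).restrictScalars k).lTensor (T 0) x = coeffDiff e 0 N y + g ∧
          g ∈ linearChains 𝒜 e 0 (generatorSpace π) by
      obtain ⟨y, g, h1, h2⟩ := hs; exact ⟨y, g, h1, h2⟩
    induction x using TensorProduct.induction_on with
    | zero => exact ⟨0, 0, by simp, zero_mem _⟩
    | add x y hx hy =>
      obtain ⟨y1, g1, h1, h1'⟩ := hx
      obtain ⟨y2, g2, h2, h2'⟩ := hy
      refine ⟨y1 + y2, g1 + g2, ?_, add_mem h1' h2'⟩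
      rw [map_add, map_add, h1, h2]; abel
    | tmul t f =>
      induction f using TensorProduct.induction_on with
      | zero => exact ⟨0, 0, by simp, zero_mem _⟩
      | add x y hx hy =>
        obtain ⟨y1, g1, h1, h1'⟩ := hx
        obtain ⟨y2, g2, h2, h2'⟩ := hy
        refine ⟨y1 + y2, g1 + g2, ?_, add_mem h1' h2'⟩
        rw [TensorProduct.tmul_add, map_add, map_add, h1, h2]; abel
      | tmul b w =>
        obtain ⟨c, hc⟩ := hb b
        refine ⟨(e 0).symm (t ⊗ₜ r b) ⊗ₜ (w : N), t ⊗ₜ (c • (w : N)), ?_,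
          Submodule.subset_span ⟨t, trivial, _, Submodule.smul_mem _ _ w.2, rfl⟩⟩
        rw [coeffDiff_symm_tmul]
        simp only [towerDiff, LinearMap.zero_apply, TensorProduct.zero_tmul, zero_add, pow_zero,
          one_smul, LinearMap.lTensor_tmul, LinearMap.coe_restrictScalars, freeCover_tmul]
        rw [← TensorProduct.tmul_add, ← algebraMap_smul B c (w : N), ← add_smul, ← hc]
  | succ i ih =>
    intro N _ _ _ _ π h x hx
    refine exists_eq_add_linear_of_exact (N' := LinearMap.ker (freeCover B π)) e hr hP hb hP1
      (ι := (LinearMap.ker (freeCover B π)).subtype) (μ := freeCover B π)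
      (Submodule.injective_subtype _) (h.freeCover_surjective hB.mem_one) (fun y => ?_)
      (V' := generatorSpace h.syzygyProj) ?_ (fun w => by simp) i
      (ih (N := LinearMap.ker (freeCover B π)) (h.syzygy hB h0)) x hx
    · exact ⟨fun hy => ⟨⟨y, hy⟩, rfl⟩, by rintro ⟨y, rfl⟩; exact y.2⟩
    · rintro _ ⟨x, rfl⟩
      exact ⟨x, rfl⟩

end BarCycles

end LinearSyzygy

/-! ### Koszulity from regularity -/

section TensorPowers

variable (k : Type*) [Field k] (M : Type*) [AddCommGroup M] [Module k M]

/-- The isomorphism `M^{⊗ (i + 1)} ≃ M^{⊗ i} ⊗ M` splitting off the last factor. -/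
noncomputable def tensorPowerSnoc (i : ℕ) : (⨂[k]^(i + 1) M) ≃ₗ[k] (⨂[k]^i M) ⊗[k] M :=
  (TensorPower.mulEquiv (n := i) (m := 1)).symm ≪≫ₗ
    TensorProduct.congr (LinearEquiv.refl k _)
      (PiTensorProduct.subsingletonEquiv (R := k) (s := fun _ => M) (0 : Fin 1))

variable {M}

theorem tensorPowerSnoc_symm_tmul (i : ℕ) (a : Fin i → M) (m : M) :
    (tensorPowerSnoc k M i).symm (PiTensorProduct.tprod k a ⊗ₜ m) =
      PiTensorProduct.tprod k (Fin.snoc a m : Fin (i + 1) → M) := by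
  have h : (PiTensorProduct.subsingletonEquiv (R := k) (s := fun _ => M) (0 : Fin 1)).symm m =
      PiTensorProduct.tprod k (fun _ => m) := by
    rw [LinearEquiv.symm_apply_eq, PiTensorProduct.subsingletonEquiv_apply_tprod]
  rw [tensorPowerSnoc, LinearEquiv.trans_symm, LinearEquiv.trans_apply, LinearEquiv.symm_symm,
    TensorProduct.congr_symm_tmul, h, LinearEquiv.refl_symm, LinearEquiv.refl_apply]
  have := TensorPower.tprod_mul_tprod k a (fun _ : Fin 1 => m)
  rw [TensorPower.gMul_def] at this
  rw [this, Fin.append_right_eq_snoc]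

end TensorPowers

section Contract

variable {B : Type*} [Mul B]

theorem contractNth_castSucc_eq_snoc {i : ℕ} (s : Fin i) (a : Fin (i + 2) → B) :
    Fin.contractNth s.castSucc.castSucc (· * ·) a =
      (Fin.snoc (Fin.contractNth s.castSucc (· * ·) (Fin.init a)) (a (Fin.last _)) :
        Fin (i + 1) → B) := by
  funext t
  induction t using Fin.lastCases with
  | last =>
    rw [Fin.snoc_last, Fin.contractNth_apply_of_gt _ _ _ _ (by simp)]
    simp
  | cast t =>
    rw [Fin.snoc_castSucc]
    simp only [Fin.contractNth, Fin.init, Fin.val_castSucc]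
    split_ifs <;> rfl

theorem contractNth_last_eq_snoc {i : ℕ} (a : Fin (i + 2) → B) :
    Fin.contractNth (Fin.last i).castSucc (· * ·) a =
      (Fin.snoc (Fin.init (Fin.init a)) (a (Fin.last i).castSucc * a (Fin.last _)) :
        Fin (i + 1) → B) := by
  funext t
  induction t using Fin.lastCases with
  | last =>
    rw [Fin.snoc_last, Fin.contractNth_apply_of_eq _ _ _ _ (by simp)]
    simp
  | cast t =>
    rw [Fin.snoc_castSucc, Fin.contractNth_apply_of_lt _ _ _ _ (by simp)]
    rfl

theorem sum_contractNth {i : ℕ} (s : Fin i) (n : Fin (i + 1) → ℕ) :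
    ∑ t, Fin.contractNth s.castSucc (· + ·) n t = ∑ t, n t := by
  rw [Fin.sum_univ_succAbove n s.castSucc]
  have h : ∀ t, Fin.contractNth s.castSucc (· + ·) n t =
      n (s.castSucc.succAbove t) + if t = s then n s.castSucc else 0 := by
    intro t
    rcases lt_trichotomy (t : ℕ) s with h | h | h
    · rw [Fin.contractNth_apply_of_lt _ _ _ _ (by exact h),
        Fin.succAbove_of_castSucc_lt _ _ (by exact h),
        if_neg (by intro h'; subst h'; omega), add_zero]
    · obtain rfl : t = s := Fin.ext h
      rw [Fin.contractNth_apply_of_eq _ _ _ _ (by simp),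
        Fin.succAbove_of_le_castSucc _ _ le_rfl, if_pos rfl, add_comm]
    · rw [Fin.contractNth_apply_of_gt _ _ _ _ (by exact h),
        Fin.succAbove_of_le_castSucc _ _ (by exact h.le),
        if_neg (by intro h'; subst h'; omega), add_zero]
  simp only [h, Finset.sum_add_distrib, Finset.sum_ite_eq', Finset.mem_univ, if_true]
  rw [add_comm]

theorem contractNth_pos {i : ℕ} (s : Fin i) (n : Fin (i + 1) → ℕ) (hn : ∀ t, 1 ≤ n t) (t : Fin i) :
    1 ≤ Fin.contractNth s.castSucc (· + ·) n t := by
  simp only [Fin.contractNth]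
  split_ifs
  · exact hn _
  · exact le_trans (hn _) (Nat.le_add_right _ _)
  · exact hn _

end Contract

section BarComparison

variable {k B : Type*} [Field k] [Ring B] [Algebra k B] (P : Ideal B)

/-- The embedding of the tensor powers of an ideal into the tensor powers of the algebra. -/
noncomputable def tensorPowerIncl (i : ℕ) : (⨂[k]^i P) →ₗ[k] (⨂[k]^i B) :=
  PiTensorProduct.map fun _ => P.subtype.restrictScalars k

theorem tensorPowerIncl_tprod (i : ℕ) (a : Fin i → P) :
    tensorPowerIncl P i (PiTensorProduct.tprod k a) =
      PiTensorProduct.tprod k (fun s => (a s : B)) := by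
  simp [tensorPowerIncl]

theorem tensorPowerIncl_injective (r : B →ₗ[k] P) (hr : ∀ p : P, r p = p) (i : ℕ) :
    Function.Injective (tensorPowerIncl (k := k) P i) := by
  refine Function.LeftInverse.injective (g := PiTensorProduct.map fun _ => r) fun x => ?_
  rw [tensorPowerIncl, ← LinearMap.comp_apply, ← PiTensorProduct.map_comp]
  have : (r ∘ₗ P.subtype.restrictScalars k) = LinearMap.id := LinearMap.ext hr
  rw [this, PiTensorProduct.map_id]
  rfl

theorem tensorPowerIncl_snoc (i : ℕ) (x : ⨂[k]^i P) (p : P) :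
    tensorPowerIncl P (i + 1) ((tensorPowerSnoc k P i).symm (x ⊗ₜ p)) =
      (tensorPowerSnoc k B i).symm (tensorPowerIncl P i x ⊗ₜ (p : B)) := by
  induction x using PiTensorProduct.induction_on with
  | smul_tprod c a =>
    rw [← TensorProduct.smul_tmul', map_smul, map_smul, map_smul, ← TensorProduct.smul_tmul',
      map_smul, tensorPowerSnoc_symm_tmul, tensorPowerIncl_tprod, tensorPowerIncl_tprod,
      tensorPowerSnoc_symm_tmul]
    congr 2
    funext t
    induction t using Fin.lastCases <;> simp
  | add x y hx hy => simp only [TensorProduct.add_tmul, map_add, hx, hy]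

/-- The differential of the bar complex of the nonunital algebra `P`, defined by recursion, is the
restriction of the bar differential of `B`. -/
theorem barDifferential_tensorPowerIncl (i : ℕ) (x : ⨂[k]^(i + 1) P) :
    barDifferential k B i (tensorPowerIncl P (i + 1) x) =
      tensorPowerIncl P i (towerDiff (T := fun i => ⨂[k]^i P) (tensorPowerSnoc k P) i x) := by
  induction i with
  | zero => simp [barDifferential, towerDiff]
  | succ i ih =>
    induction x using PiTensorProduct.induction_on with
    | add x y hx hy => simp only [map_add, hx, hy]
    | smul_tprod c a =>
      rw [map_smul, map_smul, map_smul, map_smul]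
      congr 1
      have h1 : ∀ (j : ℕ) (a : Fin (j + 1) → P), PiTensorProduct.tprod k a =
          (tensorPowerSnoc k P j).symm
            (PiTensorProduct.tprod k (Fin.init a) ⊗ₜ a (Fin.last j)) := by
        intro j a
        rw [tensorPowerSnoc_symm_tmul, Fin.snoc_init_self]
      conv_rhs => rw [h1, towerDiff_symm_tmul (T := fun i => ⨂[k]^i P) (tensorPowerSnoc k P)]
      rw [map_add, tensorPowerIncl_snoc, ← ih, map_smul]
      conv_rhs =>
        enter [2, 2]
        rw [h1 i, lastAction_symm_tmul (T := fun i => ⨂[k]^i P) (tensorPowerSnoc k P),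
          tensorPowerIncl_snoc]
      rw [tensorPowerIncl_tprod, tensorPowerIncl_tprod, tensorPowerIncl_tprod]
      simp only [barDifferential, LinearMap.sum_apply, LinearMap.smul_apply, barFace,
        PiTensorProduct.lift.tprod, MultilinearMap.coe_mk]
      rw [Fin.sum_univ_castSucc, TensorProduct.sum_tmul, map_sum]
      congr 1
      · refine Finset.sum_congr rfl fun s _ => ?_
        rw [← TensorProduct.smul_tmul', map_smul, tensorPowerSnoc_symm_tmul,
          contractNth_castSucc_eq_snoc]
        rfl
      · rw [contractNth_last_eq_snoc, tensorPowerSnoc_symm_tmul]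
        rfl

end BarComparison

section BarGrading

variable {k B : Type*} [Field k] [Ring B] [Algebra k B] {𝒜 : ℕ → Submodule k B} [GradedAlgebra 𝒜]

theorem barDifferential_mem {i j : ℕ} {x : ⨂[k]^(i + 1) B} (hx : x ∈ barComponent 𝒜 (i + 1) j) :
    barDifferential k B i x ∈ barComponent 𝒜 i j := by
  induction hx using Submodule.span_induction with
  | mem x hx =>
    obtain ⟨n, a, ha, hn, rfl⟩ := hx
    rw [barDifferential, LinearMap.sum_apply]
    refine sum_mem fun s _ => ?_
    rw [LinearMap.smul_apply]
    refine Submodule.smul_mem _ _ (Submodule.subset_span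
      ⟨Fin.contractNth s.castSucc (· + ·) n, Fin.contractNth s.castSucc (· * ·) a,
        fun t => ⟨contractNth_pos s n (fun t => (ha t).1) t, ?_⟩, by rw [sum_contractNth, hn], ?_⟩)
    · simp only [Fin.contractNth]
      split_ifs
      · exact (ha _).2
      · exact SetLike.mul_mem_graded (ha _).2 (ha _).2
      · exact (ha _).2
    · simp [barFace]
  | zero => simp
  | add x y _ _ hx hy => rw [map_add]; exact add_mem hx hy
  | smul c x _ hx => rw [map_smul]; exact Submodule.smul_mem _ _ hx

/-- The components of the reduced bar complex of different internal degrees are independent. -/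
theorem eq_zero_of_mem_barComponent {i j : ℕ} {x : ⨂[k]^i B} (hx : x ∈ barComponent 𝒜 i j)
    (hx' : x ∈ ⨆ (j' : ℕ) (_ : j' ≠ j), barComponent 𝒜 i j') : x = 0 := by
  classical
  -- the projections of `B^{⊗ i}` to its multihomogeneous components
  let p : (Fin i → ℕ) → (⨂[k]^i B) →ₗ[k] (⨂[k]^i B) := fun n =>
    PiTensorProduct.map fun s => GradedAlgebra.proj 𝒜 (n s)
  have hp : ∀ (n m : Fin i → ℕ) (a : Fin i → B), (∀ s, a s ∈ 𝒜 (m s)) →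
      p n (PiTensorProduct.tprod k a) = if n = m then PiTensorProduct.tprod k a else 0 := by
    intro n m a ha
    simp only [p, PiTensorProduct.map_tprod]
    split_ifs with h
    · subst h
      congr 1
      funext s
      exact gradedProj_eq_self_iff.2 (ha s)
    · obtain ⟨s, hs⟩ := Function.ne_iff.1 h
      exact MultilinearMap.map_coord_zero _ s (DirectSum.decompose_of_mem_ne 𝒜 (ha s) (Ne.symm hs))
  have hzero : ∀ (j' : ℕ) (y : ⨂[k]^i B), y ∈ barComponent 𝒜 i j' → ∀ n : Fin i → ℕ,
      ∑ s, n s ≠ j' → p n y = 0 := by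
    intro j' y hy n hn
    induction hy using Submodule.span_induction with
    | mem x hx =>
      obtain ⟨m, a, ha, hm, rfl⟩ := hx
      rw [hp n m a fun s => (ha s).2, if_neg]
      rintro rfl; exact hn hm
    | zero => simp
    | add x y _ _ hx hy => rw [map_add, hx, hy, add_zero]
    | smul c x _ hx => rw [map_smul, hx, smul_zero]
  have hall : ∀ n, p n x = 0 := by
    intro n
    by_cases hn : ∑ s, n s = j
    · have : (⨆ (j' : ℕ) (_ : j' ≠ j), barComponent 𝒜 i j') ≤ LinearMap.ker (p n) :=
        iSup₂_le fun j' hj' y hy => hzero j' y hy n (by rw [hn]; exact hj'.symm)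
      exact this hx'
    · exact hzero j x hx n hn
  have hsum : ∑ n ∈ Fintype.piFinset fun _ : Fin i => Finset.range (j + 1), p n x = x := by
    clear hx' hall
    induction hx using Submodule.span_induction with
    | mem x hx =>
      obtain ⟨m, a, ha, hm, rfl⟩ := hx
      rw [Finset.sum_eq_single m]
      · rw [hp m m a fun s => (ha s).2, if_pos rfl]
      · intro n _ hn
        rw [hp n m a fun s => (ha s).2, if_neg hn]
      · intro h
        refine absurd (Fintype.mem_piFinset.2 fun s => ?_) h
        have := Finset.single_le_sum (f := m) (fun _ _ => Nat.zero_le _) (Finset.mem_univ s)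
        rw [Finset.mem_range]; omega
    | zero => simp
    | add x y _ _ hx hy => simp only [map_add, Finset.sum_add_distrib, hx, hy]
    | smul c x _ hx => simp only [map_smul, ← Finset.smul_sum, hx]
  rw [← hsum]
  exact Finset.sum_eq_zero fun n _ => hall n

end BarGrading

section Criterion

universe w

variable {k : Type*} {B : Type w} [Field k] [Ring B] [Algebra k B] (𝒜 : ℕ → Submodule k B)
  [GradedAlgebra 𝒜] {u : ℕ} {η : Fin u → B}

/-- The ideal of elements of positive degree. -/
noncomputable def positiveIdeal : Ideal B := RingHom.ker (GradedRing.projZeroRingHom 𝒜)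

instance : (positiveIdeal 𝒜).IsTwoSided :=
  inferInstanceAs (RingHom.ker (GradedRing.projZeroRingHom 𝒜)).IsTwoSided

variable {𝒜}

theorem mem_positiveIdeal {b : B} : b ∈ positiveIdeal 𝒜 ↔ GradedAlgebra.proj 𝒜 0 b = 0 := Iff.rfl

theorem mem_positiveIdeal_of_mem {n : ℕ} {b : B} (hb : b ∈ 𝒜 n) (hn : n ≠ 0) :
    b ∈ positiveIdeal 𝒜 :=
  DirectSum.decompose_of_mem_ne 𝒜 hb hn

variable (𝒜)

/-- The projection of a graded algebra to its ideal of elements of positive degree. -/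
noncomputable def positiveProj : B →ₗ[k] positiveIdeal 𝒜 where
  toFun b := ⟨b - GradedAlgebra.proj 𝒜 0 b, by
    rw [mem_positiveIdeal, map_sub, gradedProj_proj, if_pos rfl, sub_self]⟩
  map_add' x y := Subtype.ext (by simp only [map_add, Submodule.coe_add]; abel)
  map_smul' c x := Subtype.ext (by
    simp only [map_smul, RingHom.id_apply, Submodule.coe_smul_of_tower, smul_sub])

/-- The projections to the homogeneous components of the module `⨁ₙ 𝒜ₙ₊₁`. -/
noncomputable def positiveIdealProj (r : ℕ) : positiveIdeal 𝒜 →ₗ[k] positiveIdeal 𝒜 where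
  toFun x := ⟨GradedAlgebra.proj 𝒜 (r + 1) (x : B),
    mem_positiveIdeal_of_mem (gradedProj_mem _ _) (Nat.succ_ne_zero r)⟩
  map_add' x y := Subtype.ext (by simp)
  map_smul' c x := Subtype.ext (by simp)

variable {𝒜}

/-- If `B` has regularity at most one, the module `B₊` has a linear resolution. -/
theorem IsRegularOverExterior.isLinearModule (h : IsRegularOverExterior 𝒜 η) :
    IsLinearModule (N := positiveIdeal 𝒜) 𝒜 η (positiveIdealProj 𝒜) where
  sum_proj x := by
    obtain ⟨m, hm⟩ := sum_gradedProj (𝒜 := 𝒜) (x : B)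
    refine ⟨m, Subtype.ext ?_⟩
    have h1 := hm (m + 1) (Nat.le_succ m)
    rw [Finset.sum_range_succ', mem_positiveIdeal.1 x.2, add_zero] at h1
    rw [AddSubmonoidClass.coe_finsetSum]
    exact h1
  proj_proj r s x := by
    apply Subtype.ext
    change GradedAlgebra.proj 𝒜 (r + 1) (GradedAlgebra.proj 𝒜 (s + 1) (x : B)) = _
    rw [gradedProj_proj]
    simp only [add_left_inj]
    split_ifs <;> rfl
  smul_proj hb r x := by
    have := SetLike.mul_mem_graded hb (gradedProj_mem (𝒜 := 𝒜) (r + 1) (x : B))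
    exact Subtype.ext (gradedProj_eq_self_iff.2 this)
  exact r i c hc hd := by
    have hcoe : ∀ (c : (Fin u → ℕ) → positiveIdeal 𝒜) a,
        cartanDiff η (fun a => (c a : B)) a = (cartanDiff η c a : positiveIdeal 𝒜) := by
      intro c a
      simp [cartanDiff, AddSubmonoidClass.coe_finsetSum]
    obtain ⟨c', hc', hd'⟩ := h.exact r i (fun a => (c a : B))
      (fun a => gradedProj_eq_self_iff.1 (congrArg Subtype.val (hc a)))
      (fun a ha => by rw [hcoe, hd a ha]; rfl)
    refine ⟨fun a => ⟨c' a, mem_positiveIdeal_of_mem (hc' a) (Nat.succ_ne_zero r)⟩,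
      fun a => Subtype.ext (gradedProj_eq_self_iff.2 (hc' a)), fun a ha => Subtype.ext ?_⟩
    rw [← hcoe, ← hd' a ha]

/-- A tensor product of elements of positive degree is a sum of elements of the components of the
reduced bar complex. -/
theorem tensorPowerIncl_mem (i : ℕ) (x : ⨂[k]^i (positiveIdeal 𝒜)) :
    tensorPowerIncl (positiveIdeal 𝒜) i x ∈ ⨆ j, barComponent 𝒜 i j := by
  classical
  induction x using PiTensorProduct.induction_on with
  | add x y hx hy => rw [map_add]; exact add_mem hx hy
  | smul_tprod c a =>
    rw [map_smul, tensorPowerIncl_tprod]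
    refine Submodule.smul_mem _ _ ?_
    have h : ∀ s, ∃ m, ∑ r ∈ Finset.range m, GradedAlgebra.proj 𝒜 (r + 1) (a s : B) = a s := by
      intro s
      obtain ⟨m, hm⟩ := sum_gradedProj (𝒜 := 𝒜) (a s : B)
      refine ⟨m, ?_⟩
      have h1 := hm (m + 1) (Nat.le_succ m)
      rwa [Finset.sum_range_succ', mem_positiveIdeal.1 (a s).2, add_zero] at h1
    choose m hm using h
    rw [← funext hm, MultilinearMap.map_sum_finset]
    refine sum_mem fun n _ => Submodule.mem_iSup_of_mem (∑ s, (n s + 1)) ?_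
    exact Submodule.subset_span ⟨fun s => n s + 1, _,
      fun s => ⟨Nat.succ_le_succ (Nat.zero_le _), gradedProj_mem _ _⟩, rfl, rfl⟩

theorem barComponent_le_range (i j : ℕ) :
    barComponent 𝒜 i j ≤ LinearMap.range (tensorPowerIncl (k := k) (positiveIdeal 𝒜) i) := by
  refine Submodule.span_le.2 ?_
  rintro _ ⟨n, a, ha, _, rfl⟩
  refine ⟨PiTensorProduct.tprod k fun s =>
    ⟨a s, mem_positiveIdeal_of_mem (ha s).2 (by have := (ha s).1; omega)⟩, ?_⟩
  rw [tensorPowerIncl_tprod]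

theorem tensorPowerIncl_linearTensors (i : ℕ) (x : ⨂[k]^i (positiveIdeal 𝒜))
    (hx : x ∈ linearTensors (T := fun i => ⨂[k]^i (positiveIdeal 𝒜)) 𝒜
      (tensorPowerSnoc k (positiveIdeal 𝒜)) i) :
    tensorPowerIncl (positiveIdeal 𝒜) i x ∈ barComponent 𝒜 i i := by
  induction i with
  | zero =>
    clear hx
    induction x using PiTensorProduct.induction_on with
    | add x y hx hy => rw [map_add]; exact add_mem hx hy
    | smul_tprod c a =>
      rw [map_smul, tensorPowerIncl_tprod]
      exact Submodule.smul_mem _ _ (Submodule.subset_span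
        ⟨fun _ => 1, _, fun s => s.elim0, by simp, rfl⟩)
  | succ i ih =>
    induction hx using Submodule.span_induction with
    | zero => simp
    | add x y _ _ hx hy => rw [map_add]; exact add_mem hx hy
    | smul c x _ hx => rw [map_smul]; exact Submodule.smul_mem _ _ hx
    | mem x hx =>
      obtain ⟨t, ht, p, hp, rfl⟩ := hx
      have ht' := ih t ht
      refine Eq.symm (tensorPowerIncl_snoc (positiveIdeal 𝒜) i t p) ▸ ?_
      generalize tensorPowerIncl (positiveIdeal 𝒜) i t = y at ht'
      suffices hs : ∀ j, y ∈ barComponent 𝒜 i j →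
          (tensorPowerSnoc k B i).symm (y ⊗ₜ (p : B)) ∈ barComponent 𝒜 (i + 1) (j + 1) from
        hs i ht'
      clear ht' ht
      intro j hy
      induction hy using Submodule.span_induction with
      | zero => simp
      | add x y _ _ hx hy => rw [TensorProduct.add_tmul, map_add]; exact add_mem hx hy
      | smul c x _ hx =>
        rw [← TensorProduct.smul_tmul', map_smul]; exact Submodule.smul_mem _ _ hx
      | mem x hx =>
        obtain ⟨n, a, ha, hn, rfl⟩ := hx
        rw [tensorPowerSnoc_symm_tmul]
        refine Submodule.subset_span ⟨Fin.snoc n 1, _, fun s => ?_, ?_, rfl⟩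
        · induction s using Fin.lastCases with
          | last => simpa using hp
          | cast s => simpa using ha s
        · rw [Fin.sum_univ_castSucc]; simp [hn]

/-- A connected graded algebra which has regularity at most one over the exterior algebra is
Koszul. -/
theorem IsRegularOverExterior.isKoszul (h : IsRegularOverExterior 𝒜 η)
    (h0 : Function.Bijective (algebraMap k (𝒜 0))) : IsKoszul 𝒜 := by
  refine ⟨h0, fun i j hij => ?_⟩
  rw [Submodule.Quotient.subsingleton_iff, Submodule.submoduleOf,
    Submodule.comap_subtype_eq_top]
  intro x hx
  have h0' : ∀ b ∈ 𝒜 0, ∃ c : k, b = algebraMap k B c := by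
    intro b hb
    obtain ⟨c, hc⟩ := h0.2 ⟨b, hb⟩
    exact ⟨c, (congrArg Subtype.val hc).symm⟩
  cases i with
  | zero =>
    have : barComponent 𝒜 0 j = ⊥ := by
      refine Submodule.span_eq_bot.2 ?_
      rintro _ ⟨n, a, _, hn, _⟩
      exact absurd (by simpa using hn) hij
    rw [barCycles, this, Submodule.mem_bot] at hx
    rw [hx]; exact zero_mem _
  | succ i =>
    obtain ⟨hxj, hxd⟩ := hx
    let P := positiveIdeal 𝒜
    let r := positiveProj 𝒜
    have hr : ∀ p : P, r p = p := fun p => Subtype.ext (by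
      change (p : B) - GradedAlgebra.proj 𝒜 0 (p : B) = p
      rw [mem_positiveIdeal.1 p.2, sub_zero])
    obtain ⟨y, rfl⟩ := barComponent_le_range (i + 1) j hxj
    let e := tensorPowerSnoc k P
    have hcyc : IsBarCycle (T := fun i => ⨂[k]^i P) e i (e i y) := by
      cases i with
      | zero => trivial
      | succ i =>
        change coeffDiff (T := fun i => ⨂[k]^i P) e i P (e (i + 1) y) = 0
        rw [← towerDiff_succ (T := fun i => ⨂[k]^i P) e]
        have h1 : tensorPowerIncl P (i + 1)
            (towerDiff (T := fun i => ⨂[k]^i P) e (i + 1) y) = 0 := by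
          rw [← barDifferential_tensorPowerIncl]; exact hxd
        rw [(map_eq_zero_iff _ (tensorPowerIncl_injective P r hr (i + 1))).1 h1, map_zero]
    obtain ⟨z, g, hzg, hg⟩ := IsLinearModule.exists_eq_add_linear (N := P)
      (T := fun i => ⨂[k]^i P) e h h0' hr (fun p hp b => P.mul_mem_right b hp) (fun b => by
        obtain ⟨c, hc⟩ := h0' _ (gradedProj_mem (𝒜 := 𝒜) 0 b)
        refine ⟨c, ?_⟩
        rw [← hc]
        exact (sub_add_cancel b _).symm)
      (fun b hb => mem_positiveIdeal_of_mem hb one_ne_zero) i h.isLinearModule (e i y) hcyc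
    -- `y` is the sum of a boundary and an element of internal degree `i + 1 ≠ j`
    have hy : y = towerDiff (T := fun i => ⨂[k]^i P) e (i + 1) ((e (i + 1)).symm z) +
        (e i).symm g := by
      apply (e i).injective
      rw [map_add, towerDiff_succ (T := fun i => ⨂[k]^i P) e, LinearEquiv.apply_symm_apply,
        LinearEquiv.apply_symm_apply, hzg]
    have hg' : tensorPowerIncl P (i + 1) ((e i).symm g) ∈ barComponent 𝒜 (i + 1) (i + 1) := by
      refine tensorPowerIncl_linearTensors (i + 1) _ ?_
      clear hzg hy
      induction hg using Submodule.span_induction with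
      | zero => rw [map_zero]; exact zero_mem _
      | add x y _ _ hx hy => rw [map_add]; exact add_mem hx hy
      | smul c x _ hx => rw [map_smul]; exact Submodule.smul_mem _ _ hx
      | mem x hx =>
        obtain ⟨t, ht, _, ⟨p, rfl⟩, rfl⟩ := hx
        exact Submodule.subset_span ⟨t, ht, _, gradedProj_mem _ _, rfl⟩
    obtain ⟨f, hf, hfs⟩ := (Submodule.mem_iSup_iff_exists_finsupp _ _).1
      (tensorPowerIncl_mem (i + 2) ((e (i + 1)).symm z))
    refine ⟨f j, hf j, ?_⟩
    rw [eq_comm, ← sub_eq_zero]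
    refine eq_zero_of_mem_barComponent (sub_mem hxj (barDifferential_mem (hf j))) ?_
    have h1 : tensorPowerIncl P (i + 1) y = ∑ j' ∈ insert j f.support,
        barDifferential k B (i + 1) (f j') + tensorPowerIncl P (i + 1) ((e i).symm g) := by
      conv_lhs => rw [hy]
      rw [map_add, ← barDifferential_tensorPowerIncl, ← hfs, Finsupp.sum, map_sum]
      congr 1
      refine Finset.sum_subset (Finset.subset_insert _ _) fun j' _ hj' => ?_
      rw [Finsupp.notMem_support_iff.1 hj', map_zero]
    rw [h1, ← Finset.sum_erase_add _ _ (Finset.mem_insert_self j _), add_right_comm,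
      add_sub_cancel_right]
    refine add_mem (sum_mem fun j' hj' => ?_) ?_
    · exact Submodule.mem_iSup_of_mem j' (Submodule.mem_iSup_of_mem (Finset.ne_of_mem_erase hj')
        (barDifferential_mem (hf j')))
    · exact Submodule.mem_iSup_of_mem (i + 1) (Submodule.mem_iSup_of_mem hij hg')

end Criterion

/-! ### Koszul complexes of commuting operators -/

section KoszulOperators

/-- A module `M`, graded by submodules `M i r` (the index `i` is the level in the Cartan complex and
`r` the degree of a form), with anticommuting operators `w s` (multiplication by a generator) and
the dual contractions `c s`, and two commuting families of operators: derivations `D s` with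
quasi-inverses `G s`, and shifts `S s` with right inverses `J s`, which lower and raise the level.
The generators with `s ∈ L` are the logarithmic ones: for these `G s` commutes with `D s`, while
for the others `G s` is a right inverse of `D s`. -/
structure KoszulOperators (k M σ : Type*) [Field k] [AddCommGroup M] [Module k M]
    [DecidableEq σ] where
  gr : ℕ → ℕ → Submodule k M
  L : Finset σ
  w : σ → Module.End k M
  c : σ → Module.End k M
  D : σ → Module.End k M
  G : σ → Module.End k M
  S : σ → Module.End k M
  J : σ → Module.End k M
  w_mem : ∀ s i r x, x ∈ gr i r → w s x ∈ gr i (r + 1)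
  c_mem : ∀ s i r x, x ∈ gr i (r + 1) → c s x ∈ gr i r
  D_mem : ∀ s i r x, x ∈ gr i r → D s x ∈ gr i r
  G_mem : ∀ s i r x, x ∈ gr i r → G s x ∈ gr i r
  S_mem : ∀ s i r x, x ∈ gr (i + 1) r → S s x ∈ gr i r
  S_zero : ∀ s r x, x ∈ gr 0 r → S s x = 0
  J_mem : ∀ s i r x, x ∈ gr i r → J s x ∈ gr (i + 1) r
  eq_zero : ∀ i r x, x ∈ gr i (r + 1) → (∀ s, c s x = 0) → x = 0
  w_w : ∀ s x, w s (w s x) = 0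
  w_w' : ∀ s t x, w s (w t x) = - w t (w s x)
  c_c : ∀ s x, c s (c s x) = 0
  c_c' : ∀ s t x, c s (c t x) = - c t (c s x)
  c_w : ∀ s x, c s (w s x) = x - w s (c s x)
  c_w' : ∀ s t, s ≠ t → ∀ x, c s (w t x) = - w t (c s x)
  D_w : ∀ s t x, D s (w t x) = w t (D s x)
  D_c : ∀ s t x, D s (c t x) = c t (D s x)
  G_w : ∀ s t x, G s (w t x) = w t (G s x)
  G_c : ∀ s t x, G s (c t x) = c t (G s x)
  S_w : ∀ s t x, S s (w t x) = w t (S s x)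
  S_c : ∀ s t x, S s (c t x) = c t (S s x)
  J_w : ∀ s t x, J s (w t x) = w t (J s x)
  J_c : ∀ s t x, J s (c t x) = c t (J s x)
  S_D : ∀ s t x, S s (D t x) = D t (S s x)
  S_G : ∀ s t x, S s (G t x) = G t (S s x)
  J_D : ∀ s t x, J s (D t x) = D t (J s x)
  D_D : ∀ s t x, D s (D t x) = D t (D s x)
  D_G : ∀ s t, s ≠ t → ∀ x, D s (G t x) = G t (D s x)
  D_G_D : ∀ s x, D s (G s (D s x)) = D s x
  D_G_of_mem : ∀ s ∈ L, ∀ x, D s (G s x) = G s (D s x)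
  D_G_of_notMem : ∀ s, s ∉ L → ∀ x, D s (G s x) = x
  S_S : ∀ s t x, S s (S t x) = S t (S s x)
  S_J : ∀ s x, S s (J s x) = x
  S_J' : ∀ s t, s ≠ t → ∀ x, S s (J t x) = J t (S s x)

namespace KoszulOperators

variable {k M σ : Type*} [Field k] [AddCommGroup M] [Module k M] [DecidableEq σ]
  (K : KoszulOperators k M σ)

/-- The Cartan differential `∑_{s ∈ R} w s ∘ S s`, in the variables from a set `R`. -/
def cartan (R : Finset σ) : Module.End k M := ∑ s ∈ R, K.w s * K.S s

theorem cartan_apply (R : Finset σ) (x : M) : K.cartan R x = ∑ s ∈ R, K.w s (K.S s x) := by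
  simp [cartan]

/-- The de Rham differential `∑ₛ w s ∘ D s`. -/
def diff [Fintype σ] : Module.End k M := ∑ s, K.w s * K.D s

theorem diff_apply [Fintype σ] (x : M) : K.diff x = ∑ s, K.w s (K.D s x) := by
  simp [diff]

theorem cartan_mem (R : Finset σ) {i r : ℕ} {x : M} (hx : x ∈ K.gr (i + 1) r) :
    K.cartan R x ∈ K.gr i (r + 1) := by
  rw [cartan_apply]
  exact sum_mem fun s _ => K.w_mem _ _ _ _ (K.S_mem _ _ _ _ hx)

theorem cartan_eq_zero (R : Finset σ) {r : ℕ} {x : M} (hx : x ∈ K.gr 0 r) :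
    K.cartan R x = 0 := by
  rw [cartan_apply]
  exact Finset.sum_eq_zero fun s _ => by rw [K.S_zero _ _ _ hx, map_zero]

theorem diff_mem [Fintype σ] {i r : ℕ} {x : M} (hx : x ∈ K.gr i r) : K.diff x ∈ K.gr i (r + 1) := by
  rw [diff_apply]
  exact sum_mem fun s _ => K.w_mem _ _ _ _ (K.D_mem _ _ _ _ hx)

theorem diff_diff [Fintype σ] (x : M) : K.diff (K.diff x) = 0 := by
  simp only [diff_apply, map_sum, K.D_w]
  refine sum_sum_eq_zero_of_antisymm _ (fun s t => ?_) fun s => K.w_w _ _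
  rw [K.w_w' s t, K.D_D, add_neg_cancel]

theorem cartan_cartan [Fintype σ] (x : M) :
    K.cartan Finset.univ (K.cartan Finset.univ x) = 0 := by
  simp only [cartan_apply, map_sum, K.S_w]
  refine sum_sum_eq_zero_of_antisymm _ (fun s t => ?_) fun s => K.w_w _ _
  rw [K.w_w' s t, K.S_S, add_neg_cancel]

theorem diff_cartan [Fintype σ] (x : M) :
    K.diff (K.cartan Finset.univ x) = - K.cartan Finset.univ (K.diff x) := by
  simp only [cartan_apply, diff_apply, map_sum, K.S_w, K.D_w]
  rw [Finset.sum_comm, ← Finset.sum_neg_distrib]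
  refine Finset.sum_congr rfl fun s _ => ?_
  rw [← Finset.sum_neg_distrib]
  refine Finset.sum_congr rfl fun t _ => ?_
  rw [K.w_w', K.S_D]

/-- The homotopy formula for `J s ∘ c s` with respect to the Cartan differential. -/
theorem cartan_homotopy {R : Finset σ} {s : σ} (hs : s ∈ R) (x : M) :
    K.cartan R (K.J s (K.c s x)) + K.J s (K.c s (K.cartan R x)) =
      x - (K.c s (K.w s x) - K.J s (K.S s (K.c s (K.w s x)))) := by
  simp only [cartan_apply, map_sum, ← Finset.sum_add_distrib]
  rw [Finset.sum_eq_single_of_mem s hs]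
  · simp only [K.S_J, K.c_w, map_sub, K.J_w, K.S_w, K.S_c]
    abel
  · intro t _ ht
    rw [K.S_J' t s ht, K.c_w' s t ht.symm, map_neg, K.J_w, K.S_c, add_neg_cancel]

/-- Exactness of the Cartan complex in the variables from `R`, for forms that contain only the
corresponding generators and satisfy `D s x = 0` for `s` in a further set `R'`. -/
theorem exists_cartan_eq {R R' : Finset σ} {i r : ℕ} {x : M}
    (hx : x ∈ K.gr i (r + 1)) (hR : ∀ s, s ∉ R → K.c s x = 0) (hR' : ∀ s ∈ R', K.D s x = 0)
    (hd : K.cartan R x = 0) :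
    ∃ y ∈ K.gr (i + 1) r, K.cartan R y = x ∧ (∀ s, s ∉ R → K.c s y = 0) ∧
      ∀ s ∈ R', K.D s y = 0 := by
  -- remove the generators from `R` one after another
  suffices h : ∀ T ⊆ R, ∃ y ∈ K.gr (i + 1) r, ∃ z ∈ K.gr i (r + 1), x = K.cartan R y + z ∧
      (∀ s, s ∉ R → K.c s y = 0) ∧ (∀ s ∈ R', K.D s y = 0) ∧ (∀ s, s ∉ R → K.c s z = 0) ∧
      (∀ s ∈ R', K.D s z = 0) ∧ (∀ s ∈ T, K.c s z = 0) ∧ K.cartan R z = 0 by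
    obtain ⟨y, hy, z, hz, hxy, h1, h2, h3, _, h4, _⟩ := h R subset_rfl
    have : z = 0 := K.eq_zero i r z hz fun s => by
      by_cases hs : s ∈ R
      exacts [h4 s hs, h3 s hs]
    exact ⟨y, hy, by rw [hxy, this, add_zero], h1, h2⟩
  intro T hT
  induction T using Finset.induction_on with
  | empty => exact ⟨0, zero_mem _, x, hx, by simp, by simp, by simp, hR, hR', by simp, hd⟩
  | insert t T ht ih =>
    obtain ⟨y, hy, z, hz, hxy, h1, h2, h3, h4, h5, h6⟩ :=
      ih (fun s hs => hT (Finset.mem_insert_of_mem hs))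
    have htR : t ∈ R := hT (Finset.mem_insert_self t T)
    have hh := K.cartan_homotopy htR z
    rw [h6, map_zero, map_zero, add_zero] at hh
    have hJ : K.J t (K.c t z) ∈ K.gr (i + 1) r := K.J_mem _ _ _ _ (K.c_mem _ _ _ _ hz)
    have hz' : z - K.cartan R (K.J t (K.c t z)) =
        K.c t (K.w t z) - K.J t (K.S t (K.c t (K.w t z))) := by
      rw [hh]; abel
    have hcq : ∀ s, s ≠ t → K.c s z = 0 → K.c s (z - K.cartan R (K.J t (K.c t z))) = 0 := by
      intro s hs h
      rw [hz', map_sub, ← K.J_c, ← K.S_c, K.c_c' s t, K.c_w' s t hs, h]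
      simp
    have hDJ : ∀ s, K.D s z = 0 → K.D s (K.J t (K.c t z)) = 0 := fun s h => by
      rw [← K.J_D, K.D_c, h, map_zero, map_zero]
    refine ⟨y + K.J t (K.c t z), add_mem hy hJ, z - K.cartan R (K.J t (K.c t z)),
      sub_mem hz (K.cartan_mem R hJ), ?_, ?_, ?_, ?_, ?_, ?_, ?_⟩
    · rw [map_add, hxy]; abel
    · intro s hs
      rw [map_add, h1 s hs, ← K.J_c, K.c_c', h3 s hs]
      simp
    · intro s hs
      rw [map_add, h2 s hs, hDJ s (h4 s hs), add_zero]
    · intro s hs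
      exact hcq s (by rintro rfl; exact hs htR) (h3 s hs)
    · intro s hs
      rw [hz', map_sub, K.D_c, K.D_w, h4 s hs, ← K.J_D, ← K.S_D, K.D_c, K.D_w, h4 s hs]
      simp
    · intro s hs
      by_cases hst : s = t
      · subst hst
        rw [hz', map_sub, ← K.J_c, ← K.S_c, K.c_c]
        simp
      · exact hcq s hst (h5 s ((Finset.mem_insert.1 hs).resolve_left hst))
    · have hq : ∀ s ∈ R, ∀ q : M, s ≠ t → K.w s (K.S s (K.c t (K.w t q) -
          K.J t (K.S t (K.c t (K.w t q))))) = K.c t (K.w t (K.w s (K.S s q))) -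
          K.J t (K.S t (K.c t (K.w t (K.w s (K.S s q))))) := by
        intro s _ q hs
        rw [map_sub, map_sub, K.S_J' s t hs, K.S_S s t, ← K.J_w,
          ← K.S_w t s (K.S s _)]
        have : K.w s (K.S s (K.c t (K.w t q))) = K.c t (K.w t (K.w s (K.S s q))) := by
          rw [K.S_c, K.S_w, K.w_w' t s, map_neg, K.c_w' t s hs.symm, neg_neg]
        rw [this]
      have hsum : K.cartan R (z - K.cartan R (K.J t (K.c t z))) =
          K.c t (K.w t (K.cartan R z)) - K.J t (K.S t (K.c t (K.w t (K.cartan R z)))) := by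
        rw [hz']
        simp only [cartan_apply, map_sum, ← Finset.sum_sub_distrib]
        refine Finset.sum_congr rfl fun s hs => ?_
        by_cases hst : s = t
        · subst hst
          rw [map_sub, K.S_J, sub_self, map_zero, K.w_w]
          simp
        · exact hq s hs z hst
      rw [hsum, h6]; simp

section Cohomology

variable [Fintype σ]

/-- The homotopy formula for `G s ∘ c s` with respect to the de Rham differential. -/
theorem diff_homotopy (s : σ) (x : M) :
    K.diff (K.G s (K.c s x)) + K.G s (K.c s (K.diff x)) =
      K.D s (K.G s (K.w s (K.c s x))) + K.G s (K.D s (K.c s (K.w s x))) := by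
  simp only [diff_apply, map_sum, ← Finset.sum_add_distrib]
  rw [Finset.sum_eq_single_of_mem s (Finset.mem_univ s)]
  · rw [K.G_w, K.D_w, K.D_c, K.D_w]
  · intro t _ ht
    rw [K.D_G t s ht, K.c_w' s t ht.symm, map_neg, K.G_w, K.D_c, add_neg_cancel]

/-- The harmonic projection in the variable `s`, which is homotopic to the identity. -/
def harmonic (s : σ) : Module.End k M :=
  1 - (K.D s * K.G s * K.w s * K.c s + K.G s * K.D s * K.c s * K.w s)

omit [Fintype σ] in
theorem harmonic_apply (s : σ) (x : M) : K.harmonic s x =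
    x - (K.D s (K.G s (K.w s (K.c s x))) + K.G s (K.D s (K.c s (K.w s x)))) := by
  simp [harmonic]

omit [Fintype σ] in
theorem harmonic_of_mem {s : σ} (hs : s ∈ K.L) (x : M) :
    K.harmonic s x = x - G K s (K.D s x) := by
  rw [harmonic_apply, K.D_G_of_mem s hs, K.c_w, ← map_add, ← map_add]
  congr 3; abel

omit [Fintype σ] in
theorem harmonic_of_notMem {s : σ} (hs : s ∉ K.L) (x : M) :
    K.harmonic s x = K.c s (K.w s x) - K.G s (K.D s (K.c s (K.w s x))) := by
  rw [harmonic_apply, K.D_G_of_notMem s hs, K.c_w]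
  abel

/-- The class of a closed form is represented by a harmonic form, killed by all `D s` and containing
only logarithmic generators. -/
theorem exists_harmonic {i r : ℕ} {x : M} (hx : x ∈ K.gr i (r + 1)) (hd : K.diff x = 0)
    (hx' : K.cartan Finset.univ x = 0) :
    ∃ y ∈ K.gr i r, ∃ z ∈ K.gr i (r + 1), x = K.diff y + z ∧ (∀ s, K.D s z = 0) ∧
      (∀ s, s ∉ K.L → K.c s z = 0) ∧ K.cartan K.L z = 0 := by
  suffices h : ∀ T : Finset σ, ∃ y ∈ K.gr i r, ∃ z ∈ K.gr i (r + 1), x = K.diff y + z ∧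
      K.diff z = 0 ∧ (∀ s ∈ T, K.D s z = 0) ∧ (∀ s ∈ T, s ∉ K.L → K.c s z = 0) ∧
      K.cartan (Finset.univ.filter fun s => s ∈ K.L ∨ s ∉ T) z = 0 by
    obtain ⟨y, hy, z, hz, h1, _, h2, h3, h4⟩ := h Finset.univ
    refine ⟨y, hy, z, hz, h1, fun s => h2 s (Finset.mem_univ s),
      fun s => h3 s (Finset.mem_univ s), ?_⟩
    convert h4
    ext s; simp
  intro T
  induction T using Finset.induction_on with
  | empty => exact ⟨0, zero_mem _, x, hx, by simp, hd, by simp, by simp, by simpa using hx'⟩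
  | insert t T ht ih =>
    obtain ⟨y, hy, z, hz, h1, h2, h3, h4, h5⟩ := ih
    have hh := K.diff_homotopy t z
    rw [h2, map_zero, map_zero, add_zero] at hh
    have hG : K.G t (K.c t z) ∈ K.gr i r := K.G_mem _ _ _ _ (K.c_mem _ _ _ _ hz)
    have hz' : K.harmonic t z = z - K.diff (K.G t (K.c t z)) := by
      rw [hh, harmonic_apply]
    have hDt : K.D t (K.harmonic t z) = 0 := by
      by_cases htL : t ∈ K.L
      · rw [K.harmonic_of_mem htL, map_sub, K.D_G_D, sub_self]
      · rw [K.harmonic_of_notMem htL, map_sub, K.D_G_D, sub_self]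
    have hDs : ∀ s, s ≠ t → K.D s z = 0 → K.D s (K.harmonic t z) = 0 := by
      intro s hs h
      rw [harmonic_apply]
      simp only [map_sub, map_add]
      rw [K.D_D s t, K.D_G s t hs, K.D_G s t hs, K.D_D s t, K.D_w, K.D_c, K.D_c, K.D_w, h]
      simp
    have hcs : ∀ s, s ≠ t → K.c s z = 0 → K.c s (K.harmonic t z) = 0 := by
      intro s hs h
      have hw : K.c s (K.w t (K.c t z)) = 0 := by rw [K.c_w' s t hs, K.c_c', h]; simp
      have hc : K.c s (K.c t (K.w t z)) = 0 := by rw [K.c_c' s t, K.c_w' s t hs, h]; simp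
      rw [harmonic_apply]
      simp only [map_sub, map_add]
      rw [← K.D_c, ← K.G_c, ← K.G_c, ← K.D_c, hw, hc, h]
      simp
    refine ⟨y + K.G t (K.c t z), add_mem hy hG, K.harmonic t z, ?_, ?_, ?_, ?_, ?_, ?_⟩
    · rw [hz']; exact sub_mem hz (K.diff_mem hG)
    · rw [hz', map_add, h1]; abel
    · rw [hz', map_sub, h2, K.diff_diff, sub_zero]
    · intro s hs
      by_cases hst : s = t
      · subst hst; exact hDt
      · exact hDs s hst (h3 s ((Finset.mem_insert.1 hs).resolve_left hst))
    · intro s hs hsL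
      by_cases hst : s = t
      · subst hst
        rw [K.harmonic_of_notMem hsL, map_sub, ← K.G_c, ← K.D_c, K.c_c]
        simp
      · exact hcs s hst (h4 s ((Finset.mem_insert.1 hs).resolve_left hst) hsL)
    · by_cases htL : t ∈ K.L
      · have hset : (Finset.univ.filter fun s => s ∈ K.L ∨ s ∉ insert t T) =
            Finset.univ.filter fun s => s ∈ K.L ∨ s ∉ T := by
          ext s
          by_cases hst : s = t
          · subst hst; simp [htL]
          · simp [hst]
        have hcomm : ∀ R : Finset σ, K.cartan R (K.harmonic t z) =
            K.harmonic t (K.cartan R z) := by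
          intro R
          simp only [K.harmonic_of_mem htL, cartan_apply, map_sub, map_sum, K.S_G, K.S_D, K.D_w,
            K.G_w]
        rw [hset, hcomm, h5, map_zero]
      · -- the projection kills the generator `t`, and it commutes with the others
        have hset : (Finset.univ.filter fun s => s ∈ K.L ∨ s ∉ T) =
            insert t (Finset.univ.filter fun s => s ∈ K.L ∨ s ∉ insert t T) := by
          ext s
          by_cases hst : s = t
          · subst hst; simp [ht]
          · simp [hst]
        have hcomm : ∀ s, s ≠ t → ∀ q, K.w s (K.S s (K.harmonic t q)) =
            K.harmonic t (K.w s (K.S s q)) := by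
          intro s hs q
          have hcw : K.w s (K.S s (K.c t (K.w t q))) = K.c t (K.w t (K.w s (K.S s q))) := by
            rw [K.S_c, K.S_w, K.w_w' t s, map_neg, K.c_w' t s hs.symm, neg_neg]
          rw [K.harmonic_of_notMem htL, K.harmonic_of_notMem htL, map_sub, map_sub, K.S_G, K.S_D,
            ← K.G_w, ← K.D_w, hcw]
        rw [hset, cartan_apply, Finset.sum_insert (by simp [htL])] at h5
        have h6 := congrArg (K.harmonic t) h5
        rw [map_add, K.harmonic_of_notMem htL (K.w t _), K.w_w, map_zero, map_sum, map_zero] at h6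
        rw [map_zero, map_zero, sub_zero, zero_add] at h6
        rw [cartan_apply, ← h6]
        refine Finset.sum_congr rfl fun s hs => hcomm s ?_ z
        rintro rfl
        simp [htL] at hs

/-- The cohomology of the de Rham differential has regularity zero: a closed form which is a Cartan
cycle is, up to an exact form, the Cartan boundary of a closed form. -/
theorem exists_closed_cartan_add_diff {i r : ℕ} {x : M} (hx : x ∈ K.gr i (r + 1))
    (hd : K.diff x = 0) (hx' : K.cartan Finset.univ x = 0) :
    ∃ h ∈ K.gr (i + 1) r, ∃ b ∈ K.gr i r, K.diff h = 0 ∧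
      x = K.cartan Finset.univ h + K.diff b := by
  obtain ⟨y, hy, z, hz, hxy, hD, hc, hcz⟩ := K.exists_harmonic hx hd hx'
  obtain ⟨h, hh, hhz, _, hDh⟩ := K.exists_cartan_eq (R := K.L) (R' := Finset.univ) hz hc
    (fun s _ => hD s) hcz
  have hDh' : ∀ s, K.D s h = 0 := fun s => hDh s (Finset.mem_univ s)
  -- the terms of the Cartan differential with nonlogarithmic generators are exact
  have hex : ∀ s, s ∉ K.L → ∀ q, (∀ t, K.D t q = 0) → K.diff (K.G s q) = K.w s q := by
    intro s hs q hq
    rw [diff_apply, Finset.sum_eq_single_of_mem s (Finset.mem_univ s)]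
    · rw [K.D_G_of_notMem s hs]
    · intro t _ ht
      rw [K.D_G t s ht, hq, map_zero, map_zero]
  have hsum : K.cartan Finset.univ h = z + K.diff (∑ s ∈ Finset.univ \ K.L, K.G s (K.S s h)) := by
    rw [map_sum, Finset.sum_congr rfl fun s hs => hex s (Finset.mem_sdiff.1 hs).2 (K.S s h)
      fun t => by rw [← K.S_D, hDh', map_zero], ← hhz, cartan_apply, cartan_apply, add_comm]
    exact (Finset.sum_sdiff (Finset.subset_univ K.L)).symm
  refine ⟨h, hh, y - ∑ s ∈ Finset.univ \ K.L, K.G s (K.S s h),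
    sub_mem hy (sum_mem fun s _ => K.G_mem _ _ _ _ (K.S_mem _ _ _ _ hh)), ?_, ?_⟩
  · rw [diff_apply]
    exact Finset.sum_eq_zero fun s _ => by rw [hDh', map_zero]
  · rw [hsum, map_sub, hxy]; abel

/-- Closed forms have regularity at most one: a closed form of degree at least two which is a Cartan
cycle is the Cartan boundary of a closed form. -/
theorem exists_closed_cartan_eq (i : ℕ) : ∀ {r : ℕ} {x : M}, x ∈ K.gr i (r + 2) → K.diff x = 0 →
    K.cartan Finset.univ x = 0 →
    ∃ y ∈ K.gr (i + 1) (r + 1), K.diff y = 0 ∧ K.cartan Finset.univ y = x := by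
  induction i with
  | zero =>
    intro r x hx hd hx'
    obtain ⟨h, hh, b, hb, hdh, hxb⟩ := K.exists_closed_cartan_add_diff hx hd hx'
    obtain ⟨e, he, heb, _⟩ := K.exists_cartan_eq (R := Finset.univ) (R' := ∅) hb (by simp)
      (by simp) (K.cartan_eq_zero _ hb)
    refine ⟨h - K.diff e, sub_mem hh (K.diff_mem he), by rw [map_sub, hdh, K.diff_diff, sub_zero],
      ?_⟩
    rw [map_sub, hxb, ← heb, K.diff_cartan]; abel
  | succ i ih =>
    intro r x hx hd hx'
    obtain ⟨h, hh, b, hb, hdh, hxb⟩ := K.exists_closed_cartan_add_diff hx hd hx'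
    -- `∂ b` is closed, so by induction it equals `∂ g` with `g` closed
    obtain ⟨g, hg, hdg, hgb⟩ := ih (K.cartan_mem Finset.univ hb) (by
      have h1 : K.diff b = x - K.cartan Finset.univ h := by rw [hxb]; abel
      rw [K.diff_cartan, h1, map_sub, hx', K.cartan_cartan, sub_zero, neg_zero])
      (K.cartan_cartan b)
    obtain ⟨e, he, heb, _⟩ := K.exists_cartan_eq (R := Finset.univ) (R' := ∅) (sub_mem hb hg)
      (by simp) (by simp) (by rw [map_sub, hgb, sub_self])
    refine ⟨h - K.diff e, sub_mem hh (K.diff_mem he), by rw [map_sub, hdh, K.diff_diff, sub_zero],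
      ?_⟩
    have h2 : K.diff b = K.diff (K.cartan Finset.univ e) := by
      rw [heb, map_sub, hdg, sub_zero]
    rw [map_sub, hxb, h2, K.diff_cartan]; abel

end Cohomology

end KoszulOperators

end KoszulOperators

/-! ### The Koszul operators on logarithmic forms -/

section FormOperators

variable {k O : Type*} [Field k] [CommRing O] [Algebra k O] {u : ℕ}

section Exterior

/-- The contraction of the exterior algebra with the `s`-th coordinate function. -/
noncomputable def contraction (k : Type*) [Field k] {u : ℕ} (s : Fin u) :
    ExteriorAlgebra k (Fin u → k) →ₗ[k] ExteriorAlgebra k (Fin u → k) :=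
  CliffordAlgebra.contractLeft (LinearMap.proj s)

theorem contraction_ι_mul (s : Fin u) (m : Fin u → k) (a : ExteriorAlgebra k (Fin u → k)) :
    contraction k s (ExteriorAlgebra.ι k m * a) =
      m s • a - ExteriorAlgebra.ι k m * contraction k s a :=
  CliffordAlgebra.contractLeft_ι_mul _ _ _

theorem contraction_mem (s : Fin u) (n : ℕ) (a : ExteriorAlgebra k (Fin u → k))
    (ha : a ∈ ⋀[k]^(n + 1) (Fin u → k)) : contraction k s a ∈ ⋀[k]^n (Fin u → k) := by
  induction n generalizing a with
  | zero =>
    change a ∈ LinearMap.range (ExteriorAlgebra.ι k) ^ (0 + 1) at ha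
    rw [zero_add, pow_one] at ha
    obtain ⟨m, rfl⟩ := ha
    have h1 := contraction_ι_mul s m 1
    have h2 : contraction k s (1 : ExteriorAlgebra k (Fin u → k)) = 0 :=
      CliffordAlgebra.contractLeft_one _ _
    rw [mul_one, h2, mul_zero, sub_zero] at h1
    rw [h1]
    exact Submodule.smul_mem _ _ (SetLike.GradedOne.one_mem (A := fun n => ⋀[k]^n (Fin u → k)))
  | succ n ih =>
    change a ∈ LinearMap.range (ExteriorAlgebra.ι k) ^ (n + 1 + 1) at ha
    rw [pow_succ'] at ha
    induction ha using Submodule.mul_induction_on' with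
    | mem_mul_mem x hx y hy =>
      obtain ⟨m, rfl⟩ := hx
      rw [contraction_ι_mul]
      refine sub_mem (Submodule.smul_mem _ _ hy) ?_
      have := ih y hy
      change _ ∈ LinearMap.range (ExteriorAlgebra.ι k) ^ (n + 1)
      rw [pow_succ']
      exact Submodule.mul_mem_mul ⟨m, rfl⟩ this
    | add x _ y _ hx hy => rw [map_add]; exact add_mem hx hy

theorem logGenerator_mem (s : Fin u) : logGenerator k s ∈ ⋀[k]^1 (Fin u → k) := by
  change _ ∈ LinearMap.range (ExteriorAlgebra.ι k) ^ 1
  rw [pow_one]; exact ⟨_, rfl⟩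

theorem logGenerator_mul_mem (s : Fin u) (n : ℕ) (a : ExteriorAlgebra k (Fin u → k))
    (ha : a ∈ ⋀[k]^n (Fin u → k)) : logGenerator k s * a ∈ ⋀[k]^(n + 1) (Fin u → k) := by
  rw [add_comm]
  exact SetLike.mul_mem_graded (A := fun n => ⋀[k]^n (Fin u → k)) (logGenerator_mem s) ha

/-- An element of positive degree of the exterior algebra is a combination of generators. -/
theorem exists_eq_sum_logGenerator_mul (n : ℕ) (a : ExteriorAlgebra k (Fin u → k))
    (ha : a ∈ ⋀[k]^(n + 1) (Fin u → k)) :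
    ∃ y : Fin u → ExteriorAlgebra k (Fin u → k), a = ∑ s, logGenerator k s * y s := by
  change a ∈ LinearMap.range (ExteriorAlgebra.ι k) ^ (n + 1) at ha
  rw [pow_succ'] at ha
  induction ha using Submodule.mul_induction_on' with
  | mem_mul_mem x hx y _ =>
    obtain ⟨m, rfl⟩ := hx
    refine ⟨fun s => m s • y, ?_⟩
    conv_lhs => rw [← Finset.univ_sum_single m, map_sum, Finset.sum_mul]
    refine Finset.sum_congr rfl fun s _ => ?_
    have : (Pi.single s (m s) : Fin u → k) = m s • Pi.single s 1 := by
      rw [← Pi.single_smul, smul_eq_mul, mul_one]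
    rw [this, map_smul, smul_mul_assoc, mul_smul_comm]
  | add x _ y _ hx hy =>
    obtain ⟨x', rfl⟩ := hx
    obtain ⟨y', rfl⟩ := hy
    exact ⟨fun s => x' s + y' s, by simp only [mul_add, Finset.sum_add_distrib]⟩

end Exterior

section Forms

theorem logForms_induction {n : ℕ} {C : LogForms k O u → Prop}
    (h : ∀ (f : O) (a : ExteriorAlgebra k (Fin u → k)), a ∈ ⋀[k]^n (Fin u → k) → C (f ⊗ₜ a))
    (h0 : C 0) (ha : ∀ x y, C x → C y → C (x + y)) {x : LogForms k O u}
    (hx : x ∈ logFormsGrading k O u n) : C x := by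
  obtain ⟨x, rfl⟩ := Submodule.toBaseChange_surjective' _ _ hx
  clear hx
  induction x using TensorProduct.induction_on with
  | zero => simpa using h0
  | add x y ihx ihy => rw [map_add, Submodule.coe_add]; exact ha _ _ ihx ihy
  | tmul f a => rw [Submodule.coe_toBaseChange_tmul]; exact h f a a.2

theorem lTensor_mem_logForms {m n : ℕ}
    (φ : ExteriorAlgebra k (Fin u → k) →ₗ[k] ExteriorAlgebra k (Fin u → k))
    (hφ : ∀ a ∈ ⋀[k]^m (Fin u → k), φ a ∈ ⋀[k]^n (Fin u → k)) {x : LogForms k O u}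
    (hx : x ∈ logFormsGrading k O u m) : φ.lTensor O x ∈ logFormsGrading k O u n := by
  refine logForms_induction (C := fun x => φ.lTensor O x ∈ logFormsGrading k O u n)
    (fun f a ha => ?_) (by simp) (fun x y hx hy => by rw [map_add]; exact add_mem hx hy) hx
  rw [LinearMap.lTensor_tmul]
  exact Submodule.tmul_mem_baseChange_of_mem _ (hφ a ha)

theorem rTensor_mem_logForms {m : ℕ} (φ : O →ₗ[k] O) {x : LogForms k O u}
    (hx : x ∈ logFormsGrading k O u m) :
    φ.rTensor (ExteriorAlgebra k (Fin u → k)) x ∈ logFormsGrading k O u m := by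
  refine logForms_induction (C := fun x => φ.rTensor (ExteriorAlgebra k (Fin u → k)) x ∈
    logFormsGrading k O u m)
    (fun f a ha => ?_) (by simp) (fun x y hx hy => by rw [map_add]; exact add_mem hx hy) hx
  rw [LinearMap.rTensor_tmul]
  exact Submodule.tmul_mem_baseChange_of_mem _ ha

variable (k O) in
/-- Left multiplication of forms by the generator `ωₛ`. -/
noncomputable def mulGenerator (s : Fin u) : LogForms k O u →ₗ[k] LogForms k O u :=
  (LinearMap.mulLeft k (logGenerator k s)).lTensor O

variable (k O) in
/-- Contraction of forms with the vector field dual to `ωₛ`. -/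
noncomputable def contractForm (s : Fin u) : LogForms k O u →ₗ[k] LogForms k O u :=
  (contraction k s).lTensor O

/-- The action of an endomorphism of `O` on the coefficients of forms. -/
noncomputable def coeffMap (φ : O →ₗ[k] O) : LogForms k O u →ₗ[k] LogForms k O u :=
  φ.rTensor (ExteriorAlgebra k (Fin u → k))

theorem mulGenerator_mulGenerator (s : Fin u) (x : LogForms k O u) :
    mulGenerator k O s (mulGenerator k O s x) = 0 := by
  induction x using TensorProduct.induction_on with
  | zero => simp
  | add x y hx hy => simp only [map_add, hx, hy, add_zero]
  | tmul f a =>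
    simp only [mulGenerator, LinearMap.lTensor_tmul, LinearMap.mulLeft_apply, ← mul_assoc]
    rw [ExteriorAlgebra.ι_sq_zero, zero_mul, TensorProduct.tmul_zero]

theorem mulGenerator_comm (s t : Fin u) (x : LogForms k O u) :
    mulGenerator k O s (mulGenerator k O t x) = - mulGenerator k O t (mulGenerator k O s x) := by
  induction x using TensorProduct.induction_on with
  | zero => simp
  | add x y hx hy => simp only [map_add, hx, hy, neg_add]
  | tmul f a =>
    simp only [mulGenerator, LinearMap.lTensor_tmul, LinearMap.mulLeft_apply, ← mul_assoc]
    rw [← TensorProduct.tmul_neg, ← neg_mul]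
    congr 2
    exact eq_neg_of_add_eq_zero_left (ExteriorAlgebra.ι_add_mul_swap _ _)

theorem contractForm_contractForm (s : Fin u) (x : LogForms k O u) :
    contractForm k O s (contractForm k O s x) = 0 := by
  induction x using TensorProduct.induction_on with
  | zero => simp
  | add x y hx hy => simp only [map_add, hx, hy, add_zero]
  | tmul f a =>
    simp only [contractForm, LinearMap.lTensor_tmul]
    rw [contraction, CliffordAlgebra.contractLeft_contractLeft, TensorProduct.tmul_zero]

theorem contractForm_comm (s t : Fin u) (x : LogForms k O u) :
    contractForm k O s (contractForm k O t x) = - contractForm k O t (contractForm k O s x) := by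
  induction x using TensorProduct.induction_on with
  | zero => simp
  | add x y hx hy => simp only [map_add, hx, hy, neg_add]
  | tmul f a =>
    simp only [contractForm, LinearMap.lTensor_tmul]
    rw [contraction, contraction, CliffordAlgebra.contractLeft_comm, TensorProduct.tmul_neg]

theorem contractForm_mulGenerator (s t : Fin u) (x : LogForms k O u) :
    contractForm k O s (mulGenerator k O t x) =
      (if s = t then x else 0) - mulGenerator k O t (contractForm k O s x) := by
  induction x using TensorProduct.induction_on with
  | zero => simp
  | add x y hx hy =>
    simp only [map_add, hx, hy]
    split_ifs <;> abel
  | tmul f a =>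
    simp only [contractForm, mulGenerator, LinearMap.lTensor_tmul, LinearMap.mulLeft_apply]
    rw [contraction_ι_mul, TensorProduct.tmul_sub]
    by_cases h : s = t
    · subst h; simp
    · rw [Pi.single_eq_of_ne h, if_neg h, zero_smul, TensorProduct.tmul_zero]

theorem coeffMap_mulGenerator (φ : O →ₗ[k] O) (s : Fin u) (x : LogForms k O u) :
    coeffMap φ (mulGenerator k O s x) = mulGenerator k O s (coeffMap φ x) := by
  induction x using TensorProduct.induction_on with
  | zero => simp
  | add x y hx hy => simp only [map_add, hx, hy]
  | tmul f a => simp [coeffMap, mulGenerator]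

theorem coeffMap_contractForm (φ : O →ₗ[k] O) (s : Fin u) (x : LogForms k O u) :
    coeffMap φ (contractForm k O s x) = contractForm k O s (coeffMap φ x) := by
  induction x using TensorProduct.induction_on with
  | zero => simp
  | add x y hx hy => simp only [map_add, hx, hy]
  | tmul f a => simp [coeffMap, contractForm]

theorem coeffMap_coeffMap (φ ψ : O →ₗ[k] O) (x : LogForms k O u) :
    coeffMap φ (coeffMap ψ x) = coeffMap (φ ∘ₗ ψ) x := by
  simp only [coeffMap, LinearMap.rTensor_comp, LinearMap.comp_apply]

theorem coeffMap_id (x : LogForms k O u) : coeffMap LinearMap.id x = x := by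
  simp [coeffMap]

theorem exists_eq_sum_mulGenerator {n : ℕ} {x : LogForms k O u}
    (hx : x ∈ logFormsGrading k O u (n + 1)) :
    ∃ y : Fin u → LogForms k O u, x = ∑ s, mulGenerator k O s (y s) := by
  refine logForms_induction (C := fun x => ∃ y : Fin u → LogForms k O u,
    x = ∑ s, mulGenerator k O s (y s)) (fun f a ha => ?_) ⟨0, by simp⟩ ?_ hx
  · obtain ⟨y, rfl⟩ := exists_eq_sum_logGenerator_mul n a ha
    exact ⟨fun s => f ⊗ₜ y s, by simp [mulGenerator, TensorProduct.tmul_sum]⟩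
  · rintro _ _ ⟨x', rfl⟩ ⟨y', rfl⟩
    exact ⟨fun s => x' s + y' s, by simp only [map_add, Finset.sum_add_distrib]⟩

/-- A form of positive degree all of whose contractions vanish is zero. -/
theorem eq_zero_of_contractForm {n : ℕ} {x : LogForms k O u}
    (hx : x ∈ logFormsGrading k O u (n + 1)) (h : ∀ s, contractForm k O s x = 0) : x = 0 := by
  -- remove the generators from an expression of `x` one after another
  suffices hs : ∀ T : Finset (Fin u), ∃ y : Fin u → LogForms k O u,
      x = ∑ s ∈ Finset.univ \ T, mulGenerator k O s (y s) by
    obtain ⟨y, hy⟩ := hs Finset.univ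
    simpa using hy
  intro T
  induction T using Finset.induction_on with
  | empty => simpa using exists_eq_sum_mulGenerator hx
  | insert t T ht ih =>
    obtain ⟨y, hy⟩ := ih
    refine ⟨fun s => contractForm k O t (mulGenerator k O t (y s)), ?_⟩
    have h1 : x = contractForm k O t (mulGenerator k O t x) := by
      rw [contractForm_mulGenerator, if_pos rfl, h, map_zero, sub_zero]
    conv_lhs => rw [h1, hy]
    have hset : Finset.univ \ T = insert t (Finset.univ \ insert t T) := by
      ext s
      by_cases hst : s = t
      · subst hst; simp [ht]
      · simp [hst]
    rw [hset, Finset.sum_insert (by simp), map_add, map_add, mulGenerator_mulGenerator, map_zero,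
      zero_add, map_sum, map_sum]
    refine Finset.sum_congr rfl fun s hs => ?_
    have hst : t ≠ s := by
      rintro rfl
      simp at hs
    rw [mulGenerator_comm, map_neg, contractForm_mulGenerator t s, if_neg hst, zero_sub, neg_neg]

theorem deRham_apply (z : Fin u → O) (D : Fin u → Derivation k O O) (v : ℕ)
    (x : LogForms k O u) :
    deRham z D v x = ∑ s, mulGenerator k O s (coeffMap (logDerivation z D v s : O →ₗ[k] O) x) := by
  induction x using TensorProduct.induction_on with
  | zero => simp
  | add x y hx hy => simp only [map_add, hx, hy, Finset.sum_add_distrib]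
  | tmul f a =>
    rw [deRham_tmul]
    simp [mulGenerator, coeffMap]

theorem one_tmul_mul (s : Fin u) (x : LogForms k O u) :
    ((1 : O) ⊗ₜ[k] logGenerator k s : LogForms k O u) * x = mulGenerator k O s x := by
  induction x using TensorProduct.induction_on with
  | zero => simp
  | add x y hx hy => simp only [map_add, mul_add, hx, hy]
  | tmul f a => simp [mulGenerator]

end Forms

/-- Quasi-inverses `G s` of the commuting derivations `logDerivation z D v s`: for the logarithmic
variables `s < v` the operator `G s` inverts the derivation on its image and commutes with it, and
for the other variables it is a right inverse, that is, an integration operator. -/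
structure LogIntegration (z : Fin u → O) (D : Fin u → Derivation k O O) (v : ℕ)
    (G : Fin u → O →ₗ[k] O) : Prop where
  deriv_comm : ∀ s t f, logDerivation z D v s (logDerivation z D v t f) =
    logDerivation z D v t (logDerivation z D v s f)
  deriv_int : ∀ s t, s ≠ t → ∀ f, logDerivation z D v s (G t f) = G t (logDerivation z D v s f)
  deriv_int_deriv : ∀ s f,
    logDerivation z D v s (G s (logDerivation z D v s f)) = logDerivation z D v s f
  int_comm : ∀ s : Fin u, (s : ℕ) < v → ∀ f,
    logDerivation z D v s (G s f) = G s (logDerivation z D v s f)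
  deriv_int_self : ∀ s : Fin u, v ≤ (s : ℕ) → ∀ f, logDerivation z D v s (G s f) = f

/-- The antishift of families of multi-indices, a right inverse of the shift `a ↦ a + eₛ`. -/
def antishift (k : Type*) [Field k] {u : ℕ} (s : Fin u) (V : Type*) [AddCommGroup V] [Module k V] :
    ((Fin u → ℕ) → V) →ₗ[k] ((Fin u → ℕ) → V) where
  toFun c a := if a s = 0 then 0 else c (a - Pi.single s 1)
  map_add' x y := by
    funext a
    simp only [Pi.add_apply]
    split_ifs <;> simp
  map_smul' t x := by
    funext a
    simp only [Pi.smul_apply, RingHom.id_apply]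
    split_ifs <;> simp

theorem antishift_apply (s : Fin u) {V : Type*} [AddCommGroup V] [Module k V]
    (c : (Fin u → ℕ) → V) (a : Fin u → ℕ) :
    antishift k s V c a = if a s = 0 then 0 else c (a - Pi.single s 1) := rfl

theorem antishift_compLeft (s : Fin u) {V : Type*} [AddCommGroup V] [Module k V]
    (φ : V →ₗ[k] V) (c : (Fin u → ℕ) → V) :
    antishift k s V (φ.compLeft _ c) = φ.compLeft _ (antishift k s V c) := by
  funext a
  simp only [antishift_apply, LinearMap.compLeft_apply, Function.comp_apply]
  split_ifs <;> simp

variable {z : Fin u → O} {D : Fin u → Derivation k O O} {v : ℕ} {G : Fin u → O →ₗ[k] O}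

/-- The operators on families of logarithmic forms indexed by multi-indices. -/
noncomputable def formOperators (h : LogIntegration z D v G) :
    KoszulOperators k ((Fin u → ℕ) → LogForms k O u) (Fin u) where
  gr i r :=
    { carrier := {c | (∀ a, ∑ s, a s ≠ i → c a = 0) ∧ ∀ a, c a ∈ logFormsGrading k O u r}
      add_mem' := fun hx hy => ⟨fun a ha => by rw [Pi.add_apply, hx.1 a ha, hy.1 a ha, add_zero],
        fun a => add_mem (hx.2 a) (hy.2 a)⟩
      zero_mem' := ⟨fun _ _ => rfl, fun _ => zero_mem _⟩
      smul_mem' := fun t x hx => ⟨fun a ha => by rw [Pi.smul_apply, hx.1 a ha, smul_zero],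
        fun a => ((logFormsGrading k O u r).restrictScalars k).smul_mem t (hx.2 a)⟩ }
  L := Finset.univ.filter fun s => (s : ℕ) < v
  w s := (mulGenerator k O s).compLeft _
  c s := (contractForm k O s).compLeft _
  D s := (coeffMap (logDerivation z D v s : O →ₗ[k] O)).compLeft _
  G s := (coeffMap (G s)).compLeft _
  S s := LinearMap.funLeft k _ fun a => a + Pi.single s 1
  J s := antishift k s _
  w_mem s i r x hx := ⟨fun a ha => by simp [hx.1 a ha], fun a =>
    lTensor_mem_logForms _ (logGenerator_mul_mem s r) (hx.2 a)⟩
  c_mem s i r x hx := ⟨fun a ha => by simp [hx.1 a ha], fun a =>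
    lTensor_mem_logForms _ (contraction_mem s r) (hx.2 a)⟩
  D_mem s i r x hx := ⟨fun a ha => by simp [hx.1 a ha], fun a => rTensor_mem_logForms _ (hx.2 a)⟩
  G_mem s i r x hx := ⟨fun a ha => by simp [hx.1 a ha], fun a => rTensor_mem_logForms _ (hx.2 a)⟩
  S_mem s i r x hx := ⟨fun a ha => hx.1 _ (by rw [sum_add_single]; omega), fun a => hx.2 _⟩
  S_zero s r x hx := funext fun a => hx.1 _ (by rw [sum_add_single]; omega)
  J_mem s i r x hx := by
    refine ⟨fun a ha => ?_, fun a => ?_⟩ <;> rw [antishift_apply] <;> split_ifs with h0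
    · rfl
    · refine hx.1 _ fun h1 => ha ?_
      rw [← h1, ← sum_add_single _ s, tsub_add_cancel_of_le]
      intro t
      by_cases hts : t = s
      · subst hts; simp; omega
      · simp [hts]
    · exact zero_mem _
    · exact hx.2 _
  eq_zero i r x hx hc := funext fun a =>
    eq_zero_of_contractForm (hx.2 a) fun s => congrFun (hc s) a
  w_w s x := funext fun a => mulGenerator_mulGenerator s _
  w_w' s t x := funext fun a => mulGenerator_comm s t _
  c_c s x := funext fun a => contractForm_contractForm s _
  c_c' s t x := funext fun a => contractForm_comm s t _
  c_w s x := funext fun a => (contractForm_mulGenerator s s _).trans (by rw [if_pos rfl]; rfl)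
  c_w' s t hst x := funext fun a =>
    (contractForm_mulGenerator s t _).trans (by rw [if_neg hst, zero_sub]; rfl)
  D_w s t x := funext fun a => coeffMap_mulGenerator _ t _
  D_c s t x := funext fun a => coeffMap_contractForm _ t _
  G_w s t x := funext fun a => coeffMap_mulGenerator _ t _
  G_c s t x := funext fun a => coeffMap_contractForm _ t _
  S_w s t x := rfl
  S_c s t x := rfl
  J_w s t x := antishift_compLeft s _ x
  J_c s t x := antishift_compLeft s _ x
  S_D s t x := rfl
  S_G s t x := rfl
  J_D s t x := antishift_compLeft s _ x
  D_D s t x := funext fun a => by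
    simp only [LinearMap.compLeft_apply, Function.comp_apply, coeffMap_coeffMap]
    congr 2
    exact LinearMap.ext (h.deriv_comm s t)
  D_G s t hst x := funext fun a => by
    simp only [LinearMap.compLeft_apply, Function.comp_apply, coeffMap_coeffMap]
    congr 2
    exact LinearMap.ext (h.deriv_int s t hst)
  D_G_D s x := funext fun a => by
    simp only [LinearMap.compLeft_apply, Function.comp_apply, coeffMap_coeffMap]
    congr 2
    exact LinearMap.ext (h.deriv_int_deriv s)
  D_G_of_mem s hs x := funext fun a => by
    simp only [LinearMap.compLeft_apply, Function.comp_apply, coeffMap_coeffMap]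
    congr 2
    exact LinearMap.ext (h.int_comm s (Finset.mem_filter.1 hs).2)
  D_G_of_notMem s hs x := funext fun a => by
    simp only [LinearMap.compLeft_apply, Function.comp_apply, coeffMap_coeffMap]
    conv_rhs => rw [← coeffMap_id (x a)]
    congr 2
    exact LinearMap.ext (h.deriv_int_self s
      (not_lt.1 fun h' => hs (Finset.mem_filter.2 ⟨Finset.mem_univ s, h'⟩)))
  S_S s t x := funext fun a => congrArg x (add_right_comm a _ _)
  S_J s x := funext fun a => by
    rw [LinearMap.funLeft_apply, antishift_apply, if_neg (by simp), add_tsub_cancel_right]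
  S_J' s t hst x := funext fun a => by
    rw [LinearMap.funLeft_apply, antishift_apply, antishift_apply]
    have h1 : (a + Pi.single s 1 : Fin u → ℕ) t = a t := by simp [hst.symm]
    rw [h1]
    split_ifs with h0
    · rfl
    · rw [LinearMap.funLeft_apply]
      congr 1
      rw [tsub_add_eq_add_tsub]
      intro r
      by_cases hr : r = t
      · subst hr; simp; omega
      · simp [hr]

/-- A graded algebra which in positive degrees consists of the closed logarithmic forms has
regularity at most one over the exterior algebra on the generators `ωₛ`. -/
theorem isRegularOverExterior_of_closedForms (h : LogIntegration z D v G) {B : Type*} [Ring B]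
    [Algebra k B] {𝒜 : ℕ → Submodule k B} (φ : B →ₐ[k] LogForms k O u)
    (hφ : Function.Injective φ) (h1 : ∀ n b, b ∈ 𝒜 n ↔ φ b ∈ logFormsGrading k O u n)
    (h2 : ∀ b, deRham z D v (φ b) = 0)
    (h3 : ∀ n x, x ∈ logFormsGrading k O u (n + 1) → deRham z D v x = 0 → ∃ b, φ b = x) :
    ∃ η : Fin u → B, IsRegularOverExterior 𝒜 η := by
  let ω' : Fin u → LogForms k O u := fun s => (1 : O) ⊗ₜ[k] logGenerator k s
  have hmem : ∀ s, ω' s ∈ logFormsGrading k O u (0 + 1) := fun s =>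
    Submodule.tmul_mem_baseChange_of_mem _ (logGenerator_mem s)
  have hclosed : ∀ s, deRham z D v (ω' s) = 0 := fun s => by
    rw [deRham_tmul]
    simp
  choose η hη using fun s => h3 0 (ω' s) (hmem s) (hclosed s)
  have hcartan : ∀ (c : (Fin u → ℕ) → B) a, φ (cartanDiff η c a) =
      ∑ s, mulGenerator k O s (φ (c (a + Pi.single s 1))) := by
    intro c a
    simp only [cartanDiff, map_sum, smul_eq_mul, map_mul, hη, ω', one_tmul_mul]
  refine ⟨η, fun s => ?_, fun s t => hφ ?_, fun s => hφ ?_, fun r i c hc hd => ?_⟩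
  · rw [h1, hη]; exact hmem s
  · rw [map_zero, map_add, map_mul, map_mul, hη, hη, one_tmul_mul, one_tmul_mul]
    simp only [ω', mulGenerator, LinearMap.lTensor_tmul, LinearMap.mulLeft_apply]
    rw [← TensorProduct.tmul_add, ExteriorAlgebra.ι_add_mul_swap, TensorProduct.tmul_zero]
  · rw [map_zero, map_mul, hη, one_tmul_mul]
    simp only [ω', mulGenerator, LinearMap.lTensor_tmul, LinearMap.mulLeft_apply]
    rw [ExteriorAlgebra.ι_sq_zero, TensorProduct.tmul_zero]
  · let K := formOperators h
    have hdiff : ∀ (x : (Fin u → ℕ) → LogForms k O u) a, K.diff x a = deRham z D v (x a) := by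
      intro x a
      rw [K.diff_apply, Finset.sum_apply, deRham_apply]
      rfl
    have hcar : ∀ (x : (Fin u → ℕ) → LogForms k O u) a, K.cartan Finset.univ x a =
        ∑ s, mulGenerator k O s (x (a + Pi.single s 1)) := by
      intro x a
      rw [K.cartan_apply, Finset.sum_apply]
      rfl
    -- the part of the family `c` in level `i`
    let x : (Fin u → ℕ) → LogForms k O u := fun a => if ∑ s, a s = i then φ (c a) else 0
    have hx : x ∈ K.gr i (r + 2) := by
      refine ⟨fun a ha => if_neg ha, fun a => ?_⟩
      simp only [x]
      split_ifs
      exacts [(h1 _ _).1 (hc a), zero_mem _]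
    have hdx : K.diff x = 0 := by
      funext a
      rw [hdiff]
      simp only [x]
      split_ifs
      exacts [h2 _, map_zero _]
    have hcx : K.cartan Finset.univ x = 0 := by
      funext a
      rw [hcar]
      simp only [x, sum_add_single]
      split_ifs with ha
      · rw [← hcartan, hd a ha, map_zero]; rfl
      · simp
    obtain ⟨y, hy, hdy, hyx⟩ := K.exists_closed_cartan_eq i hx hdx hcx
    choose c' hc' using fun a => h3 r (y a) (hy.2 a) (by rw [← hdiff, hdy]; rfl)
    refine ⟨c', fun a => by rw [h1, hc']; exact hy.2 a, fun a ha => hφ ?_⟩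
    rw [hcartan]
    simp only [hc']
    rw [← hcar, hyx]
    exact if_pos ha

end FormOperators

section ClosedForms

universe w

variable {k : Type*} {O : Type w} [Field k] [CommRing O] [Algebra k O] {u : ℕ}
  {z : Fin u → O} {D : Fin u → Derivation k O O} {v : ℕ} {G : Fin u → O →ₗ[k] O}

variable (k O u) in
/-- The projection of forms to their component of degree zero. -/
noncomputable def constantTerm : LogForms k O u →ₗ[k] O :=
  (TensorProduct.rid k O).toLinearMap ∘ₗ
    (ExteriorAlgebra.algebraMapInv (R := k) (M := Fin u → k)).toLinearMap.lTensor O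

theorem constantTerm_tmul_one (f : O) : constantTerm k O u (f ⊗ₜ 1) = f := by
  simp [constantTerm]

theorem algebraMap_closedForms_injective [Nontrivial O] :
    Function.Injective (algebraMap k (closedForms z D v)) := by
  intro a b hab
  have h1 := congrArg (fun x : closedForms z D v => constantTerm k O u x) hab
  simp only [Subalgebra.coe_algebraMap, Algebra.TensorProduct.algebraMap_apply,
    constantTerm_tmul_one] at h1
  exact (algebraMap k O).injective h1

theorem exists_eq_tmul_one {x : LogForms k O u} (hx : x ∈ logFormsGrading k O u 0) :
    ∃ f : O, x = f ⊗ₜ 1 := by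
  refine logForms_induction (C := fun x => ∃ f : O, x = f ⊗ₜ 1) (fun f a ha => ?_)
    ⟨0, by simp⟩ ?_ hx
  · change a ∈ LinearMap.range (ExteriorAlgebra.ι k) ^ 0 at ha
    rw [pow_zero] at ha
    obtain ⟨c, rfl⟩ := Submodule.mem_one.1 ha
    refine ⟨c • f, ?_⟩
    rw [Algebra.algebraMap_eq_smul_one, TensorProduct.smul_tmul]
  · rintro _ _ ⟨f, rfl⟩ ⟨g, rfl⟩
    exact ⟨f + g, (TensorProduct.add_tmul _ _ _).symm⟩

/-- The algebra of closed forms is Koszul if the constants are the only closed functions. -/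
theorem isKoszul_closedGrading [Nontrivial O] (h : LogIntegration z D v G)
    (hk : ∀ f : O, (∀ s, logDerivation z D v s f = 0) → ∃ c : k, f = algebraMap k O c) :
    IsKoszul (closedGrading z D v) := by
  obtain ⟨η, hη⟩ := isRegularOverExterior_of_closedForms h (𝒜 := closedGrading z D v)
    (closedForms z D v).val Subtype.val_injective (fun n b => Iff.rfl) (fun b => b.2)
    (fun n x _ hx => ⟨⟨x, hx⟩, rfl⟩)
  refine hη.isKoszul ⟨fun a b hab => ?_, fun x => ?_⟩
  · exact algebraMap_closedForms_injective (z := z) (D := D) (v := v) (congrArg Subtype.val hab)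
  · obtain ⟨⟨x, hxd⟩, hx⟩ := x
    obtain ⟨f, rfl⟩ := exists_eq_tmul_one hx
    obtain ⟨c, rfl⟩ := hk f fun s => by
      have h1 : deRham z D v (f ⊗ₜ 1) = 0 := hxd
      have h2 := congrArg (contractForm k O s) h1
      rw [deRham_apply, map_sum, map_zero, Finset.sum_eq_single_of_mem s (Finset.mem_univ s)] at h2
      · have h3 : contractForm k O s ((logDerivation z D v s f) ⊗ₜ 1) = 0 := by
          simp [contractForm, contraction]
        have h4 : coeffMap (logDerivation z D v s : O →ₗ[k] O)
            (f ⊗ₜ (1 : ExteriorAlgebra k (Fin u → k))) = (logDerivation z D v s f) ⊗ₜ 1 := by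
          simp [coeffMap]
        rw [h4, contractForm_mulGenerator, if_pos rfl, h3, map_zero, sub_zero] at h2
        rw [← constantTerm_tmul_one (k := k) (u := u) (logDerivation z D v s f), h2, map_zero]
      · intro t _ hts
        rw [contractForm_mulGenerator, if_neg hts.symm, ← coeffMap_contractForm]
        simp [contractForm, contraction]
    exact ⟨c, rfl⟩

/-- The algebra of constants and closed forms of positive degree is Koszul. -/
theorem isKoszul_connectedGrading [Nontrivial O] (h : LogIntegration z D v G) :
    IsKoszul (B := connectedPart (closedGrading z D v))
      (connectedGrading (closedGrading z D v)) := by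
  let φ : connectedPart (closedGrading z D v) →ₐ[k] LogForms k O u :=
    (closedForms z D v).val.comp (connectedPart (closedGrading z D v)).val
  have hclosed : ∀ b, deRham z D v (φ b) = 0 := fun b => b.1.2
  obtain ⟨η, hη⟩ := isRegularOverExterior_of_closedForms h
    (B := connectedPart (closedGrading z D v)) (𝒜 := connectedGrading (closedGrading z D v))
    φ (Subtype.val_injective.comp Subtype.val_injective) (fun n b => Iff.rfl) hclosed
    (fun n x hx hd => by
      refine ⟨⟨⟨x, hd⟩, ?_⟩, rfl⟩
      change (DirectSum.decompose (closedGrading z D v) _ 0 : closedForms z D v) ∈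
        (⊥ : Subalgebra k (closedForms z D v))
      have hx' : (⟨x, hd⟩ : closedForms z D v) ∈ closedGrading z D v (n + 1) := hx
      rw [DirectSum.decompose_of_mem_ne _ hx' (Nat.succ_ne_zero n)]
      exact zero_mem _)
  refine hη.isKoszul ⟨fun a b hab => ?_, fun x => ?_⟩
  · exact algebraMap_closedForms_injective (z := z) (D := D) (v := v)
      (congrArg (fun x => x.1.1) hab)
  · obtain ⟨⟨x, hxc⟩, hx⟩ := x
    have hxc' : (DirectSum.decompose (closedGrading z D v) x 0 : closedForms z D v) ∈
      (⊥ : Subalgebra k (closedForms z D v)) := hxc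
    have hx' : x ∈ closedGrading z D v 0 := hx
    rw [DirectSum.decompose_of_mem_same _ hx'] at hxc'
    obtain ⟨c, rfl⟩ := Algebra.mem_bot.1 hxc'
    exact ⟨c, rfl⟩

end ClosedForms

/-! ### Algebras of polynomials and power series -/

section CoefficientAlgebras

variable {k O : Type*} [Field k] [CommRing O] [Algebra k O] {u : ℕ}

/-- The features common to ordinary and divided power polynomials and series that the integration
of forms needs: elements of `O` are determined by their coefficients `coeff f n` at multi-indices
`n`, partial differentiation shifts the coefficients up to nonzero weights (`n + 1` for ordinary
powers and `1` for divided ones), Euler's operators `zₛ ∂ₛ` are diagonal, and `O` is stable under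
diagonal operators and under antishifts. -/
structure MonomialExpansion (z : Fin u → O) (D : Fin u → Derivation k O O)
    (coeff : O →ₗ[k] ((Fin u →₀ ℕ) → k)) (wt : ℕ → k) : Prop where
  injective : Function.Injective coeff
  wt_ne_zero : ∀ n, wt n ≠ 0
  coeff_algebraMap : ∀ c n, coeff (algebraMap k O c) n = if n = 0 then c else 0
  coeff_deriv : ∀ s f n, coeff (D s f) n = wt (n s) * coeff f (n + Finsupp.single s 1)
  coeff_euler : ∀ s f n, coeff (z s * D s f) n = (n s : k) * coeff f n
  exists_diagonal : ∀ (w : (Fin u →₀ ℕ) → k) (f : O), ∃ g : O, ∀ n, coeff g n = w n * coeff f n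
  exists_antishift : ∀ (s : Fin u) (f : O), ∃ g : O, ∀ n,
    coeff g n = if n s = 0 then 0 else coeff f (n - Finsupp.single s 1)

/-- An operator on the target of an injective linear map lifts to the source if it preserves the
image. -/
theorem exists_linearMap_of_injective {V : Type*} [AddCommGroup V] [Module k V] {E : O →ₗ[k] V}
    (hE : Function.Injective E) (T : V →ₗ[k] V) (h : ∀ f, ∃ g, E g = T (E f)) :
    ∃ G : O →ₗ[k] O, ∀ f, E (G f) = T (E f) := by
  choose G hG using h
  exact ⟨{ toFun := G
           map_add' := fun f g => hE (by simp only [map_add, hG])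
           map_smul' := fun c f => hE (by simp only [map_smul, hG, RingHom.id_apply]) }, hG⟩

namespace MonomialExpansion

variable {z : Fin u → O} {D : Fin u → Derivation k O O} {coeff : O →ₗ[k] ((Fin u →₀ ℕ) → k)}
  {wt : ℕ → k}

theorem coeff_logDerivation_of_lt (h : MonomialExpansion z D coeff wt) {v : ℕ} {s : Fin u}
    (hs : (s : ℕ) < v) (f : O) (n : Fin u →₀ ℕ) :
    coeff (logDerivation z D v s f) n = (n s : k) * coeff f n := by
  rw [logDerivation, if_pos hs, Derivation.smul_apply, smul_eq_mul, h.coeff_euler]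

theorem coeff_logDerivation_of_le (h : MonomialExpansion z D coeff wt) {v : ℕ} {s : Fin u}
    (hs : v ≤ (s : ℕ)) (f : O) (n : Fin u →₀ ℕ) :
    coeff (logDerivation z D v s f) n = wt (n s) * coeff f (n + Finsupp.single s 1) := by
  rw [logDerivation, if_neg (not_lt.2 hs), h.coeff_deriv]

theorem exists_integration (h : MonomialExpansion z D coeff wt) (v : ℕ) (s : Fin u) :
    ∃ G : O →ₗ[k] O, ((s : ℕ) < v → ∀ f n, coeff (G f) n = (n s : k)⁻¹ * coeff f n) ∧
      (v ≤ (s : ℕ) → ∀ f n, coeff (G f) n =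
        if n s = 0 then 0 else (wt (n s - 1))⁻¹ * coeff f (n - Finsupp.single s 1)) := by
  rcases Nat.lt_or_ge (s : ℕ) v with hs | hs
  · obtain ⟨G, hG⟩ := exists_linearMap_of_injective h.injective
      (LinearMap.pi fun n => (n s : k)⁻¹ • LinearMap.proj n) fun f => by
        obtain ⟨g, hg⟩ := h.exists_diagonal (fun n => (n s : k)⁻¹) f
        exact ⟨g, funext hg⟩
    exact ⟨G, fun _ f n => by rw [hG]; rfl, fun h' => absurd hs (not_lt.2 h')⟩
  · obtain ⟨G, hG⟩ := exists_linearMap_of_injective h.injective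
      (LinearMap.pi fun n => if n s = 0 then 0 else
        (wt (n s - 1))⁻¹ • LinearMap.proj (n - Finsupp.single s 1)) fun f => by
        obtain ⟨g, hg⟩ := h.exists_antishift s f
        obtain ⟨g', hg'⟩ := h.exists_diagonal (fun n => (wt (n s - 1))⁻¹) g
        refine ⟨g', funext fun n => ?_⟩
        rw [hg', hg, LinearMap.pi_apply]
        split_ifs <;> simp
    refine ⟨G, fun h' => absurd h' (not_lt.2 hs), fun _ f n => ?_⟩
    rw [hG, LinearMap.pi_apply]
    split_ifs <;> simp

/-- Integrating coefficientwise inverts the logarithmic derivations. In positive characteristic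
the convention `0⁻¹ = 0` makes the inverse Euler operator vanish on all monomials `z^[n]` with `nₛ`
divisible by the characteristic, as it should. -/
theorem exists_logIntegration (h : MonomialExpansion z D coeff wt) (v : ℕ) :
    ∃ G, LogIntegration z D v G := by
  choose G hlt hle using h.exists_integration v
  have hsub : ∀ (n : Fin u →₀ ℕ) (s : Fin u), n s ≠ 0 →
      n - Finsupp.single s 1 + Finsupp.single s 1 = n := fun n s hn =>
    tsub_add_cancel_of_le (Finsupp.single_le_iff.mpr (Nat.one_le_iff_ne_zero.mpr hn))
  refine ⟨G, ⟨fun s t f => ?_, fun s t hst f => ?_, fun s f => ?_, fun s hs f => ?_,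
    fun s hs f => ?_⟩⟩
  all_goals apply h.injective; funext n
  · rcases eq_or_ne s t with rfl | hst
    · rfl
    have h1 : ∀ i : ℕ, (n + Finsupp.single s i : Fin u →₀ ℕ) t = n t := fun i => by
      simp [Finsupp.single_eq_of_ne hst.symm]
    have h2 : ∀ i : ℕ, (n + Finsupp.single t i : Fin u →₀ ℕ) s = n s := fun i => by
      simp [Finsupp.single_eq_of_ne hst]
    rcases Nat.lt_or_ge (s : ℕ) v with hs | hs <;> rcases Nat.lt_or_ge (t : ℕ) v with ht | ht <;>
      simp only [h.coeff_logDerivation_of_lt, h.coeff_logDerivation_of_le, hs, ht, h1, h2]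
    · ring
    · ring
    · ring
    · rw [add_right_comm]; ring
  · have h1 : ∀ i : ℕ, (n + Finsupp.single s i : Fin u →₀ ℕ) t = n t := fun i => by
      simp [Finsupp.single_eq_of_ne hst.symm]
    have h2 : ∀ i : ℕ, (n - Finsupp.single t i : Fin u →₀ ℕ) s = n s := fun i => by
      simp [Finsupp.single_eq_of_ne hst]
    rcases Nat.lt_or_ge (s : ℕ) v with hs | hs <;> rcases Nat.lt_or_ge (t : ℕ) v with ht | ht <;>
      simp only [h.coeff_logDerivation_of_lt, h.coeff_logDerivation_of_le, hlt, hle, hs,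
        ht, h1, h2]
    · ring
    · split_ifs
      · ring
      · ring
    · ring
    · split_ifs with hn
      · ring
      · have : n + Finsupp.single s 1 - Finsupp.single t 1 =
            n - Finsupp.single t 1 + Finsupp.single s 1 := by
          conv_lhs => rw [← hsub n t hn, add_right_comm]
          exact add_tsub_cancel_right _ _
        rw [this]; ring
  · rcases Nat.lt_or_ge (s : ℕ) v with hs | hs
    · simp only [h.coeff_logDerivation_of_lt hs, hlt _ hs]
      rcases eq_or_ne (n s : k) 0 with hn | hn
      · simp [hn]
      · field_simp
    · simp only [h.coeff_logDerivation_of_le hs, hle _ hs]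
      simp [h.wt_ne_zero]
  · simp only [h.coeff_logDerivation_of_lt hs, hlt _ hs]
    ring
  · simp only [h.coeff_logDerivation_of_le hs, hle _ hs]
    simp [h.wt_ne_zero]

theorem eq_algebraMap_of_logDerivation_eq_zero (h : MonomialExpansion z D coeff wt) {v : ℕ}
    (hv : v = 0 ∨ CharZero k) (f : O) (hf : ∀ s, logDerivation z D v s f = 0) :
    ∃ c, f = algebraMap k O c := by
  refine ⟨coeff f 0, h.injective (funext fun n => ?_)⟩
  rw [h.coeff_algebraMap]
  split_ifs with hn
  · rw [hn]
  obtain ⟨s, hs⟩ := Finsupp.ne_iff.1 hn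
  rcases Nat.lt_or_ge (s : ℕ) v with hsv | hsv
  · have h1 := h.coeff_logDerivation_of_lt hsv f n
    have : CharZero k := hv.resolve_left (by omega)
    rw [hf, map_zero, Pi.zero_apply] at h1
    exact (mul_eq_zero.1 h1.symm).resolve_left (Nat.cast_ne_zero.2 hs)
  · have h1 := h.coeff_logDerivation_of_le hsv f (n - Finsupp.single s 1)
    rw [hf, map_zero, Pi.zero_apply, tsub_add_cancel_of_le
      (Finsupp.single_le_iff.mpr (Nat.one_le_iff_ne_zero.mpr hs))] at h1
    exact (mul_eq_zero.1 h1.symm).resolve_left (h.wt_ne_zero _)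

theorem nontrivial (h : MonomialExpansion z D coeff wt) : Nontrivial O := by
  refine ⟨algebraMap k O 1, 0, fun h1 => ?_⟩
  have h2 := h.coeff_algebraMap 1 0
  rw [h1, map_zero, if_pos rfl] at h2
  exact one_ne_zero h2.symm

theorem isKoszul_closedGrading (h : MonomialExpansion z D coeff wt) {v : ℕ}
    (hv : v = 0 ∨ CharZero k) : IsKoszul (closedGrading z D v) := by
  have := h.nontrivial
  obtain ⟨G, hG⟩ := h.exists_logIntegration v
  exact _root_.isKoszul_closedGrading hG (h.eq_algebraMap_of_logDerivation_eq_zero hv)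

theorem isKoszul_connectedGrading (h : MonomialExpansion z D coeff wt) (v : ℕ) :
    IsKoszul (B := connectedPart (closedGrading z D v))
      (connectedGrading (closedGrading z D v)) := by
  have := h.nontrivial
  obtain ⟨G, hG⟩ := h.exists_logIntegration v
  exact _root_.isKoszul_connectedGrading hG

end MonomialExpansion

end CoefficientAlgebras

theorem finite_support_antishift {k : Type*} [Field k] {u : ℕ} {c : (Fin u →₀ ℕ) → k}
    (hc : (Function.support c).Finite) (s : Fin u) :
    (Function.support fun n : Fin u →₀ ℕ =>
      if n s = 0 then 0 else c (n - Finsupp.single s 1)).Finite := by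
  refine (hc.image (fun n => n + Finsupp.single s 1)).subset fun n hn => ?_
  rw [Function.mem_support, ite_ne_left_iff] at hn
  exact ⟨n - Finsupp.single s 1, hn.2.symm, tsub_add_cancel_of_le
    (Finsupp.single_le_iff.mpr (Nat.one_le_iff_ne_zero.mpr hn.1))⟩

section Instances

variable {k : Type*} [Field k] {u : ℕ}

theorem MvPowerSeries.monomialExpansion [CharZero k] :
    MonomialExpansion (k := k) (O := MvPowerSeries (Fin u) k) MvPowerSeries.X
      (MvPowerSeries.pderiv k) (LinearMap.pi fun n => MvPowerSeries.coeff n)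
      (fun n => (n : k) + 1) where
  injective f g hfg := MvPowerSeries.ext fun n => congrFun hfg n
  wt_ne_zero n := Nat.cast_add_one_ne_zero n
  coeff_algebraMap c n := by
    classical
    rw [LinearMap.pi_apply, MvPowerSeries.algebraMap_apply, MvPowerSeries.coeff_C]; rfl
  coeff_deriv s f n := by
    rw [LinearMap.pi_apply, MvPowerSeries.coeff_pderiv, mul_comm]; rfl
  coeff_euler s f n := by
    classical
    rw [LinearMap.pi_apply, LinearMap.pi_apply, MvPowerSeries.X, MvPowerSeries.coeff_monomial_mul]
    by_cases hn : n s = 0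
    · rw [if_neg (by rw [Finsupp.single_le_iff, hn]; decide), hn]; simp
    · have hle : Finsupp.single s 1 ≤ n :=
        Finsupp.single_le_iff.mpr (Nat.one_le_iff_ne_zero.mpr hn)
      rw [if_pos hle, MvPowerSeries.coeff_pderiv, tsub_add_cancel_of_le hle, one_mul, mul_comm]
      congr 1
      rw [Finsupp.tsub_apply, Finsupp.single_eq_same, Nat.cast_sub (Nat.one_le_iff_ne_zero.mpr hn)]
      simp
  exists_diagonal w f := ⟨fun n => w n * MvPowerSeries.coeff n f, fun n => rfl⟩
  exists_antishift s f := ⟨fun n => if n s = 0 then 0 else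
    MvPowerSeries.coeff (n - Finsupp.single s 1) f, fun n => rfl⟩

theorem MvPolynomial.monomialExpansion [CharZero k] :
    MonomialExpansion (k := k) (O := MvPolynomial (Fin u) k) MvPolynomial.X
      MvPolynomial.pderiv (LinearMap.pi fun n => MvPolynomial.lcoeff k n)
      (fun n => (n : k) + 1) where
  injective f g hfg := MvPolynomial.ext _ _ fun n => congrFun hfg n
  wt_ne_zero n := Nat.cast_add_one_ne_zero n
  coeff_algebraMap c n := by
    classical
    rw [LinearMap.pi_apply, MvPolynomial.lcoeff_apply, MvPolynomial.algebraMap_eq,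
      MvPolynomial.coeff_C]
    simp only [eq_comm]
  coeff_deriv s f n := by
    rw [LinearMap.pi_apply, MvPolynomial.lcoeff_apply, MvPolynomial.coeff_pderiv, mul_comm]
    rfl
  coeff_euler s f n := by
    classical
    rw [LinearMap.pi_apply, LinearMap.pi_apply, MvPolynomial.lcoeff_apply,
      MvPolynomial.lcoeff_apply, MvPolynomial.coeff_X_mul']
    by_cases hn : n s = 0
    · rw [if_neg (by simp [hn]), hn]; simp
    · have hle : Finsupp.single s 1 ≤ n :=
        Finsupp.single_le_iff.mpr (Nat.one_le_iff_ne_zero.mpr hn)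
      rw [if_pos (by simp [hn]), MvPolynomial.coeff_pderiv, tsub_add_cancel_of_le hle, mul_comm]
      congr 1
      rw [Finsupp.tsub_apply, Finsupp.single_eq_same, Nat.cast_sub (Nat.one_le_iff_ne_zero.mpr hn)]
      simp
  exists_diagonal w f := by
    have hfin : (Function.support fun n => w n * MvPolynomial.coeff n f).Finite :=
      f.support.finite_toSet.subset fun n hn =>
        MvPolynomial.mem_support_iff.2 (right_ne_zero_of_mul hn)
    exact ⟨AddMonoidAlgebra.ofCoeff (Finsupp.ofSupportFinite _ hfin), fun n => rfl⟩
  exists_antishift s f := by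
    have hfin := finite_support_antishift (c := fun n => MvPolynomial.coeff n f)
      (f.support.finite_toSet.subset fun n hn => MvPolynomial.mem_support_iff.2 hn) s
    exact ⟨AddMonoidAlgebra.ofCoeff (Finsupp.ofSupportFinite _ hfin), fun n => rfl⟩

namespace DPSeries

theorem binom_single_one (s : Fin u) (n : Fin u →₀ ℕ) :
    binom (Finsupp.single s 1) n = n s + 1 := by
  rw [binom, Finset.prod_eq_single_of_mem s (Finset.mem_univ s)]
  · simp [add_comm]
  · intro t _ hts
    simp [Finsupp.single_eq_of_ne hts]

theorem coeff_coord_mul_partialDeriv (s : Fin u) (f : DPSeries u k) (n : Fin u →₀ ℕ) :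
    (coord s * partialDeriv s f).coeff n = (n s : k) * f.coeff n := by
  rw [coeff_mul]
  by_cases hn : n s = 0
  · rw [hn, Nat.cast_zero, zero_mul]
    refine Finset.sum_eq_zero fun p hp => ?_
    rw [Finset.HasAntidiagonal.mem_antidiagonal] at hp
    have : p.1 ≠ Finsupp.single s 1 := by
      intro h
      rw [← hp, h] at hn
      simp at hn
    simp [coord, coeff_monomial, this]
  · have hle : Finsupp.single s 1 ≤ n :=
      Finsupp.single_le_iff.mpr (Nat.one_le_iff_ne_zero.mpr hn)
    rw [Finset.sum_eq_single (Finsupp.single s 1, n - Finsupp.single s 1)]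
    · change (binom (Finsupp.single s 1) (n - Finsupp.single s 1) : k) * ((coord s).coeff _ *
        f.coeff (n - Finsupp.single s 1 + Finsupp.single s 1)) = _
      rw [binom_single_one, coord, coeff_monomial, if_pos rfl, one_mul, tsub_add_cancel_of_le hle,
        Finsupp.tsub_apply, Finsupp.single_eq_same, Nat.sub_add_cancel
        (Nat.one_le_iff_ne_zero.mpr hn)]
    · rintro ⟨a, b⟩ hab hne
      rw [Finset.HasAntidiagonal.mem_antidiagonal] at hab
      have : a ≠ Finsupp.single s 1 := by
        rintro rfl
        refine hne ?_
        rw [← hab]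
        simp
      simp [coord, coeff_monomial, this]
    · intro h
      exact absurd (Finset.HasAntidiagonal.mem_antidiagonal.2 (add_tsub_cancel_of_le hle)) h

variable (k u) in
/-- The coefficients of a divided power series, as a linear map. -/
def coeffLinear : DPSeries u k →ₗ[k] ((Fin u →₀ ℕ) → k) where
  toFun := DPSeries.coeff
  map_add' _ _ := rfl
  map_smul' _ _ := rfl

theorem monomialExpansion :
    MonomialExpansion (k := k) (O := DPSeries u k) coord partialDeriv (coeffLinear k u)
      (fun _ => 1) where
  injective _ _ hfg := DPSeries.ext hfg
  wt_ne_zero _ := one_ne_zero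
  coeff_algebraMap c n := coeff_monomial 0 n c
  coeff_deriv _ _ _ := (one_mul _).symm
  coeff_euler s f n := coeff_coord_mul_partialDeriv s f n
  exists_diagonal w f := ⟨⟨fun n => w n * f.coeff n⟩, fun _ => rfl⟩
  exists_antishift s f := ⟨⟨fun n => if n s = 0 then 0 else f.coeff (n - Finsupp.single s 1)⟩,
    fun _ => rfl⟩

end DPSeries

theorem DPPolynomial.monomialExpansion :
    MonomialExpansion (k := k) (O := DPPolynomial u k) DPPolynomial.coord DPPolynomial.partialDeriv
      (DPSeries.coeffLinear k u ∘ₗ (DPPolynomial u k).val.toLinearMap) (fun _ => 1) where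
  injective _ _ hfg := Subtype.ext (DPSeries.ext hfg)
  wt_ne_zero _ := one_ne_zero
  coeff_algebraMap c n := DPSeries.coeff_monomial 0 n c
  coeff_deriv _ _ _ := (one_mul _).symm
  coeff_euler s f n := DPSeries.coeff_coord_mul_partialDeriv s f.1 n
  exists_diagonal w f := ⟨⟨⟨fun n => w n * f.1.coeff n⟩,
    f.2.subset fun _ hn => right_ne_zero_of_mul hn⟩, fun _ => rfl⟩
  exists_antishift s f :=
    ⟨⟨⟨fun n => if n s = 0 then 0 else f.1.coeff (n - Finsupp.single s 1)⟩,
      finite_support_antishift f.2 s⟩, fun _ => rfl⟩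

end Instances

/-! ### Smooth and holomorphic functions on a disk -/

section SmoothDisk

variable {𝕜 : Type*} [RCLike 𝕜] {u : ℕ}

variable (𝕜) in
/-- The linear map multiplying the `s`-th coordinate by `c`. -/
noncomputable def scaleCoord (s : Fin u) (c : 𝕜) : (Fin u → 𝕜) →L[𝕜] (Fin u → 𝕜) :=
  ContinuousLinearMap.pi fun j => (if j = s then c else 1) • ContinuousLinearMap.proj j

theorem scaleCoord_apply (s : Fin u) (c : 𝕜) (x : Fin u → 𝕜) (j : Fin u) :
    scaleCoord 𝕜 s c x j = (if j = s then c else 1) * x j := rfl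

theorem scaleCoord_one (s : Fin u) (x : Fin u → 𝕜) : scaleCoord 𝕜 s 1 x = x := by
  funext j
  rw [scaleCoord_apply, ite_self, one_mul]

theorem scaleCoord_single (s j : Fin u) (c : 𝕜) :
    scaleCoord 𝕜 s c (Pi.single j 1) = (if j = s then c else 1) • Pi.single j 1 := by
  funext i
  rw [scaleCoord_apply, Pi.smul_apply, smul_eq_mul]
  rcases eq_or_ne i j with rfl | h
  · rfl
  · simp [Pi.single_eq_of_ne h]

theorem continuous_scaleCoord (s : Fin u) :
    Continuous fun p : ℝ × (Fin u → 𝕜) => scaleCoord 𝕜 s (p.1 : 𝕜) p.2 := by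
  refine continuous_pi fun j => ?_
  simp only [scaleCoord_apply]
  split_ifs
  · exact (RCLike.continuous_ofReal.comp continuous_fst).mul
      ((continuous_apply j).comp continuous_snd)
  · exact continuous_const.mul ((continuous_apply j).comp continuous_snd)

theorem continuous_scaleCoord_clm (s : Fin u) :
    Continuous fun t : ℝ => scaleCoord 𝕜 (u := u) s (t : 𝕜) := by
  rw [← continuousOn_univ, continuousOn_clm_apply]
  intro x
  exact ((continuous_scaleCoord s).comp (Continuous.prodMk_left x)).continuousOn

theorem IsReinhardtDisk.scaleCoord_mem {D : Set (Fin u → 𝕜)} (hD : IsReinhardtDisk 𝕜 D)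
    (s : Fin u) {t : ℝ} (ht : t ∈ Set.Icc (0 : ℝ) 1) {x : Fin u → 𝕜} (hx : x ∈ D) :
    scaleCoord 𝕜 s (t : 𝕜) x ∈ D := by
  refine hD.mem_of_norm_le x hx _ fun j => ?_
  rw [scaleCoord_apply, norm_mul]
  refine mul_le_of_le_one_left (norm_nonneg _) ?_
  split_ifs
  · rw [RCLike.norm_ofReal, abs_of_nonneg ht.1]; exact ht.2
  · rw [norm_one]

theorem IsReinhardtDisk.isPreconnected {D : Set (Fin u → 𝕜)} (hD : IsReinhardtDisk 𝕜 D) :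
    IsPreconnected D := by
  have hstar : StarConvex ℝ 0 D := fun x hx a b ha hb hab => by
    refine hD.mem_of_norm_le x hx _ fun j => ?_
    rw [smul_zero, zero_add, Pi.smul_apply, norm_smul, Real.norm_of_nonneg hb]
    exact mul_le_of_le_one_left (norm_nonneg _) (by linarith)
  exact (hstar.isPathConnected hD.zero_mem).isConnected.isPreconnected

namespace smoothFunctions

variable {D : TopologicalSpace.Opens (Fin u → 𝕜)}

theorem contDiffOn_extendZero (f : smoothFunctions D) :
    ContDiffOn 𝕜 ∞ (extendZero (D := (D : Set (Fin u → 𝕜))) f.1) D := f.2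

theorem extendZero_partialDeriv (j : Fin u) (f : smoothFunctions D) {x : Fin u → 𝕜} (hx : x ∈ D) :
    extendZero (D := (D : Set (Fin u → 𝕜))) (partialDeriv D j f).1 x =
      fderiv 𝕜 (extendZero (D := (D : Set (Fin u → 𝕜))) f.1) x (Pi.single j 1) :=
  extendZero_coe _ (⟨x, hx⟩ : (D : Set (Fin u → 𝕜)))

/-- Partial derivatives commute. -/
theorem partialDeriv_comm (i j : Fin u) (f : smoothFunctions D) :
    partialDeriv D i (partialDeriv D j f) = partialDeriv D j (partialDeriv D i f) := by
  apply Subtype.ext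
  funext x
  have hnhds := D.isOpen.mem_nhds x.2
  have hd : DifferentiableAt 𝕜 (fderiv 𝕜 (extendZero (D := (D : Set (Fin u → 𝕜))) f.1)) x :=
    (((contDiffOn_extendZero f).fderiv_of_isOpen D.isOpen (m := ∞) (by simp)).contDiffAt
      hnhds).differentiableAt (by simp)
  have key : ∀ i j : Fin u, (partialDeriv D i (partialDeriv D j f)).1 x =
      fderiv 𝕜 (fderiv 𝕜 (extendZero (D := (D : Set (Fin u → 𝕜))) f.1)) x (Pi.single i 1)
        (Pi.single j 1) := by
    intro i j
    change fderiv 𝕜 (extendZero (D := (D : Set (Fin u → 𝕜))) (partialDeriv D j f).1) x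
      (Pi.single i 1) = _
    rw [hasFDerivAt_of_eqOn (partialDeriv D j f) x
      (hd.hasFDerivAt.clm_apply (hasFDerivAt_const (Pi.single j 1) _)) (fun y => rfl)]
    simp
  rw [key, key]
  refine (((contDiffOn_extendZero f).contDiffAt hnhds).isSymmSndFDerivAt ?_) _ _
  rw [minSmoothness_of_isRCLikeNormedField]
  exact WithTop.coe_le_coe.2 le_top

/-- The average `∫₀¹ tᵐ f(x₁, …, t xₛ, …, xᵤ) dt`. -/
noncomputable def averageFun (m : ℕ) (s : Fin u) (f : smoothFunctions D) (x : Fin u → 𝕜) : 𝕜 :=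
  ∫ t in (0 : ℝ)..1, (t : 𝕜) ^ m *
    extendZero (D := (D : Set (Fin u → 𝕜))) f.1 (scaleCoord 𝕜 s (t : 𝕜) x)

variable (hD : IsReinhardtDisk 𝕜 (D : Set (Fin u → 𝕜)))
include hD

theorem continuousOn_scale (m : ℕ) (s : Fin u) {G : Type*} [NormedAddCommGroup G] [NormedSpace 𝕜 G]
    {g : (Fin u → 𝕜) → G} (hg : ContinuousOn g D) :
    ContinuousOn (fun p : ℝ × (Fin u → 𝕜) => (p.1 : 𝕜) ^ m • g (scaleCoord 𝕜 s (p.1 : 𝕜) p.2))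
      (Set.Icc 0 1 ×ˢ (D : Set (Fin u → 𝕜))) :=
  (((RCLike.continuous_ofReal.comp continuous_fst).pow m).continuousOn).smul
    (hg.comp (continuous_scaleCoord s).continuousOn fun _ hp => hD.scaleCoord_mem s hp.1 hp.2)

theorem intervalIntegrable_average (m : ℕ) (s : Fin u) (f : smoothFunctions D) {x : Fin u → 𝕜}
    (hx : x ∈ D) : IntervalIntegrable (fun t : ℝ => (t : 𝕜) ^ m *
      extendZero (D := (D : Set (Fin u → 𝕜))) f.1 (scaleCoord 𝕜 s (t : 𝕜) x))
      MeasureTheory.volume 0 1 := by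
  refine ContinuousOn.intervalIntegrable ?_
  rw [Set.uIcc_of_le zero_le_one]
  exact (continuousOn_scale hD m s (contDiffOn_extendZero f).continuousOn).comp
    (Continuous.prodMk_left x).continuousOn fun t ht => ⟨ht, hx⟩

/-- Differentiation under the integral sign. -/
theorem exists_hasFDerivAt_averageFun (m : ℕ) (s : Fin u) (f : smoothFunctions D)
    {x : Fin u → 𝕜} (hx : x ∈ D) :
    ∃ f' : (Fin u → 𝕜) →L[𝕜] 𝕜, HasFDerivAt (averageFun m s f) f' x ∧
      ∀ j, f' (Pi.single j 1) =
        averageFun (if j = s then m + 1 else m) s (partialDeriv D j f) x := by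
  let F := extendZero (D := (D : Set (Fin u → 𝕜))) f.1
  have hF : ContDiffOn 𝕜 ∞ F D := contDiffOn_extendZero f
  have hF1 : ContinuousOn (fderiv 𝕜 F) D :=
    (hF.fderiv_of_isOpen D.isOpen (m := ∞) (by simp)).continuousOn
  let F' : (Fin u → 𝕜) → ℝ → (Fin u → 𝕜) →L[𝕜] 𝕜 := fun y t =>
    ((t : 𝕜) ^ m • fderiv 𝕜 F (scaleCoord 𝕜 s (t : 𝕜) y)).comp (scaleCoord 𝕜 s (t : 𝕜))
  have hF'c : ContinuousOn (fun p : ℝ × (Fin u → 𝕜) => F' p.2 p.1)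
      (Set.Icc 0 1 ×ˢ (D : Set (Fin u → 𝕜))) :=
    (continuousOn_scale hD m s hF1).clm_comp
      ((continuous_scaleCoord_clm s).comp continuous_fst).continuousOn
  -- the derivative of the integrand is bounded near `x` by compactness
  obtain ⟨ε, hε, hεD⟩ := Metric.nhds_basis_closedBall.mem_iff.1 (D.isOpen.mem_nhds hx)
  obtain ⟨C, hC⟩ := ((isCompact_Icc (a := (0 : ℝ)) (b := 1)).prod
    (isCompact_closedBall x ε)).exists_bound_of_continuousOn
    (hF'c.mono (Set.prod_mono subset_rfl hεD))
  have hι : ∀ t : ℝ, t ∈ Set.uIoc (0 : ℝ) 1 → t ∈ Set.Icc (0 : ℝ) 1 := fun t ht => by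
    rw [Set.uIoc_of_le zero_le_one] at ht
    exact Set.Ioc_subset_Icc_self ht
  have hF'int : IntervalIntegrable (F' x) MeasureTheory.volume 0 1 := by
    refine ContinuousOn.intervalIntegrable ?_
    rw [Set.uIcc_of_le zero_le_one]
    exact hF'c.comp (Continuous.prodMk_left x).continuousOn fun t ht => ⟨ht, hx⟩
  have key := intervalIntegral.hasFDerivAt_integral_of_dominated_of_fderiv_le
    (μ := MeasureTheory.volume) (a := 0) (b := 1)
    (F := fun y t => (t : 𝕜) ^ m * F (scaleCoord 𝕜 s (t : 𝕜) y)) (F' := F') (x₀ := x)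
    (s := Metric.closedBall x ε) (bound := fun _ => C) (Metric.closedBall_mem_nhds x hε)
    (by
      filter_upwards [D.isOpen.mem_nhds hx] with y hy
      exact (intervalIntegrable_average hD m s f hy).def'.aestronglyMeasurable)
    (intervalIntegrable_average hD m s f hx) hF'int.def'.aestronglyMeasurable
    (Filter.Eventually.of_forall fun t ht y hy => hC (t, y) ⟨hι t ht, hy⟩)
    intervalIntegrable_const
    (Filter.Eventually.of_forall fun t ht y hy => by
      have h1 : HasFDerivAt F (fderiv 𝕜 F (scaleCoord 𝕜 s (t : 𝕜) y)) (scaleCoord 𝕜 s (t : 𝕜) y) :=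
        (differentiableAt f ⟨_, hD.scaleCoord_mem s (hι t ht) (hεD hy)⟩).hasFDerivAt
      have h2 := (h1.comp y (scaleCoord 𝕜 s (t : 𝕜)).hasFDerivAt).const_mul ((t : 𝕜) ^ m)
      exact h2)
  refine ⟨_, key, fun j => ?_⟩
  rw [ContinuousLinearMap.intervalIntegral_apply hF'int, averageFun]
  refine intervalIntegral.integral_congr fun t ht => ?_
  rw [Set.uIcc_of_le zero_le_one] at ht
  dsimp only [F']
  rw [ContinuousLinearMap.comp_apply, scaleCoord_single, map_smul, smul_apply,
    extendZero_partialDeriv j f (hD.scaleCoord_mem s ht hx), smul_eq_mul, smul_eq_mul]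
  split_ifs
  · rw [pow_succ']; ring
  · rw [one_mul]

theorem contDiffOn_averageFun (n : ℕ) (m : ℕ) (s : Fin u) (f : smoothFunctions D) :
    ContDiffOn 𝕜 n (averageFun m s f) D := by
  induction n generalizing m f with
  | zero =>
    rw [Nat.cast_zero, contDiffOn_zero]
    intro x hx
    obtain ⟨f', h, -⟩ := exists_hasFDerivAt_averageFun hD m s f hx
    exact h.continuousAt.continuousWithinAt
  | succ n ih =>
    rw [Nat.cast_succ, contDiffOn_succ_iff_fderiv_of_isOpen D.isOpen]
    refine ⟨fun x hx => ?_, by simp, ?_⟩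
    · obtain ⟨f', h, -⟩ := exists_hasFDerivAt_averageFun hD m s f hx
      exact h.differentiableAt.differentiableWithinAt
    · rw [contDiffOn_clm_apply]
      intro y
      have h1 : ContDiffOn 𝕜 n (fun x => ∑ j, y j *
          averageFun (if j = s then m + 1 else m) s (partialDeriv D j f) x) D :=
        ContDiffOn.sum fun j _ => contDiffOn_const.mul (ih _ _)
      refine h1.congr fun x hx => ?_
      obtain ⟨f', h, hj⟩ := exists_hasFDerivAt_averageFun hD m s f hx
      rw [h.fderiv]
      conv_lhs => rw [← Finset.univ_sum_single y, map_sum]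
      refine Finset.sum_congr rfl fun j _ => ?_
      have : (Pi.single j (y j) : Fin u → 𝕜) = y j • Pi.single j 1 := by
        rw [← Pi.single_smul, smul_eq_mul, mul_one]
      rw [this, map_smul, hj, smul_eq_mul]

/-- The averaging operators `f ↦ ∫₀¹ tᵐ f(x₁, …, t xₛ, …, xᵤ) dt` on smooth functions. -/
noncomputable def average (m : ℕ) (s : Fin u) : smoothFunctions D →ₗ[𝕜] smoothFunctions D where
  toFun f := ⟨fun x => averageFun m s f x, by
    change ContDiffOn 𝕜 ∞ (extendZero (D := (D : Set (Fin u → 𝕜))) _) D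
    refine (contDiffOn_infty.2 fun n => contDiffOn_averageFun hD n m s f).congr fun x hx => ?_
    exact extendZero_coe _ (⟨x, hx⟩ : (D : Set (Fin u → 𝕜)))⟩
  map_add' f g := by
    apply Subtype.ext
    funext x
    change averageFun m s (f + g) x = averageFun m s f x + averageFun m s g x
    rw [averageFun, averageFun, averageFun, ← intervalIntegral.integral_add
      (intervalIntegrable_average hD m s f x.2) (intervalIntegrable_average hD m s g x.2)]
    refine intervalIntegral.integral_congr fun t ht => ?_
    rw [Set.uIcc_of_le zero_le_one] at ht
    have hy := hD.scaleCoord_mem s ht x.2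
    simp only [extendZero_coe _ (⟨_, hy⟩ : (D : Set (Fin u → 𝕜)))]
    exact mul_add _ _ _
  map_smul' c f := by
    apply Subtype.ext
    funext x
    change averageFun m s (c • f) x = c * averageFun m s f x
    rw [averageFun, averageFun, ← intervalIntegral.integral_const_mul]
    refine intervalIntegral.integral_congr fun t ht => ?_
    rw [Set.uIcc_of_le zero_le_one] at ht
    have hy := hD.scaleCoord_mem s ht x.2
    simp only [extendZero_coe _ (⟨_, hy⟩ : (D : Set (Fin u → 𝕜)))]
    exact mul_left_comm _ _ _

theorem partialDeriv_average (m : ℕ) (s j : Fin u) (f : smoothFunctions D) :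
    partialDeriv D j (average hD m s f) =
      average hD (if j = s then m + 1 else m) s (partialDeriv D j f) := by
  apply Subtype.ext
  funext x
  obtain ⟨f', h, hj⟩ := exists_hasFDerivAt_averageFun hD m s f x.2
  change fderiv 𝕜 (extendZero (D := (D : Set (Fin u → 𝕜))) (average hD m s f).1) x
    (Pi.single j 1) = averageFun _ s _ x
  rw [hasFDerivAt_of_eqOn (average hD m s f) x h (fun y => rfl), hj]

theorem average_coord_mul (m : ℕ) (s j : Fin u) (f : smoothFunctions D) :
    average hD m s (coord D j * f) =
      coord D j * average hD (if j = s then m + 1 else m) s f := by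
  apply Subtype.ext
  funext x
  change averageFun m s (coord D j * f) x = (x : Fin u → 𝕜) j * averageFun _ s f x
  rw [averageFun, averageFun, ← intervalIntegral.integral_const_mul]
  refine intervalIntegral.integral_congr fun t ht => ?_
  rw [Set.uIcc_of_le zero_le_one] at ht
  have hy := hD.scaleCoord_mem s ht x.2
  simp only [extendZero_coe _ (⟨_, hy⟩ : (D : Set (Fin u → 𝕜)))]
  change (t : 𝕜) ^ m * (scaleCoord 𝕜 s (t : 𝕜) x j * _) = _
  rw [scaleCoord_apply]
  split_ifs
  · rw [pow_succ']; ring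
  · ring

/-- The fundamental theorem of calculus along the `s`-th coordinate axis, applied to
`t ↦ t f(x₁, …, t xₛ, …, xᵤ)`. -/
theorem average_add_coord_mul_average (s : Fin u) (f : smoothFunctions D) :
    average hD 0 s f + coord D s * average hD 1 s (partialDeriv D s f) = f := by
  apply Subtype.ext
  funext x
  change averageFun 0 s f x + (x : Fin u → 𝕜) s * averageFun 1 s (partialDeriv D s f) x = f.1 x
  let F := extendZero (D := (D : Set (Fin u → 𝕜))) f.1
  have hderiv : ∀ t ∈ Set.uIcc (0 : ℝ) 1, HasDerivAt
      (fun t : ℝ => (t : 𝕜) * F (scaleCoord 𝕜 s (t : 𝕜) x))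
      ((t : 𝕜) ^ 0 * F (scaleCoord 𝕜 s (t : 𝕜) x) + (x : Fin u → 𝕜) s * ((t : 𝕜) ^ 1 *
        extendZero (D := (D : Set (Fin u → 𝕜))) (partialDeriv D s f).1
          (scaleCoord 𝕜 s (t : 𝕜) x))) t := by
    intro t ht
    rw [Set.uIcc_of_le zero_le_one] at ht
    have hy := hD.scaleCoord_mem s ht x.2
    have h1 : HasDerivAt (fun t : ℝ => scaleCoord 𝕜 s (t : 𝕜) x)
        ((x : Fin u → 𝕜) s • Pi.single s 1) t := by
      rw [hasDerivAt_pi]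
      intro j
      simp only [scaleCoord_apply, Pi.smul_apply, smul_eq_mul]
      split_ifs with hj
      · subst hj
        simpa [mul_comm] using (RCLike.ofRealCLM (K := 𝕜).hasDerivAt (x := t)).mul_const
          ((x : Fin u → 𝕜) j)
      · simpa [Pi.single_eq_of_ne hj] using hasDerivAt_const t ((x : Fin u → 𝕜) j)
    have h2 : HasFDerivAt F ((fderiv 𝕜 F (scaleCoord 𝕜 s (t : 𝕜) x)).restrictScalars ℝ)
        (scaleCoord 𝕜 s (t : 𝕜) x) :=
      (differentiableAt f ⟨_, hy⟩).hasFDerivAt.restrictScalars ℝ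
    have h3 := (RCLike.ofRealCLM (K := 𝕜).hasDerivAt (x := t)).mul (h2.comp_hasDerivAt t h1)
    refine h3.congr_deriv ?_
    rw [extendZero_partialDeriv s f hy, ContinuousLinearMap.coe_restrictScalars', map_smul]
    simp
    ring
  have hint0 := intervalIntegrable_average hD 0 s f x.2
  have hint1 := (intervalIntegrable_average hD 1 s (partialDeriv D s f) x.2).const_mul
    ((x : Fin u → 𝕜) s)
  have key := intervalIntegral.integral_eq_sub_of_hasDerivAt hderiv (hint0.add hint1)
  rw [intervalIntegral.integral_add hint0 hint1, intervalIntegral.integral_const_mul] at key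
  rw [averageFun, averageFun]
  refine key.trans ?_
  simp only [RCLike.ofReal_one, one_mul, RCLike.ofReal_zero, zero_mul, sub_zero, scaleCoord_one, F]
  exact extendZero_coe _ x

omit hD in
theorem partialDeriv_coord (s j : Fin u) :
    partialDeriv D s (coord D j) = if j = s then 1 else 0 := by
  apply Subtype.ext
  funext x
  change fderiv 𝕜 (extendZero (D := (D : Set (Fin u → 𝕜))) (coord D j).1) x (Pi.single s 1) = _
  rw [hasFDerivAt_of_eqOn (coord D j) x
    (ContinuousLinearMap.proj (R := 𝕜) (φ := fun _ : Fin u => 𝕜) j).hasFDerivAt (fun y => rfl),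
    ContinuousLinearMap.proj_apply]
  split_ifs with h
  · rw [h, Pi.single_eq_same]; rfl
  · rw [Pi.single_eq_of_ne h]; rfl

omit hD in
theorem partialDeriv_coord_mul (s j : Fin u) (f : smoothFunctions D) :
    partialDeriv D s (coord D j * f) =
      (if j = s then f else 0) + coord D j * partialDeriv D s f := by
  rw [Derivation.leibniz, partialDeriv_coord, smul_eq_mul, smul_eq_mul, add_comm]
  split_ifs <;> simp

theorem partialDeriv_coord_mul_average (s : Fin u) (f : smoothFunctions D) :
    partialDeriv D s (coord D s * average hD 0 s f) = f := by
  rw [partialDeriv_coord_mul, if_pos rfl, partialDeriv_average, if_pos rfl, zero_add,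
    average_add_coord_mul_average]

theorem average_partialDeriv_coord_mul (s : Fin u) (f : smoothFunctions D) :
    average hD 0 s (partialDeriv D s (coord D s * f)) = f := by
  rw [partialDeriv_coord_mul, if_pos rfl, map_add, average_coord_mul, if_pos rfl, zero_add,
    average_add_coord_mul_average]

/-- Integration operators on smooth functions. With `I f = ∫₀¹ f(x₁, …, t xₛ, …, xᵤ) dt`, the
operator `zₛ I` is a right inverse of `∂ₛ`, and `I` is a two-sided inverse of `∂ₛ zₛ`, so that
`zₛ I² ∂ₛ` is a quasi-inverse of `zₛ ∂ₛ`. -/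
noncomputable def integration (v : ℕ) (s : Fin u) : smoothFunctions D →ₗ[𝕜] smoothFunctions D :=
  if (s : ℕ) < v then
    LinearMap.mulLeft 𝕜 (coord D s) ∘ₗ average hD 0 s ∘ₗ average hD 0 s ∘ₗ
      (partialDeriv D s : smoothFunctions D →ₗ[𝕜] smoothFunctions D)
  else LinearMap.mulLeft 𝕜 (coord D s) ∘ₗ average hD 0 s

theorem integration_of_lt {v : ℕ} {s : Fin u} (hs : (s : ℕ) < v) (f : smoothFunctions D) :
    integration hD v s f =
      coord D s * average hD 0 s (average hD 0 s (partialDeriv D s f)) := by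
  rw [integration, if_pos hs]; rfl

theorem integration_of_le {v : ℕ} {s : Fin u} (hs : v ≤ (s : ℕ)) (f : smoothFunctions D) :
    integration hD v s f = coord D s * average hD 0 s f := by
  rw [integration, if_neg (not_lt.2 hs)]; rfl

omit hD in
theorem logDerivation_of_lt {v : ℕ} {s : Fin u} (hs : (s : ℕ) < v) (f : smoothFunctions D) :
    logDerivation (coord D) (partialDeriv D) v s f = coord D s * partialDeriv D s f := by
  rw [logDerivation, if_pos hs]; rfl

omit hD in
theorem logDerivation_of_le {v : ℕ} {s : Fin u} (hs : v ≤ (s : ℕ)) (f : smoothFunctions D) :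
    logDerivation (coord D) (partialDeriv D) v s f = partialDeriv D s f := by
  rw [logDerivation, if_neg (not_lt.2 hs)]

theorem logIntegration (v : ℕ) :
    LogIntegration (coord D) (partialDeriv D) v (integration hD v) where
  deriv_comm s t f := by
    rcases eq_or_ne s t with rfl | hst
    · rfl
    rcases Nat.lt_or_ge (s : ℕ) v with hs | hs <;> rcases Nat.lt_or_ge (t : ℕ) v with ht | ht <;>
      simp only [logDerivation_of_lt, logDerivation_of_le, hs, ht, partialDeriv_coord_mul, hst,
        hst.symm, if_false, zero_add, partialDeriv_comm s t]
    exact mul_left_comm _ _ _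
  deriv_int s t hst f := by
    have h1 : ∀ g, partialDeriv D s (average hD 0 t g) = average hD 0 t (partialDeriv D s g) :=
      fun g => by rw [partialDeriv_average, if_neg hst]
    have h2 : ∀ g, average hD 0 t (coord D s * g) = coord D s * average hD 0 t g :=
      fun g => by rw [average_coord_mul, if_neg hst]
    rcases Nat.lt_or_ge (s : ℕ) v with hs | hs <;> rcases Nat.lt_or_ge (t : ℕ) v with ht | ht <;>
      simp only [logDerivation_of_lt, logDerivation_of_le, integration_of_lt, integration_of_le,
        hs, ht, partialDeriv_coord_mul, hst, hst.symm, if_false, zero_add, h1, h2,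
        partialDeriv_comm s t]
    · exact mul_left_comm _ _ _
    · exact mul_left_comm _ _ _
  deriv_int_deriv s f := by
    rcases Nat.lt_or_ge (s : ℕ) v with hs | hs
    · simp only [logDerivation_of_lt hs, integration_of_lt hD hs, average_partialDeriv_coord_mul,
        partialDeriv_coord_mul_average]
    · simp only [logDerivation_of_le hs, integration_of_le hD hs, partialDeriv_coord_mul_average]
  int_comm s hs f := by
    simp only [logDerivation_of_lt hs, integration_of_lt hD hs, average_partialDeriv_coord_mul,
      partialDeriv_coord_mul_average]
  deriv_int_self s hs f := by
    rw [logDerivation_of_le hs, integration_of_le hD hs, partialDeriv_coord_mul_average]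

theorem eq_algebraMap_of_logDerivation_eq_zero (v : ℕ) (f : smoothFunctions D)
    (hf : ∀ s, logDerivation (coord D) (partialDeriv D) v s f = 0) :
    ∃ c, f = algebraMap 𝕜 (smoothFunctions D) c := by
  -- all partial derivatives vanish since `∂ₛ zₛ` is injective
  have h1 : ∀ s, partialDeriv D s f = 0 := fun s => by
    rcases Nat.lt_or_ge (s : ℕ) v with hs | hs
    · rw [← average_partialDeriv_coord_mul hD s (partialDeriv D s f), ← logDerivation_of_lt hs, hf,
        map_zero, map_zero]
    · rw [← logDerivation_of_le hs, hf]
  refine ⟨f.1 ⟨0, hD.zero_mem⟩, Subtype.ext (funext fun x => ?_)⟩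
  change f.1 x = f.1 ⟨0, hD.zero_mem⟩
  have h2 := D.isOpen.is_const_of_fderiv_eq_zero hD.isPreconnected
    (fun y hy => (differentiableAt f ⟨y, hy⟩).differentiableWithinAt) (fun y hy => by
      refine ContinuousLinearMap.coe_injective ((Pi.basisFun 𝕜 (Fin u)).ext fun j => ?_)
      rw [Pi.basisFun_apply]
      exact congrFun (congrArg Subtype.val (h1 j)) ⟨y, hy⟩) x.2 hD.zero_mem
  rw [extendZero_coe f.1 x] at h2
  exact h2.trans (extendZero_coe f.1 ⟨0, hD.zero_mem⟩)

/-- The algebra of closed logarithmic forms on a disk is Koszul. -/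
theorem isKoszul_closedGrading (v : ℕ) :
    IsKoszul (closedGrading (coord D) (partialDeriv D) v) := by
  have : Nonempty D := ⟨⟨0, hD.zero_mem⟩⟩
  exact _root_.isKoszul_closedGrading (logIntegration hD v)
    (eq_algebraMap_of_logDerivation_eq_zero hD v)

end smoothFunctions

end SmoothDisk

/-! ### Koszulity of closed logarithmic forms on disks -/

theorem mainTheorem1 :
    -- algebraic affine space in characteristic zero
    (∀ (k : Type*) [Field k] [CharZero k] (u v : ℕ), v ≤ u →
      IsKoszul (closedGrading (k := k) (O := MvPolynomial (Fin u) k)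
        MvPolynomial.X MvPolynomial.pderiv v)) ∧
    -- formal disk in characteristic zero
    (∀ (k : Type*) [Field k] [CharZero k] (u v : ℕ), v ≤ u →
      IsKoszul (closedGrading (k := k) (O := MvPowerSeries (Fin u) k)
        MvPowerSeries.X (MvPowerSeries.pderiv k) v)) ∧
    -- complex analytic disk
    (∀ (u v : ℕ), v ≤ u → ∀ D : TopologicalSpace.Opens (Fin u → ℂ),
      IsReinhardtDisk ℂ (D : Set (Fin u → ℂ)) →
      IsKoszul (closedGrading (k := ℂ) (O := smoothFunctions D)
        (smoothFunctions.coord D) (smoothFunctions.partialDeriv D) v)) ∧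
    -- smooth real disk
    (∀ (u v : ℕ), v ≤ u → ∀ D : TopologicalSpace.Opens (Fin u → ℝ),
      IsReinhardtDisk ℝ (D : Set (Fin u → ℝ)) →
      IsKoszul (closedGrading (k := ℝ) (O := smoothFunctions D)
        (smoothFunctions.coord D) (smoothFunctions.partialDeriv D) v)) ∧
    -- polynomials with divided powers in prime characteristic
    (∀ (p : ℕ) [Fact p.Prime] (k : Type*) [Field k] [CharP k p] (u v : ℕ), v ≤ u →
      IsKoszul (connectedGrading (closedGrading (k := k) (O := DPPolynomial u k)
        DPPolynomial.coord DPPolynomial.partialDeriv v)) ∧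
      (v = 0 → IsKoszul (closedGrading (k := k) (O := DPPolynomial u k)
        DPPolynomial.coord DPPolynomial.partialDeriv v))) ∧
    -- formal power series with divided powers in prime characteristic
    (∀ (p : ℕ) [Fact p.Prime] (k : Type*) [Field k] [CharP k p] (u v : ℕ), v ≤ u →
      IsKoszul (connectedGrading (closedGrading (k := k) (O := DPSeries u k)
        DPSeries.coord DPSeries.partialDeriv v)) ∧
      (v = 0 → IsKoszul (closedGrading (k := k) (O := DPSeries u k)
        DPSeries.coord DPSeries.partialDeriv v))) := by
  refine ⟨fun k _ _ u v _ => ?_, fun k _ _ u v _ => ?_, fun u v _ D hD => ?_, fun u v _ D hD => ?_,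
    fun p _ k _ _ u v _ => ⟨?_, fun hv => ?_⟩, fun p _ k _ _ u v _ => ⟨?_, fun hv => ?_⟩⟩
  · exact MvPolynomial.monomialExpansion.isKoszul_closedGrading (Or.inr inferInstance)
  · exact MvPowerSeries.monomialExpansion.isKoszul_closedGrading (Or.inr inferInstance)
  · exact smoothFunctions.isKoszul_closedGrading hD v
  · exact smoothFunctions.isKoszul_closedGrading hD v
  · exact DPPolynomial.monomialExpansion.isKoszul_connectedGrading v
  · exact DPPolynomial.monomialExpansion.isKoszul_closedGrading (Or.inl hv)
  · exact DPSeries.monomialExpansion.isKoszul_connectedGrading v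
  · exact DPSeries.monomialExpansion.isKoszul_closedGrading (Or.inl hv)
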